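/- **Setting.** Let $X$ be a locally compact, $\sigma$-compact metric space with a positive Radon measure $\mu$ such that $\operatorname{supp}\mu=X$, and let $L_2(X)=L_2(X,\mu)$ be real. Let $\mathcal E$ be a Dirichlet form on $L_2(X)$ (a densely defined, symmetric, positive, closed form with $0\vee\varphi\wedge 1\in D(\mathcal E)$ and $\mathcal E(0\vee\varphi\wedge 1)\le\mathcal E(\varphi)$ for all $\varphi\in D(\mathcal E)$), where $\mathcal E(\varphi)=\mathcal E(\varphi,\varphi)$ and $\|\varphi\|_{D(\mathcal E)}^2=\|\varphi\|_2^2+\mathcal E(\varphi)$. Assume that $\mathcal E$ is *regular*, i.e. $D(\mathcal E)\cap C_c(X)$ is dense in $D(\mathcal E)$ with the norm $\|\cdot\|_{D(\mathcal E)}$ and in $C_0(X)$ with the supremum norm, and *strongly local*, i.e. $\mathcal E(\varphi,\psi)=0$ for all $\varphi,\psi\in D(\mathcal E)$ and $a\in\mathbf R$ with $(\varphi+a)\psi=0$ a.e. Let $\Omega\subseteq X$ be open, and identify $L_2(\Omega)$ with $\{\varphi\in L_2(X):\varphi=0\text{ a.e. on }X\setminus\Omega\}$. * For $A\subseteq\overline\Omega$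 let $\operatorname{cap}_\Omega(A)\in[0,\infty]$ be the infimum of $\|\varphi\|_{D(\mathcal E)}^2$ over all $\varphi\in D(\mathcal E)$ for which there is an open $V\subseteq X$ with $A\subseteq V$ and $\varphi\ge1$ a.e. on $V\cap\Omega$. * $\mathcal E_D$ is the form on $L_2(\Omega)$ that is the restriction of $\mathcal E$ to the closure, in the norm $\|\cdot\|_{D(\mathcal E)}$, of $\{\varphi\in D(\mathcal E):\operatorname{supp}\varphi\text{ is a compact subset of }\Omega\}$. Let $S^D$ be the semigroup on $L_2(\Omega)$ associated with $\mathcal E_D$. * For $\chi\in D(\mathcal E)\cap L_\infty(X)$ with $\chi\ge0$ set $\mathcal E_\chi(\varphi)=\mathcal E(\chi\varphi,\varphi)-\tfrac12\mathcal E(\chi,\varphi^2)$ for $\varphi\in D(\mathcal E)\cap L_\infty(X)$, and extend $\mathcal E_\chi$ to $D(\mathcal E)$ by continuity in the norm $\|\cdot\|_{D(\mathcal E)}$. Let $\mathcal E_N$ be the form on $L_2(X)$ with domain $D(\mathcal E_N)=D(\mathcal E)$ and $$\mathcal E_N(\varphi)=\sup\{\mathcal E_\chi(\varphi):\chi\in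 D(\mathcal E)\cap L_\infty(X),\ 0\le\chi\le\mathbb 1_\Omega\}.$$ Let $\widehat{\mathcal E_N}$ be the relaxation (lower semicontinuous regularization on $L_2(X)$) of $\mathcal E_N$, where $\mathcal E_N$ is given the value $\infty$ off $D(\mathcal E)$, and let $S^N$ be the semigroup on $L_2(X)$ associated with $\widehat{\mathcal E_N}$. Here the semigroup associated with a closed, densely defined, positive form is $(e^{-tH})_{t>0}$, with $H$ the positive self-adjoint operator of the form. **Theorem 3.7.** The following conditions are equivalent. 1. $\operatorname{cap}_\Omega(\partial\Omega)=0$. 2. $S^D_t\varphi=S^N_t\varphi$ for all $\varphi\in L_2(\Omega)$ and all $t>0$. -/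

import Mathlib

open MeasureTheory Filter Topology Set
open scoped ENNReal ZeroAtInfty

noncomputable section

/-! ### Quadratic forms on a real Hilbert space and their semigroups

A (not necessarily densely defined or closed) positive quadratic form `t` is encoded as the
function with value `t(u)` on its domain and value `∞` off its domain. -/

namespace QForm

variable {K : Type*} [NormedAddCommGroup K] [InnerProductSpace ℝ K]

/-- The bilinear form of a quadratic form, by polarization (used on the domain `{q ≠ ∞}`). -/
def polar (q : K → ℝ≥0∞) (u v : K) : ℝ :=
  ((q (u + v)).toReal - (q (u - v)).toReal) / 4

/-- The graph of the operator `H` associated with the form `q`: `u ∈ D(H)` and `H u = f`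
if and only if `u ∈ D(q)` and `q(u, v) = (f, v)` for all `v ∈ D(q)`. -/
def IsAssocOp (q : K → ℝ≥0∞) (u f : K) : Prop :=
  q u ≠ ∞ ∧ ∀ v, q v ≠ ∞ → polar q u v = inner ℝ f v

/-- `R = (l I + H)⁻¹`, that is, `R f ∈ D(H)` and `H (R f) = f - l R f` for all `f`. -/
def IsResolvent (q : K → ℝ≥0∞) (l : ℝ) (R : K →L[ℝ] K) : Prop :=
  ∀ f, IsAssocOp q (R f) (f - l • R f)

open Classical in
/-- The resolvent `(l I + H)⁻¹` of the operator `H` associated with a form. It exists (and is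
unique) for every `l > 0` if the form is closed and the space is complete. -/
def formResolvent (q : K → ℝ≥0∞) (l : ℝ) : K →L[ℝ] K :=
  if h : ∃ R : K →L[ℝ] K, IsResolvent q l R then h.choose else 0

/-- The Yosida approximation `H_l = l (I - l (l I + H)⁻¹) = l H (l I + H)⁻¹`, a bounded
operator. -/
def yosida (q : K → ℝ≥0∞) (l : ℝ) : K →L[ℝ] K :=
  l • (1 - l • formResolvent q l)

/-- The semigroup `exp (-t H)` generated by `-H`, where `H` is the operator associated with the
(closed, densely defined) form `q`: the strong limit of `exp (-t H_n)`, with `H_n` the Yosida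
approximations of `H` (the Hille-Yosida construction). -/
def semigroup (q : K → ℝ≥0∞) (t : ℝ) (f : K) : K :=
  limUnder atTop fun n : ℕ => NormedSpace.exp ((-t) • yosida q (n : ℝ)) f

/-- The relaxation of a quadratic form: its lower semicontinuous regularization, the largest
lower semicontinuous function below `q`. -/
def relaxation (q : K → ℝ≥0∞) (u : K) : ℝ≥0∞ :=
  liminf q (𝓝 u)

end QForm

/-! ### Real `L₂` spaces -/

variable {X : Type*} [MeasurableSpace X]

/-- The real Hilbert space `L₂(X)`. -/
abbrev L2 (μ : Measure X) : Type _ := Lp ℝ 2 μ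

/-- `L₂(Ω)` as the subspace of those elements of `L₂(X)` that vanish a.e. off `Ω`. -/
def L2On (μ : Measure X) (Ω : Set X) : Submodule ℝ (L2 μ) where
  carrier := {f | ∀ᵐ x ∂μ, x ∉ Ω → f x = 0}
  add_mem' := by
    intro f g hf hg
    filter_upwards [hf, hg, Lp.coeFn_add f g] with x h1 h2 h3 hx
    rw [h3, Pi.add_apply, h1 hx, h2 hx, add_zero]
  zero_mem' := by
    filter_upwards [Lp.coeFn_zero ℝ 2 μ] with x h _
    rw [h, Pi.zero_apply]
  smul_mem' := by
    intro c f hf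
    filter_upwards [hf, Lp.coeFn_smul c f] with x h1 h2 hx
    rw [h2, Pi.smul_apply, h1 hx, smul_zero]

open Classical in
/-- The class in `L₂(X)` of a square-integrable function (`0` if it is not one). -/
def toL2 (μ : Measure X) (f : X → ℝ) : L2 μ :=
  if h : MemLp f 2 μ then h.toLp f else 0

/-- The support of a class of functions: the complement of the largest open set on which the
class vanishes almost everywhere. -/
def aeSupport [TopologicalSpace X] {μ : Measure X} (f : L2 μ) : Set X :=
  {x | ∀ U ∈ 𝓝 x, ¬ ∀ᵐ y ∂μ, y ∈ U → f y = 0}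

/-! ### Dirichlet forms -/

/-- A (symmetric, densely defined, closed, Markovian) Dirichlet form on `L₂(X)`. -/
structure DirichletForm (μ : Measure X) where
  domain : Submodule ℝ (L2 μ)
  form : domain →ₗ[ℝ] domain →ₗ[ℝ] ℝ
  dense_domain : Dense (domain : Set (L2 μ))
  symm : ∀ u v, form u v = form v u
  nonneg : ∀ u, 0 ≤ form u u
  /-- The domain is complete for the graph norm. -/
  closed : ∀ u : ℕ → domain,
    (∀ ε : ℝ, 0 < ε → ∃ N, ∀ m, N ≤ m → ∀ n, N ≤ n →
      ‖u m - u n‖ ^ 2 + form (u m - u n) (u m - u n) < ε) →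
    ∃ v : domain,
      Tendsto (fun n => ‖u n - v‖ ^ 2 + form (u n - v) (u n - v)) atTop (𝓝 0)
  /-- If `ψ = 0 ∨ φ ∧ 1` with `φ` in the domain then `ψ` is in the domain and
  `E(ψ) ≤ E(φ)`. -/
  markov : ∀ φ : domain, ∀ ψ : L2 μ,
    (∀ᵐ x ∂μ, ψ x = max 0 (min ((φ : L2 μ) x) 1)) →
    ∃ h : ψ ∈ domain, form ⟨ψ, h⟩ ⟨ψ, h⟩ ≤ form φ φ

namespace DirichletForm

variable {μ : Measure X} (E : DirichletForm μ)

open Classical in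
/-- `E(φ, ψ)` for `φ, ψ ∈ D(E)` (and `0` otherwise). -/
def val (φ ψ : L2 μ) : ℝ :=
  if h : φ ∈ E.domain ∧ ψ ∈ E.domain then E.form ⟨φ, h.1⟩ ⟨ψ, h.2⟩ else 0

/-- The square of the graph norm, `‖φ‖²_{D(E)} = ‖φ‖₂² + E(φ)`, for `φ ∈ D(E)`. -/
def normSq (φ : L2 μ) : ℝ := ‖φ‖ ^ 2 + E.val φ φ

/-- `E` is regular: `D(E) ∩ C_c(X)` is dense in `D(E)` with the graph norm and in `C₀(X)` with
the supremum norm. -/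
def IsRegular [TopologicalSpace X] : Prop :=
  (∀ φ ∈ E.domain, ∀ ε : ℝ, 0 < ε → ∃ ψ ∈ E.domain,
    (∃ g : X → ℝ, Continuous g ∧ HasCompactSupport g ∧ ψ =ᵐ[μ] g) ∧
      E.normSq (φ - ψ) < ε) ∧
  Dense {g : C₀(X, ℝ) | HasCompactSupport g ∧ ∃ ψ ∈ E.domain, ψ =ᵐ[μ] g}

/-- `E` is strongly local: `E(φ, ψ) = 0` whenever `(φ + a) ψ = 0` for some real `a`. -/
def IsStronglyLocal : Prop :=
  ∀ φ ∈ E.domain, ∀ ψ ∈ E.domain, ∀ a : ℝ,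
    (∀ᵐ x ∂μ, (φ x + a) * ψ x = 0) → E.val φ ψ = 0

/-- The relative capacity of `A` with respect to `Ω`. -/
def relCap [TopologicalSpace X] (Ω A : Set X) : ℝ≥0∞ :=
  ⨅ φ ∈ {φ : L2 μ | φ ∈ E.domain ∧
      ∃ V : Set X, IsOpen V ∧ A ⊆ V ∧ ∀ᵐ x ∂μ, x ∈ V ∩ Ω → 1 ≤ φ x},
    ENNReal.ofReal (E.normSq φ)

/-! #### Dirichlet boundary conditions -/

/-- `D_Ω`: the elements of `D(E)` whose support is a compact subset of `Ω`. -/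
def compactDomain [TopologicalSpace X] (Ω : Set X) : Set (L2 μ) :=
  {φ | φ ∈ E.domain ∧ IsCompact (aeSupport φ) ∧ aeSupport φ ⊆ Ω}

/-- `D(E_D)`: the closure of `D_Ω` in `D(E)` with respect to the graph norm. -/
def dirichletDomain [TopologicalSpace X] (Ω : Set X) : Set (L2 μ) :=
  {φ | φ ∈ E.domain ∧ ∀ ε : ℝ, 0 < ε → ∃ ψ ∈ E.compactDomain Ω, E.normSq (φ - ψ) < ε}

open Classical in
/-- The form `E_D` on `L₂(Ω)`: the restriction of `E` to the closure of `D_Ω`. -/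
def dirichletPart [TopologicalSpace X] (Ω : Set X) (φ : L2On μ Ω) : ℝ≥0∞ :=
  if (φ : L2 μ) ∈ E.dirichletDomain Ω then ENNReal.ofReal (E.val φ φ) else ∞

/-- The semigroup `S^D` on `L₂(Ω)` associated with `E_D`. -/
def dirichletSemigroup [TopologicalSpace X] (Ω : Set X) (t : ℝ) (φ : L2On μ Ω) : L2On μ Ω :=
  QForm.semigroup (E.dirichletPart Ω) t φ

/-! #### Neumann boundary conditions -/

/-- `D(E) ∩ L_∞(X)`. -/
def boundedDomain : Set (L2 μ) := {φ | φ ∈ E.domain ∧ MemLp φ ∞ μ}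

/-- The truncated form `E_χ(φ) = E(χ φ, φ) - E(χ, φ²) / 2` for `φ ∈ D(E) ∩ L_∞(X)`. -/
def truncBdd (χ φ : L2 μ) : ℝ :=
  E.val (toL2 μ fun x => χ x * φ x) φ - E.val χ (toL2 μ fun x => φ x ^ 2) / 2

/-- The extension of `E_χ` to `D(E)` by continuity: the limit of `E_χ(ψ)` as
`ψ ∈ D(E) ∩ L_∞(X)` tends to `φ` in the graph norm. -/
def trunc (χ φ : L2 μ) : ℝ :=
  limUnder (comap (fun ψ : L2 μ => E.normSq (ψ - φ)) (𝓝 0) ⊓ 𝓟 E.boundedDomain)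
    fun ψ => E.truncBdd χ ψ

/-- `C_Ω = {χ ∈ D(E) ∩ L_∞(X) : 0 ≤ χ ≤ 1_Ω}`. -/
def cutoffs (Ω : Set X) : Set (L2 μ) :=
  {χ | χ ∈ E.boundedDomain ∧ ∀ᵐ x ∂μ, 0 ≤ χ x ∧ χ x ≤ Ω.indicator 1 x}

open Classical in
/-- The form `E_N` on `L₂(X)`, with domain `D(E)`: the supremum of the truncated forms `E_χ`
over `χ ∈ C_Ω`. -/
def neumannPart (Ω : Set X) (φ : L2 μ) : ℝ≥0∞ :=
  if φ ∈ E.domain then ⨆ χ ∈ E.cutoffs Ω, ENNReal.ofReal (E.trunc χ φ) else ∞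

/-- The semigroup `S^N` on `L₂(X)` associated with the relaxation of `E_N`. -/
def neumannSemigroup (Ω : Set X) (t : ℝ) (φ : L2 μ) : L2 μ :=
  QForm.semigroup (QForm.relaxation (E.neumannPart Ω)) t φ

end DirichletForm

end

/-!
For `ψ ∈ D(E)` let `P ψ = 1_Ω ψ`. Both conditions are equivalent to

  `P ψ ∈ D(E_D)` for every `ψ ∈ D(E)`.

*From capacity zero to restrictions.* Let `φ n` be test functions for the boundary of `Ω`, with
values in `[0, 1]` and norms tending to zero. If `ψ ∈ D(E)` is bounded and vanishes off a compact
set, then `P (ψ - ψ φ n)` vanishes off a compact subset of `Ω`, so it is a product with a cutoff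
function and belongs to `D(E_D)` (`restrictL2_mem_compactDomain`). By strong locality `E_N` only
depends on the restriction to `Ω` (`neumannPart_congr`), and `E_N = E` on `D(E_D)`
(`neumannPart_of_mem_dirichletDomain`), so that
`E (P (ψ - ψ φ n)) = E_N (ψ - ψ φ n) ≤ E (ψ - ψ φ n)` remains bounded
(`mul_mem_and_val_le`). Lower semicontinuity of `E_D` in `L₂(X)` gives `P ψ ∈ D(E_D)`, and
regularity extends this to all `ψ ∈ D(E)` (`restrictL2_mem_dirichletDomain`).

*From restrictions to semigroups.* If `P` maps `D(E)` into `D(E_D)` then the relaxation of `E_N` is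
`u ↦ E_D (P u)` (`relaxation_neumannPart_eq`). The operators associated with the two forms then have
the same resolvents on `L₂(Ω)`, and hence the same semigroups (`semigroup_eq_of_restrictL2_mem`).

*From semigroups to restrictions.* Equality of the semigroups on `L₂(Ω)` gives equality of the
resolvents (`QForm.resolvent_eq_of_semigroup_eq`), hence of the approximating forms
`l (u - l (l I + H)⁻¹ u, u)`. As `L₂(Ω)` is invariant, the approximating form of `P ψ` is at most
that of `ψ`, hence at most `E ψ`, so that `P ψ ∈ D(E_D)` (`QForm.ne_top_of_resolvent_eq`).

*From restrictions to capacity zero.* If `ψ` is a cutoff function for a compact set `K` off `Ω` and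
`θ ∈ D(E)` has compact support in `Ω`, then `P ψ - θ` equals one on the part of `Ω` near `K`. As `θ`
can be chosen close to `P ψ`, the capacity of `K` vanishes (`relCap_eq_zero_of_isCompact`). The
boundary of `Ω` is a countable union of compact sets, and capacity zero passes to countable unions
(`relCap_iUnion_eq_zero`).

The form `E_N` is handled through `(f, f - S f)` for the sub-Markovian operators
`S = l (l I + H)⁻¹` associated with `E`: these bounded forms converge to `E`, their truncations
converge to the truncated forms `E_χ`, and truncations of bounded Markovian forms are integrals
against `χ` of a nonnegative density (`IsSubMarkov.truncated_eq`, `tendsto_truncBdd`).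
-/

open MeasureTheory Filter Topology Set
open scoped ENNReal ZeroAtInfty

noncomputable section

namespace QForm

variable {K : Type*} [NormedAddCommGroup K] [InnerProductSpace ℝ K]

/-! ### Quadratic forms: polarization -/

/-- The function `q` is a positive quadratic form with values in `[0, ∞]`: it is homogeneous of
degree two and satisfies the parallelogram law. One inequality suffices for the latter, the other
one follows from it by homogeneity. -/
structure IsQuad (q : K → ℝ≥0∞) : Prop where
  parallelogram_le : ∀ u v, q (u + v) + q (u - v) ≤ 2 * q u + 2 * q v
  map_smul : ∀ (c : ℝ) (u : K), q (c • u) = ENNReal.ofReal (c ^ 2) * q u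

namespace IsQuad

variable {q : K → ℝ≥0∞} (hq : IsQuad q) {u v w : K}
include hq

lemma map_zero : q 0 = 0 := by
  simpa using hq.map_smul 0 0

lemma map_neg (u : K) : q (-u) = q u := by
  simpa using hq.map_smul (-1) u

lemma map_sub_comm (u v : K) : q (u - v) = q (v - u) := by
  rw [← hq.map_neg, neg_sub]

lemma zero_ne_top : q 0 ≠ ∞ := by
  simp [hq.map_zero]

lemma parallelogram (u v : K) : q (u + v) + q (u - v) = 2 * q u + 2 * q v := by
  refine le_antisymm (hq.parallelogram_le u v) ?_
  have h := hq.parallelogram_le (u + v) (u - v)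
  have h1 : u + v + (u - v) = (2 : ℝ) • u := by rw [two_smul]; abel
  have h2 : u + v - (u - v) = (2 : ℝ) • v := by rw [two_smul]; abel
  have h4 : ENNReal.ofReal ((2 : ℝ) ^ 2) = 2 * 2 := by
    rw [ENNReal.ofReal_pow (by norm_num), ENNReal.ofReal_ofNat, sq]
  rw [h1, h2, hq.map_smul, hq.map_smul, h4, mul_assoc, mul_assoc, ← mul_add, ← mul_add] at h
  exact (ENNReal.mul_le_mul_iff_right two_ne_zero ENNReal.ofNat_ne_top).1
    (by rwa [← mul_add] at h ⊢)

lemma add_le (u v : K) : q (u + v) ≤ 2 * q u + 2 * q v :=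
  le_self_add.trans (hq.parallelogram u v).le

lemma add_ne_top (hu : q u ≠ ∞) (hv : q v ≠ ∞) : q (u + v) ≠ ∞ :=
  ne_top_of_le_ne_top (by finiteness) (hq.add_le u v)

lemma smul_ne_top (c : ℝ) (hu : q u ≠ ∞) : q (c • u) ≠ ∞ := by
  rw [hq.map_smul]; finiteness

lemma neg_ne_top (hu : q u ≠ ∞) : q (-u) ≠ ∞ := by
  rwa [hq.map_neg]

lemma sub_ne_top (hu : q u ≠ ∞) (hv : q v ≠ ∞) : q (u - v) ≠ ∞ := by
  rw [sub_eq_add_neg]; exact hq.add_ne_top hu (hq.neg_ne_top hv)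

lemma toReal_parallelogram (hu : q u ≠ ∞) (hv : q v ≠ ∞) :
    (q (u + v)).toReal + (q (u - v)).toReal = 2 * (q u).toReal + 2 * (q v).toReal := by
  have h := congrArg ENNReal.toReal (hq.parallelogram u v)
  rw [ENNReal.toReal_add (hq.add_ne_top hu hv) (hq.sub_ne_top hu hv),
    ENNReal.toReal_add (by finiteness) (by finiteness)] at h
  simpa using h

lemma toReal_smul (c : ℝ) (u : K) : (q (c • u)).toReal = c ^ 2 * (q u).toReal := by
  rw [hq.map_smul, ENNReal.toReal_mul, ENNReal.toReal_ofReal (sq_nonneg c)]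

lemma polar_comm (u v : K) : polar q u v = polar q v u := by
  rw [polar, polar, add_comm, hq.map_sub_comm]

lemma polar_zero_left (v : K) : polar q 0 v = 0 := by
  simp [polar, hq.map_neg]

lemma polar_self (u : K) : polar q u u = (q u).toReal := by
  rw [polar, ← two_smul ℝ u, sub_self, hq.toReal_smul, hq.map_zero]
  simp; ring

lemma polar_two_smul_right (hu : q u ≠ ∞) (hw : q w ≠ ∞) (hv : q v ≠ ∞) :
    polar q u v + polar q w v = polar q (u + w) ((2 : ℝ) • v) / 2 := by
  have h1 := hq.toReal_parallelogram (hq.add_ne_top hu hv) (hq.add_ne_top hw hv)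
  have h2 := hq.toReal_parallelogram (hq.sub_ne_top hu hv) (hq.sub_ne_top hw hv)
  have e1 : u + v + (w + v) = u + w + (2 : ℝ) • v := by rw [two_smul]; abel
  have e2 : u + v - (w + v) = u - w := by abel
  have e3 : u - v + (w - v) = u + w - (2 : ℝ) • v := by rw [two_smul]; abel
  have e4 : u - v - (w - v) = u - w := by abel
  rw [e1, e2] at h1
  rw [e3, e4] at h2
  simp only [polar]
  linarith

lemma polar_add_left (hu : q u ≠ ∞) (hw : q w ≠ ∞) (hv : q v ≠ ∞) :
    polar q (u + w) v = polar q u v + polar q w v := by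
  have h := hq.polar_two_smul_right (hq.add_ne_top hu hw) hq.zero_ne_top hv
  rw [hq.polar_zero_left, add_zero, add_zero] at h
  rw [hq.polar_two_smul_right hu hw hv, h]

lemma polar_neg_left (u v : K) : polar q (-u) v = -polar q u v := by
  have h1 : q (-u + v) = q (u - v) := by rw [← hq.map_neg]; congr 1; abel
  have h2 : q (-u - v) = q (u + v) := by rw [← hq.map_neg]; congr 1; abel
  rw [polar, polar, h1, h2]; ring

lemma abs_polar_le (hu : q u ≠ ∞) (hv : q v ≠ ∞) :
    |polar q u v| ≤ (q u).toReal + (q v).toReal := by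
  have h := hq.toReal_parallelogram hu hv
  have h1 : 0 ≤ (q (u + v)).toReal := ENNReal.toReal_nonneg
  have h2 : 0 ≤ (q (u - v)).toReal := ENNReal.toReal_nonneg
  rw [polar, abs_le]
  constructor <;> linarith

/-- Real homogeneity of the polar form: `c ↦ polar q (c • u) v` is additive, and it is bounded on
bounded sets. -/
lemma polar_smul_left (c : ℝ) (hu : q u ≠ ∞) (hv : q v ≠ ∞) :
    polar q (c • u) v = c * polar q u v := by
  let g : ℝ →+ ℝ := AddMonoidHom.mk' (fun c => polar q (c • u) v) fun a b => by
    rw [add_smul, hq.polar_add_left (hq.smul_ne_top a hu) (hq.smul_ne_top b hu) hv]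
  have hb : ∀ a : ℝ, |a| ≤ 1 → |g a| ≤ (q u).toReal + (q v).toReal := fun a ha => by
    refine (hq.abs_polar_le (hq.smul_ne_top a hu) hv).trans ?_
    rw [hq.toReal_smul]
    have : a ^ 2 ≤ 1 := by rw [← sq_abs]; exact pow_le_one₀ (abs_nonneg a) ha
    have h0 : 0 ≤ (q u).toReal := ENNReal.toReal_nonneg
    nlinarith
  have hg : Continuous g := by
    refine continuous_of_continuousAt_zero g ?_
    rw [ContinuousAt, g.map_zero, Metric.tendsto_nhds_nhds]
    intro ε hε
    obtain ⟨n, hn⟩ := exists_nat_gt (((q u).toReal + (q v).toReal) / ε)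
    refine ⟨1 / (n + 1), by positivity, fun {a} ha => ?_⟩
    rw [dist_zero_right, Real.norm_eq_abs] at ha ⊢
    have h1 : |((n : ℝ) + 1) * a| ≤ 1 := by
      rw [abs_mul, abs_of_nonneg (by positivity)]
      rw [lt_div_iff₀ (by positivity)] at ha
      linarith
    have h2 := hb _ h1
    have h3 : g (((n : ℝ) + 1) * a) = ((n : ℝ) + 1) * g a := by
      have := map_nsmul g (n + 1) a
      simpa [nsmul_eq_mul] using this
    rw [h3, abs_mul, abs_of_nonneg (by positivity)] at h2
    rw [div_lt_iff₀ hε] at hn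
    by_contra! h4
    nlinarith
  have := map_real_smul g hg c 1
  simpa [g] using this

lemma polar_sub_left (hu : q u ≠ ∞) (hw : q w ≠ ∞) (hv : q v ≠ ∞) :
    polar q (u - w) v = polar q u v - polar q w v := by
  rw [sub_eq_add_neg, hq.polar_add_left hu (hq.neg_ne_top hw) hv, hq.polar_neg_left,
    sub_eq_add_neg]

lemma toReal_add (hu : q u ≠ ∞) (hv : q v ≠ ∞) :
    (q (u + v)).toReal = (q u).toReal + 2 * polar q u v + (q v).toReal := by
  have h := hq.toReal_parallelogram hu hv
  rw [polar]; linarith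

lemma toReal_add_smul (t : ℝ) (hu : q u ≠ ∞) (hv : q v ≠ ∞) :
    (q (u + t • v)).toReal = (q u).toReal + 2 * t * polar q u v + t ^ 2 * (q v).toReal := by
  rw [hq.toReal_add hu (hq.smul_ne_top t hv), hq.polar_comm u, hq.polar_smul_left t hv hu,
    hq.toReal_smul, hq.polar_comm v]
  ring

/-- The Cauchy-Schwarz inequality. -/
lemma polar_sq_le (hu : q u ≠ ∞) (hv : q v ≠ ∞) :
    polar q u v ^ 2 ≤ (q u).toReal * (q v).toReal := by
  have h := discrim_le_zero (a := (q v).toReal) (b := 2 * polar q u v) (c := (q u).toReal)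
    fun t => by
      have h1 := hq.toReal_add_smul t hu hv
      have h2 : 0 ≤ (q (u + t • v)).toReal := ENNReal.toReal_nonneg
      linarith
  rw [discrim] at h
  linarith

lemma tendsto_polar {x : ℕ → K} (hx : ∀ n, q (x n) ≠ ∞) (hu : q u ≠ ∞) (hv : q v ≠ ∞)
    (h : Tendsto (fun n => (q (x n - u)).toReal) atTop (𝓝 0)) :
    Tendsto (fun n => polar q (x n) v) atTop (𝓝 (polar q u v)) := by
  rw [tendsto_iff_dist_tendsto_zero]
  have h1 : Tendsto (fun n => √((q (x n - u)).toReal * (q v).toReal)) atTop (𝓝 0) := by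
    simpa using (h.mul_const (q v).toReal).sqrt
  refine squeeze_zero (fun _ => dist_nonneg) (fun n => ?_) h1
  rw [Real.dist_eq, ← hq.polar_sub_left (hx n) hu hv]
  exact Real.abs_le_sqrt (hq.polar_sq_le (hq.sub_ne_top (hx n) hu) hv)

lemma tendsto_toReal {x : ℕ → K} (hx : ∀ n, q (x n) ≠ ∞) (hu : q u ≠ ∞)
    (h : Tendsto (fun n => (q (x n - u)).toReal) atTop (𝓝 0)) :
    Tendsto (fun n => (q (x n)).toReal) atTop (𝓝 (q u).toReal) := by
  have h1 := ((hq.tendsto_polar hx hu hu h).const_mul 2).sub_const (q u).toReal |>.add h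
  rw [hq.polar_self, add_zero, two_mul, add_sub_cancel_right] at h1
  refine h1.congr fun n => ?_
  have h2 := hq.toReal_add hu (hq.sub_ne_top (hx n) hu)
  rw [add_sub_cancel, hq.polar_comm u, hq.polar_sub_left (hx n) hu hu, hq.polar_self] at h2
  linarith

end IsQuad

end QForm

namespace QForm

variable {K : Type*} [NormedAddCommGroup K] [InnerProductSpace ℝ K]

/-! ### Closed forms and their resolvents -/

lemma le_of_tendsto_of_lsc {K : Type*} [TopologicalSpace K] {q : K → ℝ≥0∞}
    (hq : LowerSemicontinuous q) {x : ℕ → K} {u : K} {y : ℝ≥0∞} (hx : Tendsto x atTop (𝓝 u))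
    (h : ∀ᶠ n in atTop, q (x n) ≤ y) : q u ≤ y :=
  (lowerSemicontinuous_iff_isClosed_preimage.1 hq y).mem_of_tendsto hx h

/-- A quadratic form whose domain is complete for the graph norm is lower semicontinuous. A
minimizing sequence of the form over shrinking balls around `u` is a Cauchy sequence with respect
to the form, because balls are convex. -/
lemma IsQuad.lowerSemicontinuous_of_complete {q : K → ℝ≥0∞} (hq : IsQuad q)
    (h : ∀ (x : ℕ → K) (u : K), (∀ n, q (x n) ≠ ∞) → Tendsto x atTop (𝓝 u) →
      (∀ ε : ℝ, 0 < ε → ∃ N, ∀ m, N ≤ m → ∀ n, N ≤ n → (q (x m - x n)).toReal < ε) →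
      q u ≠ ∞ ∧ Tendsto (fun n => (q (x n - u)).toReal) atTop (𝓝 0)) :
    LowerSemicontinuous q := by
  intro u y hy
  by_contra hcon
  rw [not_eventually] at hcon
  have hyt : y ≠ ∞ := hy.ne_top
  set r : ℕ → ℝ := fun k => 1 / ((k : ℝ) + 1) with hr
  have hr0 : ∀ k, 0 < r k := fun k => by positivity
  have hrm : Antitone r := fun a b hab => one_div_le_one_div_of_le (by positivity) (by gcongr)
  have hrt : Tendsto r atTop (𝓝 0) := tendsto_one_div_add_atTop_nhds_zero_nat
  set d : ℕ → ℝ≥0∞ := fun k => ⨅ v ∈ Metric.ball u (r k), q v with hd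
  have hdm : Monotone d := fun a b hab =>
    biInf_mono fun v hv => Metric.ball_subset_ball (hrm hab) hv
  have hdy : ∀ k, d k ≤ y := fun k => by
    obtain ⟨v, hv, hvk⟩ := (hcon.and_eventually (Metric.ball_mem_nhds u (hr0 k))).exists
    exact (biInf_le q hvk).trans (not_lt.1 hv)
  have hdt : ∀ k, d k ≠ ∞ := fun k => ne_top_of_le_ne_top hyt (hdy k)
  have hex : ∀ k, ∃ v ∈ Metric.ball u (r k), q v < d k + ENNReal.ofReal (r k) := fun k => by
    have : d k < d k + ENNReal.ofReal (r k) :=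
      ENNReal.lt_add_right (hdt k) (by simpa using hr0 k)
    simpa [hd, iInf_lt_iff] using this
  choose x hxb hxq using hex
  have hxt : ∀ k, q (x k) ≠ ∞ := fun k => (hxq k).ne_top
  have hxr : ∀ k, (q (x k)).toReal ≤ (d k).toReal + r k := fun k => by
    have := ENNReal.toReal_mono (by finiteness [hdt k]) (hxq k).le
    rwa [ENNReal.toReal_add (hdt k) (by finiteness), ENNReal.toReal_ofReal (hr0 k).le] at this
  have hxu : Tendsto x atTop (𝓝 u) := by
    rw [tendsto_iff_dist_tendsto_zero]
    exact squeeze_zero (fun _ => dist_nonneg) (fun k => (Metric.mem_ball.1 (hxb k)).le) hrt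
  have hdm' : Monotone fun k => (d k).toReal := fun a b hab =>
    ENNReal.toReal_mono (hdt b) (hdm hab)
  have hdy' : ∀ k, (d k).toReal ≤ y.toReal := fun k => ENNReal.toReal_mono hyt (hdy k)
  have hdbdd : BddAbove (range fun k => (d k).toReal) :=
    ⟨y.toReal, by rintro _ ⟨k, rfl⟩; exact hdy' k⟩
  set D := ⨆ k, (d k).toReal
  have hD : Tendsto (fun k => (d k).toReal) atTop (𝓝 D) := tendsto_atTop_ciSup hdm' hdbdd
  have hdD : ∀ k, (d k).toReal ≤ D := fun k => le_ciSup hdbdd k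
  have hDy : D ≤ y.toReal := ciSup_le hdy'
  -- the midpoint of `x m` and `x n` lies in the ball with index `N`, where the form is at
  -- least `d N`
  have key : ∀ N m n, N ≤ m → N ≤ n →
      (q (x m - x n)).toReal ≤ 4 * (D - (d N).toReal) + 4 * r N := by
    intro N m n hm hn
    have h1 := hq.toReal_parallelogram (hxt m) (hxt n)
    have hmid : ((1 / 2 : ℝ) • (x m + x n)) ∈ Metric.ball u (r N) := by
      have := (convex_ball u (r N)) (Metric.ball_subset_ball (hrm hm) (hxb m))
        (Metric.ball_subset_ball (hrm hn) (hxb n)) (a := 1 / 2) (b := 1 / 2) (by norm_num)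
        (by norm_num) (by norm_num)
      rwa [← smul_add] at this
    have h2 : (d N).toReal ≤ (q ((1 / 2 : ℝ) • (x m + x n))).toReal :=
      ENNReal.toReal_mono (hq.smul_ne_top _ (hq.add_ne_top (hxt m) (hxt n))) (biInf_le _ hmid)
    rw [hq.toReal_smul] at h2
    have := hxr m
    have := hxr n
    have := hdD m
    have := hdD n
    have := hrm hm
    have := hrm hn
    linarith
  obtain ⟨hu, hlim⟩ := h x u hxt hxu fun ε hε => by
    have : Tendsto (fun N => 4 * (D - (d N).toReal) + 4 * r N) atTop (𝓝 0) := by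
      simpa using ((hD.const_sub D).const_mul 4).add (hrt.const_mul 4)
    obtain ⟨N, hN⟩ := (this.eventually (gt_mem_nhds hε)).exists
    exact ⟨N, fun m hm n hn => (key N m n hm hn).trans_lt hN⟩
  have h1 := hq.tendsto_toReal hxt hu hlim
  have h2 : (q u).toReal ≤ y.toReal + 0 :=
    le_of_tendsto_of_tendsto' h1 (hrt.const_add y.toReal) fun k =>
      (hxr k).trans (add_le_add_left (hdy' k) (r k))
  rw [add_zero, ENNReal.toReal_le_toReal hu hyt] at h2
  exact absurd hy (not_lt.2 h2)

/-- A densely defined, positive, closed quadratic form. Closedness is stated as lower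
semicontinuity. -/
structure IsClosedForm (q : K → ℝ≥0∞) : Prop extends IsQuad q where
  lsc : LowerSemicontinuous q
  dense : Dense {u | q u ≠ ∞}

lemma exists_minimizer [CompleteSpace K] {q : K → ℝ≥0∞} (hq : IsQuad q)
    (hlsc : LowerSemicontinuous q) {l : ℝ} (hl : 0 < l) (g : K) :
    ∃ u, q u ≠ ∞ ∧ ∀ v, q v ≠ ∞ →
      (q u).toReal + l * ‖u - g‖ ^ 2 ≤ (q v).toReal + l * ‖v - g‖ ^ 2 := by
  set J : K → ℝ := fun v => (q v).toReal + l * ‖v - g‖ ^ 2 with hJ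
  have hJ0 : ∀ v, 0 ≤ J v := fun v => by positivity
  set A := J '' {v | q v ≠ ∞}
  have hAb : BddBelow A := ⟨0, by rintro _ ⟨v, -, rfl⟩; exact hJ0 v⟩
  have hAn : A.Nonempty := ⟨J 0, 0, hq.zero_ne_top, rfl⟩
  set c := sInf A
  have hc : ∀ v, q v ≠ ∞ → c ≤ J v := fun v hv => csInf_le hAb ⟨v, hv, rfl⟩
  obtain ⟨a, -, hat, haA⟩ := exists_seq_tendsto_sInf hAn hAb
  choose x hxt hxa using haA
  have hxc : Tendsto (fun n => J (x n)) atTop (𝓝 c) := by simpa [hxa] using hat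
  have key : ∀ m n, l * ‖x m - x n‖ ^ 2 ≤ 2 * (J (x m) - c) + 2 * (J (x n) - c) := by
    intro m n
    have h1 := hq.toReal_parallelogram (hxt m) (hxt n)
    have h2 := hc _ (hq.smul_ne_top (1 / 2) (hq.add_ne_top (hxt m) (hxt n)))
    have h3 := parallelogram_law_with_norm ℝ (x m - g) (x n - g)
    have h4 : x m - g - (x n - g) = x m - x n := by abel
    have h5 : x m - g + (x n - g) = (2 : ℝ) • ((1 / 2 : ℝ) • (x m + x n) - g) := by
      rw [smul_sub, smul_smul, two_smul]; norm_num; abel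
    rw [h4, h5, norm_smul] at h3
    simp only [hJ] at h2 ⊢
    rw [hq.toReal_smul] at h2
    have h6 : 0 ≤ (q (x m - x n)).toReal := ENNReal.toReal_nonneg
    have h7 : ‖(2 : ℝ)‖ = 2 := by norm_num
    rw [h7] at h3
    have h8 : l * ‖x m - x n‖ ^ 2 = l * (2 * (‖x m - g‖ * ‖x m - g‖ + ‖x n - g‖ * ‖x n - g‖)
        - 4 * ‖(1 / 2 : ℝ) • (x m + x n) - g‖ ^ 2) := by
      congr 1; linarith
    rw [h8]
    linarith
  have hcau : CauchySeq x := by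
    refine Metric.cauchySeq_iff.2 fun ε hε => ?_
    have hpos : 0 < l * ε ^ 2 / 4 := by positivity
    obtain ⟨N, hN⟩ := eventually_atTop.1 (hxc.eventually (gt_mem_nhds (lt_add_of_pos_right c hpos)))
    refine ⟨N, fun m hm n hn => ?_⟩
    have h1 := key m n
    have h2 := hN m hm
    have h3 := hN n hn
    rw [dist_eq_norm]
    refine lt_of_pow_lt_pow_left₀ 2 hε.le (lt_of_mul_lt_mul_left ?_ hl.le)
    linarith
  obtain ⟨u, hu⟩ := cauchySeq_tendsto_of_complete hcau
  have hnorm : Tendsto (fun n => l * ‖x n - g‖ ^ 2) atTop (𝓝 (l * ‖u - g‖ ^ 2)) :=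
    (((hu.sub_const g).norm).pow 2).const_mul l
  have hle : ∀ ε : ℝ, 0 < ε → q u ≤ ENNReal.ofReal (c - l * ‖u - g‖ ^ 2 + ε) := fun ε hε => by
    refine le_of_tendsto_of_lsc hlsc hu ?_
    have ht : Tendsto (fun n => J (x n) - l * ‖x n - g‖ ^ 2) atTop (𝓝 (c - l * ‖u - g‖ ^ 2)) :=
      hxc.sub hnorm
    filter_upwards [ht.eventually (gt_mem_nhds (lt_add_of_pos_right _ hε))] with n hn
    rw [← ENNReal.ofReal_toReal (hxt n)]
    refine ENNReal.ofReal_le_ofReal ?_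
    simp only [hJ] at hn
    linarith
  have hut : q u ≠ ∞ := ne_top_of_le_ne_top ENNReal.ofReal_ne_top (hle 1 one_pos)
  have h0 : 0 ≤ c - l * ‖u - g‖ ^ 2 := by
    have ht : Tendsto (fun n => J (x n) - l * ‖x n - g‖ ^ 2) atTop (𝓝 (c - l * ‖u - g‖ ^ 2)) :=
      hxc.sub hnorm
    exact ge_of_tendsto' ht fun n => by simp [hJ]
  refine ⟨u, hut, fun v hv => (le_of_forall_pos_le_add fun ε hε => ?_ : J u ≤ c).trans (hc v hv)⟩
  have := ENNReal.toReal_mono ENNReal.ofReal_ne_top (hle ε hε)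
  rw [ENNReal.toReal_ofReal (by linarith)] at this
  simp only [hJ]
  linarith

lemma eq_zero_of_forall_quadratic_nonneg {a b : ℝ} (ha : 0 ≤ a)
    (h : ∀ t : ℝ, 0 ≤ a * t ^ 2 + 2 * b * t) : b = 0 := by
  have h1 := h (-b / (a + 1))
  have h2 : a * (-b / (a + 1)) ^ 2 + 2 * b * (-b / (a + 1)) = -(b ^ 2 * (a + 2)) / (a + 1) ^ 2 := by
    field_simp; ring
  rw [h2, div_nonneg_iff] at h1
  rcases h1 with ⟨h3, -⟩ | ⟨-, h3⟩
  · have : 0 ≤ b ^ 2 := sq_nonneg b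
    have : b ^ 2 = 0 := by nlinarith
    exact pow_eq_zero_iff (two_ne_zero) |>.1 this
  · have : 0 < (a + 1) ^ 2 := by positivity
    linarith

/-- The Euler equation: the minimizer of `q v + l ‖v - f / l‖²` is `(l I + H)⁻¹ f`. -/
lemma exists_isAssocOp [CompleteSpace K] {q : K → ℝ≥0∞} (hq : IsQuad q)
    (hlsc : LowerSemicontinuous q) {l : ℝ} (hl : 0 < l) (f : K) :
    ∃ u, IsAssocOp q u (f - l • u) := by
  obtain ⟨u, hu, hmin⟩ := exists_minimizer hq hlsc hl (l⁻¹ • f)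
  refine ⟨u, hu, fun v hv => ?_⟩
  have h := eq_zero_of_forall_quadratic_nonneg (a := (q v).toReal + l * ‖v‖ ^ 2)
    (b := polar q u v + l * inner ℝ (u - l⁻¹ • f) v) (by positivity) fun t => by
      have h1 := hmin _ (hq.add_ne_top hu (hq.smul_ne_top t hv))
      rw [hq.toReal_add_smul t hu hv, add_sub_right_comm, norm_add_sq_real, inner_smul_right,
        norm_smul, mul_pow, Real.norm_eq_abs, sq_abs] at h1
      linarith
  rw [inner_sub_left, inner_smul_left] at h ⊢
  simp only [conj_trivial] at h ⊢
  have : l * (l⁻¹ * inner ℝ f v) = inner ℝ f v := by field_simp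
  linarith

lemma IsQuad.isAssocOp_unique {q : K → ℝ≥0∞} (hq : IsQuad q) {l : ℝ} (hl : 0 < l) {f u v : K}
    (hu : IsAssocOp q u (f - l • u)) (hv : IsAssocOp q v (f - l • v)) : u = v := by
  have hd := hq.sub_ne_top hu.1 hv.1
  have h1 := hu.2 _ hd
  have h2 := hv.2 _ hd
  have h3 := hq.polar_sub_left hu.1 hv.1 hd
  rw [hq.polar_self, h1, h2, ← inner_sub_left] at h3
  have h4 : f - l • u - (f - l • v) = -(l • (u - v)) := by rw [smul_sub]; abel
  rw [h4, inner_neg_left, inner_smul_left, real_inner_self_eq_norm_sq] at h3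
  have h5 : 0 ≤ (q (u - v)).toReal := ENNReal.toReal_nonneg
  rw [h3] at h5
  simp only [conj_trivial] at h5
  have h6 : ‖u - v‖ ^ 2 = 0 := by nlinarith [sq_nonneg ‖u - v‖]
  exact sub_eq_zero.1 (norm_eq_zero.1 (pow_eq_zero_iff two_ne_zero |>.1 h6))

lemma IsQuad.isAssocOp_add {q : K → ℝ≥0∞} (hq : IsQuad q) {f g u v : K}
    (hu : IsAssocOp q u f) (hv : IsAssocOp q v g) : IsAssocOp q (u + v) (f + g) :=
  ⟨hq.add_ne_top hu.1 hv.1, fun w hw => by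
    rw [hq.polar_add_left hu.1 hv.1 hw, hu.2 w hw, hv.2 w hw, inner_add_left]⟩

lemma IsQuad.isAssocOp_smul {q : K → ℝ≥0∞} (hq : IsQuad q) {f u : K} (c : ℝ)
    (hu : IsAssocOp q u f) : IsAssocOp q (c • u) (c • f) :=
  ⟨hq.smul_ne_top c hu.1, fun w hw => by
    rw [hq.polar_smul_left c hu.1 hw, hu.2 w hw, inner_smul_left]; simp⟩

lemma norm_le_of_isAssocOp {q : K → ℝ≥0∞} (hq : IsQuad q) {l : ℝ} {f u : K}
    (hu : IsAssocOp q u (f - l • u)) : l * ‖u‖ ≤ ‖f‖ := by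
  have h1 := hu.2 u hu.1
  rw [hq.polar_self, inner_sub_left, inner_smul_left, real_inner_self_eq_norm_sq] at h1
  have h2 : 0 ≤ (q u).toReal := ENNReal.toReal_nonneg
  have h3 := real_inner_le_norm f u
  simp only [conj_trivial] at h1
  rcases (norm_nonneg u).eq_or_lt with h | h
  · rw [← h]; simp
  · exact le_of_mul_le_mul_right (by nlinarith) h

theorem exists_isResolvent [CompleteSpace K] {q : K → ℝ≥0∞} (hq : IsQuad q)
    (hlsc : LowerSemicontinuous q) {l : ℝ} (hl : 0 < l) :
    ∃ R : K →L[ℝ] K, IsResolvent q l R := by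
  choose R hR using exists_isAssocOp hq hlsc hl
  refine ⟨LinearMap.mkContinuous
    { toFun := R
      map_add' := fun f g => hq.isAssocOp_unique hl (hR (f + g)) ?_
      map_smul' := fun c f => hq.isAssocOp_unique hl (hR (c • f)) ?_ } l⁻¹ fun f => ?_, hR⟩
  · have := hq.isAssocOp_add (hR f) (hR g)
    rwa [show f - l • R f + (g - l • R g) = f + g - l • (R f + R g) by rw [smul_add]; abel] at this
  · have := hq.isAssocOp_smul c (hR f)
    rwa [smul_sub, smul_comm] at this
  · have := norm_le_of_isAssocOp hq (hR f)
    change ‖R f‖ ≤ _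
    rw [inv_mul_eq_div, le_div_iff₀ hl]
    linarith

namespace IsClosedForm

variable [CompleteSpace K] {q : K → ℝ≥0∞} (hq : IsClosedForm q) {l m : ℝ}
include hq

lemma isResolvent (hl : 0 < l) : IsResolvent q l (formResolvent q l) := by
  have h := exists_isResolvent hq.toIsQuad hq.lsc hl
  rw [formResolvent, dif_pos h]
  exact h.choose_spec

lemma resolvent_unique (hl : 0 < l) {f u : K} (hu : IsAssocOp q u (f - l • u)) :
    formResolvent q l f = u :=
  hq.isAssocOp_unique hl (hq.isResolvent hl f) hu

lemma resolvent_ne_top (hl : 0 < l) (f : K) : q (formResolvent q l f) ≠ ∞ :=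
  (hq.isResolvent hl f).1

lemma polar_resolvent (hl : 0 < l) (f : K) {v : K} (hv : q v ≠ ∞) :
    polar q (formResolvent q l f) v = inner ℝ (f - l • formResolvent q l f) v :=
  (hq.isResolvent hl f).2 v hv

lemma norm_smul_resolvent_le (hl : 0 < l) (f : K) : l * ‖formResolvent q l f‖ ≤ ‖f‖ :=
  norm_le_of_isAssocOp hq.toIsQuad (hq.isResolvent hl f)

lemma resolvent_symm (hl : 0 < l) (f g : K) :
    inner ℝ (formResolvent q l f) g = inner ℝ f (formResolvent q l g) := by
  have h1 := hq.polar_resolvent hl f (hq.resolvent_ne_top hl g)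
  have h2 := hq.polar_resolvent hl g (hq.resolvent_ne_top hl f)
  rw [hq.polar_comm, h1, inner_sub_left, inner_sub_left, inner_smul_left, inner_smul_left,
    real_inner_comm (formResolvent q l f) (formResolvent q l g)] at h2
  rw [real_inner_comm]
  linarith

/-- The resolvent identity. -/
lemma resolvent_identity (hl : 0 < l) (f : K) (m : ℝ) (hm : 0 < m) :
    formResolvent q m f =
      formResolvent q l f + (l - m) • formResolvent q l (formResolvent q m f) := by
  rw [← map_smul, ← map_add]
  symm
  refine hq.resolvent_unique hl ?_
  have := hq.isResolvent hm f
  rwa [show f + (l - m) • formResolvent q m f - l • formResolvent q m f =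
    f - m • formResolvent q m f by rw [sub_smul]; abel]

lemma resolvent_comm (hl : 0 < l) (hm : 0 < m) (f : K) :
    formResolvent q l (formResolvent q m f) = formResolvent q m (formResolvent q l f) := by
  rcases eq_or_ne l m with rfl | h
  · rfl
  have h1 := hq.resolvent_identity hl f m hm
  have h2 := hq.resolvent_identity hm f l hl
  have h3 : (l - m) • (formResolvent q l (formResolvent q m f) -
      formResolvent q m (formResolvent q l f)) = 0 := by
    rw [smul_sub]
    have h4 : (m - l) • formResolvent q m (formResolvent q l f) =
      -((l - m) • formResolvent q m (formResolvent q l f)) := by rw [← neg_smul, neg_sub]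
    rw [h4] at h2
    nth_rw 1 [h2] at h1
    rw [← sub_eq_zero] at h1
    rw [← neg_eq_zero, ← h1]
    abel
  exact sub_eq_zero.1 ((smul_eq_zero.1 h3).resolve_left (sub_ne_zero.2 h))

lemma resolvent_injective (hl : 0 < l) {f : K} (h : formResolvent q l f = 0) : f = 0 := by
  have h1 : ∀ v, q v ≠ ∞ → inner ℝ f v = 0 := fun v hv => by
    have := hq.polar_resolvent hl f hv
    rw [h, hq.polar_zero_left, smul_zero, sub_zero] at this
    exact this.symm
  exact hq.dense.eq_zero_of_inner_left (𝕜 := ℝ) h1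

lemma toReal_smul_resolvent_le (hl : 0 < l) {w : K} (hw : q w ≠ ∞) :
    (q (l • formResolvent q l w)).toReal + 2 * l * ‖w - l • formResolvent q l w‖ ^ 2
      ≤ (q w).toReal := by
  have h1 := hq.smul_ne_top l (hq.resolvent_ne_top hl w)
  have h2 := hq.sub_ne_top hw h1
  have h3 := hq.toReal_add h1 h2
  rw [add_sub_cancel, hq.polar_smul_left l (hq.resolvent_ne_top hl w) h2,
    hq.polar_resolvent hl w h2, real_inner_self_eq_norm_sq] at h3
  have h4 : 0 ≤ (q (w - l • formResolvent q l w)).toReal := ENNReal.toReal_nonneg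
  linarith

lemma toReal_smul_resolvent (hl : 0 < l) (w : K) :
    (q (l • formResolvent q l w)).toReal + l * ‖w - l • formResolvent q l w‖ ^ 2
      = l * inner ℝ (w - l • formResolvent q l w) w := by
  have h1 := hq.smul_ne_top l (hq.resolvent_ne_top hl w)
  rw [← hq.polar_self, hq.polar_smul_left l (hq.resolvent_ne_top hl w) h1,
    hq.polar_resolvent hl w h1, ← real_inner_self_eq_norm_sq, ← mul_add, ← inner_add_right,
    add_sub_cancel]

/-- The approximating forms `l (w - l (l I + H)⁻¹ w, w)` are below the form. -/
lemma approx_le (hl : 0 < l) {w : K} (hw : q w ≠ ∞) :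
    l * inner ℝ (w - l • formResolvent q l w) w ≤ (q w).toReal := by
  have h1 := hq.toReal_smul_resolvent_le hl hw
  rw [← hq.toReal_smul_resolvent hl w]
  have : 0 ≤ l * ‖w - l • formResolvent q l w‖ ^ 2 := by positivity
  linarith

lemma toReal_smul_resolvent_le_approx (hl : 0 < l) (w : K) :
    (q (l • formResolvent q l w)).toReal ≤ l * inner ℝ (w - l • formResolvent q l w) w := by
  rw [← hq.toReal_smul_resolvent hl w]
  exact le_add_of_nonneg_right (by positivity)

/-- `l (l I + H)⁻¹` converges strongly to the identity as `l → ∞`. -/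
lemma tendsto_smul_resolvent (w : K) :
    Tendsto (fun n : ℕ => (n : ℝ) • formResolvent q n w) atTop (𝓝 w) := by
  have hdom : ∀ v, q v ≠ ∞ →
      Tendsto (fun n : ℕ => (n : ℝ) • formResolvent q n v) atTop (𝓝 v) := fun v hv => by
    rw [tendsto_iff_norm_sub_tendsto_zero]
    have h1 : Tendsto (fun n : ℕ => √((q v).toReal / n)) atTop (𝓝 0) := by
      simpa using (tendsto_const_div_atTop_nhds_zero_nat (q v).toReal).sqrt
    refine squeeze_zero' (Eventually.of_forall fun _ => norm_nonneg _) ?_ h1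
    filter_upwards [eventually_gt_atTop 0] with n hn
    have hn' : (0 : ℝ) < n := Nat.cast_pos.2 hn
    have h2 := hq.toReal_smul_resolvent_le hn' hv
    have h3 : 0 ≤ (q ((n : ℝ) • formResolvent q n v)).toReal := ENNReal.toReal_nonneg
    rw [norm_sub_rev]
    refine Real.le_sqrt_of_sq_le ?_
    rw [le_div_iff₀ hn']
    nlinarith [sq_nonneg ‖v - (n : ℝ) • formResolvent q n v‖]
  rw [Metric.tendsto_atTop]
  intro ε hε
  obtain ⟨v, hv, hvw⟩ := Metric.dense_iff.1 hq.dense w (ε / 3) (by positivity)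
  rw [Metric.mem_ball, dist_eq_norm] at hv
  obtain ⟨N, hN⟩ := Metric.tendsto_atTop.1 (hdom v hvw) (ε / 3) (by positivity)
  refine ⟨max N 1, fun n hn => ?_⟩
  have hn' : (0 : ℝ) < n := Nat.cast_pos.2 (le_trans (le_max_right N 1) hn)
  have h1 := hN n (le_trans (le_max_left _ _) hn)
  rw [dist_eq_norm] at h1 ⊢
  have h2 := hq.norm_smul_resolvent_le hn' (w - v)
  have h3 : (n : ℝ) • formResolvent q n w - w =
      (n : ℝ) • formResolvent q n (w - v) + ((n : ℝ) • formResolvent q n v - v) + (v - w) := by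
    rw [map_sub, smul_sub]; abel
  rw [h3]
  refine (norm_add₃_le).trans_lt ?_
  rw [norm_smul, Real.norm_of_nonneg hn'.le]
  rw [norm_sub_rev] at h2
  linarith

/-- If the approximating forms are bounded at `w` then `w` is in the domain. -/
lemma le_of_approx_le {w : K} {c : ℝ} (hc : ∀ n : ℕ, 0 < n →
    (n : ℝ) * inner ℝ (w - (n : ℝ) • formResolvent q n w) w ≤ c) : q w ≤ ENNReal.ofReal c := by
  refine le_of_tendsto_of_lsc hq.lsc (hq.tendsto_smul_resolvent w) ?_
  filter_upwards [eventually_gt_atTop 0] with n hn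
  have hn' : (0 : ℝ) < n := Nat.cast_pos.2 hn
  rw [← ENNReal.ofReal_toReal (hq.smul_ne_top n (hq.resolvent_ne_top hn' w))]
  exact ENNReal.ofReal_le_ofReal ((hq.toReal_smul_resolvent_le_approx hn' w).trans (hc n hn))

/-- On the domain the approximating forms converge to the form. -/
lemma tendsto_approx {w : K} (hw : q w ≠ ∞) :
    Tendsto (fun n : ℕ => (n : ℝ) * inner ℝ (w - (n : ℝ) • formResolvent q n w) w) atTop
      (𝓝 (q w).toReal) := by
  refine tendsto_order.2 ⟨fun a ha => ?_, fun a ha => ?_⟩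
  · rcases lt_or_ge a 0 with h0 | h0
    · filter_upwards [eventually_gt_atTop 0] with n hn
      have hn' : (0 : ℝ) < n := Nat.cast_pos.2 hn
      exact h0.trans_le (ENNReal.toReal_nonneg.trans (hq.toReal_smul_resolvent_le_approx hn' w))
    · have h1 : ENNReal.ofReal a < q w := (ENNReal.ofReal_lt_iff_lt_toReal h0 hw).2 ha
      filter_upwards [eventually_gt_atTop 0,
        (hq.tendsto_smul_resolvent w).eventually (hq.lsc w _ h1)] with n hn hlt
      have hn' : (0 : ℝ) < n := Nat.cast_pos.2 hn
      exact ((ENNReal.ofReal_lt_iff_lt_toReal h0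
        (hq.smul_ne_top n (hq.resolvent_ne_top hn' w))).1 hlt).trans_le
          (hq.toReal_smul_resolvent_le_approx hn' w)
  · filter_upwards [eventually_gt_atTop 0] with n hn
    exact (hq.approx_le (Nat.cast_pos.2 hn) hw).trans_lt ha

end IsClosedForm

end QForm

namespace QForm

variable {K : Type*} [NormedAddCommGroup K] [InnerProductSpace ℝ K]

/-! ### Semigroups of bounded positive operators -/

section Bounded

variable {A B : K →L[ℝ] K}

lemma exp_neg_smul_apply_comm (A : K →L[ℝ] K) (t : ℝ) (v : K) :
    NormedSpace.exp ((-t) • A) (A v) = A (NormedSpace.exp ((-t) • A) v) := by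
  have h : Commute ((-t) • A) A := (Commute.refl A).smul_left _
  exact congrArg (fun T : K →L[ℝ] K => T v) h.exp_left.eq

variable [CompleteSpace K]

lemma hasDerivAt_exp_neg_smul (A : K →L[ℝ] K) (v : K) (t : ℝ) :
    HasDerivAt (fun s : ℝ => NormedSpace.exp ((-s) • A) v)
      (-(NormedSpace.exp ((-t) • A) (A v))) t := by
  have h1 := (hasDerivAt_exp_smul_const A (-t)).scomp t (hasDerivAt_neg t)
  have h2 := h1.clm_apply (hasDerivAt_const t v)
  simpa using h2

lemma norm_exp_neg_smul_le (hA : ∀ v, 0 ≤ inner ℝ (A v) v) {t : ℝ} (ht : 0 ≤ t) (v : K) :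
    ‖NormedSpace.exp ((-t) • A) v‖ ≤ ‖v‖ := by
  have hd : ∀ s : ℝ, HasDerivAt (fun s : ℝ => ‖NormedSpace.exp ((-s) • A) v‖ ^ 2)
      (2 * inner ℝ (NormedSpace.exp ((-s) • A) v) (-(NormedSpace.exp ((-s) • A) (A v)))) s :=
    fun s => (hasDerivAt_exp_neg_smul A v s).norm_sq
  have h := antitone_of_hasDerivAt_nonpos hd (fun s => by
    beta_reduce
    rw [exp_neg_smul_apply_comm, inner_neg_right, real_inner_comm]
    simpa using hA (NormedSpace.exp ((-s) • A) v)) ht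
  simp only [neg_zero, zero_smul, NormedSpace.exp_zero, one_apply_eq_self] at h
  exact (pow_le_pow_iff_left₀ (norm_nonneg _) (norm_nonneg _) two_ne_zero).1 h

/-- Duhamel's estimate for commuting generators. -/
lemma norm_exp_sub_exp_le (hA : ∀ v, 0 ≤ inner ℝ (A v) v) (hB : ∀ v, 0 ≤ inner ℝ (B v) v)
    (hAB : Commute A B) {t : ℝ} (ht : 0 ≤ t) (v : K) :
    ‖NormedSpace.exp ((-t) • A) v - NormedSpace.exp ((-t) • B) v‖ ≤ ‖A v - B v‖ * t := by
  have hd : ∀ s : ℝ, HasDerivAt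
      (fun s : ℝ => NormedSpace.exp ((-t) • B) (NormedSpace.exp ((-s) • (A - B)) v))
      (NormedSpace.exp ((-t) • B) (-(NormedSpace.exp ((-s) • (A - B)) ((A - B) v)))) s :=
    fun s => (NormedSpace.exp ((-t) • B)).hasFDerivAt.comp_hasDerivAt s
      (hasDerivAt_exp_neg_smul (A - B) v s)
  have hs : ∀ (s : ℝ) (w : K), NormedSpace.exp ((-t) • B) (NormedSpace.exp ((-s) • (A - B)) w) =
      NormedSpace.exp ((-(t - s)) • B) (NormedSpace.exp ((-s) • A) w) := fun s w => by
    have hc1 : Commute ((-t) • B) ((-s) • (A - B)) :=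
      ((hAB.symm.sub_right (Commute.refl B)).smul_left _).smul_right _
    have hc2 : Commute ((-(t - s)) • B) ((-s) • A) := (hAB.symm.smul_left _).smul_right _
    let _ : NormedAlgebra ℚ (K →L[ℝ] K) := NormedAlgebra.restrictScalars ℚ ℝ _
    rw [← mul_apply_eq_comp, ← mul_apply_eq_comp,
      ← NormedSpace.exp_add_of_commute hc1, ← NormedSpace.exp_add_of_commute hc2]
    congr 2
    module
  have h := norm_image_sub_le_of_norm_deriv_le_segment' (a := 0) (b := t) (C := ‖A v - B v‖)
    (fun s _ => (hd s).hasDerivWithinAt) (fun s hs' => by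
      rw [map_neg, norm_neg, hs]
      exact (norm_exp_neg_smul_le hB (sub_nonneg.2 hs'.2.le) _).trans
        (norm_exp_neg_smul_le hA hs'.1 _)) t (right_mem_Icc.2 ht)
  rw [hs, hs] at h
  simpa using h

/-- The first order Taylor expansion of the semigroup generated by a bounded positive operator. -/
lemma norm_exp_sub_taylor_le (hA : ∀ v, 0 ≤ inner ℝ (A v) v) {t : ℝ} (ht : 0 ≤ t) (v : K) :
    ‖NormedSpace.exp ((-t) • A) v - v + t • A v‖ ≤ ‖A (A v)‖ * t * t := by
  have h0 : ∀ s, 0 ≤ s → ∀ w, ‖NormedSpace.exp ((-s) • A) w - w‖ ≤ ‖A w‖ * s := fun s hs w => by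
    have := norm_exp_sub_exp_le hA (B := 0) (by simp) (Commute.zero_right A) hs w
    simpa using this
  have hd : ∀ s : ℝ, HasDerivAt (fun s : ℝ => NormedSpace.exp ((-s) • A) v - v + s • A v)
      (-(NormedSpace.exp ((-s) • A) (A v)) + (1 : ℝ) • A v) s := fun s =>
    ((hasDerivAt_exp_neg_smul A v s).sub_const v).add ((hasDerivAt_id s).smul_const (A v))
  have h := norm_image_sub_le_of_norm_deriv_le_segment' (a := 0) (b := t) (C := ‖A (A v)‖ * t)
    (fun s _ => (hd s).hasDerivWithinAt) (fun s hs => by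
      rw [one_smul, neg_add_eq_sub, norm_sub_rev]
      exact (h0 s hs.1 _).trans (mul_le_mul_of_nonneg_left hs.2.le (norm_nonneg _)))
      t (right_mem_Icc.2 ht)
  simpa using h

lemma exp_symm (hA : ∀ v w, inner ℝ (A v) w = inner ℝ v (A w)) (t : ℝ) (v w : K) :
    inner ℝ (NormedSpace.exp ((-t) • A) v) w = inner ℝ v (NormedSpace.exp ((-t) • A) w) := by
  have h : IsSelfAdjoint A := by
    rw [ContinuousLinearMap.isSelfAdjoint_iff_isSymmetric]; exact hA
  have h1 : IsSelfAdjoint ((-t) • A) := (IsSelfAdjoint.all (-t)).smul h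
  have h2 : IsSelfAdjoint (NormedSpace.exp ((-t) • A)) := h1.exp
  rw [ContinuousLinearMap.isSelfAdjoint_iff_isSymmetric] at h2
  exact h2 v w

/-- Operators intertwined by a bounded map have intertwined exponentials. -/
lemma exp_intertwine {K' : Type*} [NormedAddCommGroup K'] [InnerProductSpace ℝ K']
    [CompleteSpace K'] (i : K' →L[ℝ] K) (A' : K' →L[ℝ] K') (h : ∀ v, i (A' v) = A (i v))
    (t : ℝ) (v : K') :
    i (NormedSpace.exp ((-t) • A') v) = NormedSpace.exp ((-t) • A) (i v) := by
  have h1 := (NormedSpace.exp_series_hasSum_exp' (𝕂 := ℝ) ((-t) • A')).mapL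
    (i ∘L ContinuousLinearMap.apply ℝ K' v)
  have h2 := (NormedSpace.exp_series_hasSum_exp' (𝕂 := ℝ) ((-t) • A)).mapL
    (ContinuousLinearMap.apply ℝ K (i v))
  refine h1.unique (h2.congr_fun fun n => ?_)
  have h3 : ∀ n : ℕ, i ((((-t) • A') ^ n) v) = (((-t) • A) ^ n) (i v) := fun n => by
    induction n with
    | zero => simp
    | succ n ih =>
      rw [pow_succ', pow_succ', mul_apply_eq_comp, mul_apply_eq_comp, ← ih]
      change i ((-t) • A' _) = (-t) • A (i _)
      rw [map_smul, h]
  change i ((_ : ℝ) • ((((-t) • A') ^ n) v)) = (_ : ℝ) • ((((-t) • A) ^ n) (i v))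
  rw [map_smul, h3]

end Bounded

/-! ### The semigroup of a closed form -/

lemma yosida_apply (q : K → ℝ≥0∞) (l : ℝ) (v : K) :
    yosida q l v = l • (v - l • formResolvent q l v) := by
  simp [yosida]

namespace IsClosedForm

variable [CompleteSpace K] {q : K → ℝ≥0∞} (hq : IsClosedForm q) {l m t : ℝ}

include hq

lemma yosida_nonneg (hl : 0 < l) (v : K) : 0 ≤ inner ℝ (yosida q l v) v := by
  rw [yosida_apply, inner_smul_left]
  exact ENNReal.toReal_nonneg.trans (hq.toReal_smul_resolvent_le_approx hl v)

lemma yosida_symm (hl : 0 < l) (v w : K) :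
    inner ℝ (yosida q l v) w = inner ℝ v (yosida q l w) := by
  rw [yosida_apply, yosida_apply, inner_smul_left, inner_smul_right, inner_sub_left,
    inner_sub_right, inner_smul_left, inner_smul_right, hq.resolvent_symm hl]
  rfl

lemma yosida_commute (hl : 0 < l) (hm : 0 < m) : Commute (yosida q l) (yosida q m) := by
  have h : Commute (formResolvent q l) (formResolvent q m) :=
    ContinuousLinearMap.ext fun f => hq.resolvent_comm hl hm f
  unfold yosida
  refine ((Commute.sub_left (Commute.one_left _) ?_).smul_left _).smul_right _
  exact (Commute.sub_right (Commute.one_right _) (h.smul_right _)).smul_left _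

lemma yosida_resolvent (hl : 0 < l) (w : K) :
    yosida q l (formResolvent q 1 w) = l • formResolvent q l (w - formResolvent q 1 w) := by
  have h := hq.resolvent_identity one_pos w l hl
  rw [yosida_apply, hq.resolvent_comm hl one_pos, map_sub, hq.resolvent_comm hl one_pos w]
  congr 1
  nth_rw 2 [h]
  module

/-- On the range of `(I + H)⁻²` the squares of the Yosida approximations are bounded uniformly
in `l`. -/
lemma norm_yosida_yosida_le (hl : 0 < l) (w : K) :
    ‖yosida q l (yosida q l (formResolvent q 1 (formResolvent q 1 w)))‖ ≤ 4 * ‖w‖ := by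
  have hR1 : ∀ x, ‖formResolvent q 1 x‖ ≤ ‖x‖ := fun x => by
    simpa using hq.norm_smul_resolvent_le one_pos x
  have hRl : ∀ x, ‖l • formResolvent q l x‖ ≤ ‖x‖ := fun x => by
    rw [norm_smul, Real.norm_of_nonneg hl.le]; exact hq.norm_smul_resolvent_le hl x
  have hsub : ∀ x, ‖x - formResolvent q 1 x‖ ≤ 2 * ‖x‖ := fun x => by
    linarith [norm_sub_le x (formResolvent q 1 x), hR1 x]
  have h0 : l • formResolvent q l (formResolvent q 1 w - formResolvent q 1 (formResolvent q 1 w)) =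
      formResolvent q 1 (l • formResolvent q l (w - formResolvent q 1 w)) := by
    rw [← map_sub, hq.resolvent_comm hl one_pos, map_smul]
  rw [hq.yosida_resolvent hl, h0, hq.yosida_resolvent hl]
  have h1 := hRl (w - formResolvent q 1 w)
  have h2 := hsub (l • formResolvent q l (w - formResolvent q 1 w))
  have h3 := hsub w
  refine (hRl _).trans ?_
  linarith

lemma resolvent_mem_range (hl : 0 < l) (w : K) :
    formResolvent q l w ∈ range (formResolvent q 1) := by
  rw [hq.resolvent_identity one_pos w l hl, ← map_smul, ← map_add]
  exact mem_range_self _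

lemma denseRange_resolvent : DenseRange (formResolvent q 1) := fun w => by
  refine mem_closure_of_tendsto (hq.tendsto_smul_resolvent w) ?_
  filter_upwards [eventually_gt_atTop 0] with n hn
  rw [← map_smul]
  exact hq.resolvent_mem_range (Nat.cast_pos.2 hn) _

/-- The Hille-Yosida construction: `exp (-t H_n)` converges strongly. -/
theorem tendsto_semigroup (ht : 0 ≤ t) (v : K) :
    Tendsto (fun n : ℕ => NormedSpace.exp ((-t) • yosida q (n : ℝ)) v) atTop
      (𝓝 (semigroup q t v)) := by
  refine (?_ : CauchySeq _).tendsto_limUnder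
  -- on the domain of `H`, which is the range of `(I + H)⁻¹`, the generators themselves converge
  have hdom : ∀ w, CauchySeq fun n : ℕ =>
      NormedSpace.exp ((-t) • yosida q (n : ℝ)) (formResolvent q 1 w) := fun w => by
    have hy : CauchySeq fun n : ℕ => yosida q (n : ℝ) (formResolvent q 1 w) := by
      refine ((hq.tendsto_smul_resolvent (w - formResolvent q 1 w)).congr' ?_).cauchySeq
      filter_upwards [eventually_gt_atTop 0] with n hn
      exact (hq.yosida_resolvent (Nat.cast_pos.2 hn) w).symm
    rw [Metric.cauchySeq_iff] at hy ⊢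
    intro ε hε
    obtain ⟨N, hN⟩ := hy (ε / (t + 1)) (by positivity)
    refine ⟨max N 1, fun m hm n hn => ?_⟩
    have hm' : (0 : ℝ) < m := Nat.cast_pos.2 (le_trans (le_max_right N 1) hm)
    have hn' : (0 : ℝ) < n := Nat.cast_pos.2 (le_trans (le_max_right N 1) hn)
    have h1 := hN m (le_trans (le_max_left _ _) hm) n (le_trans (le_max_left _ _) hn)
    have h2 := norm_exp_sub_exp_le (hq.yosida_nonneg hm') (hq.yosida_nonneg hn')
      (hq.yosida_commute hm' hn') ht (formResolvent q 1 w)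
    rw [dist_eq_norm] at h1 ⊢
    rw [lt_div_iff₀ (by positivity)] at h1
    nlinarith [norm_nonneg (yosida q (m : ℝ) (formResolvent q 1 w) -
      yosida q (n : ℝ) (formResolvent q 1 w))]
  rw [Metric.cauchySeq_iff]
  intro ε hε
  obtain ⟨_, hv, w, rfl⟩ := Metric.dense_iff.1 hq.denseRange_resolvent v (ε / 3) (by positivity)
  rw [Metric.mem_ball, dist_eq_norm] at hv
  obtain ⟨N, hN⟩ := Metric.cauchySeq_iff.1 (hdom w) (ε / 3) (by positivity)
  refine ⟨max N 1, fun m hm n hn => ?_⟩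
  have hm' : (0 : ℝ) < m := Nat.cast_pos.2 (le_trans (le_max_right N 1) hm)
  have hn' : (0 : ℝ) < n := Nat.cast_pos.2 (le_trans (le_max_right N 1) hn)
  have h1 := hN m (le_trans (le_max_left _ _) hm) n (le_trans (le_max_left _ _) hn)
  set u := formResolvent q 1 w
  have h2 := norm_exp_neg_smul_le (hq.yosida_nonneg hm') ht (v - u)
  have h3 := norm_exp_neg_smul_le (hq.yosida_nonneg hn') ht (u - v)
  rw [dist_eq_norm] at h1 ⊢
  have h4 : NormedSpace.exp ((-t) • yosida q (m : ℝ)) v -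
      NormedSpace.exp ((-t) • yosida q (n : ℝ)) v
    = NormedSpace.exp ((-t) • yosida q (m : ℝ)) (v - u) +
      (NormedSpace.exp ((-t) • yosida q (m : ℝ)) u - NormedSpace.exp ((-t) • yosida q (n : ℝ)) u) +
      NormedSpace.exp ((-t) • yosida q (n : ℝ)) (u - v) := by
    rw [map_sub, map_sub]; abel
  rw [h4]
  refine norm_add₃_le.trans_lt ?_
  rw [norm_sub_rev] at h2
  linarith

lemma semigroup_symm (ht : 0 ≤ t) (v w : K) :
    inner ℝ (semigroup q t v) w = inner ℝ v (semigroup q t w) := by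
  have h1 := (hq.tendsto_semigroup ht v).inner (𝕜 := ℝ) (tendsto_const_nhds (x := w))
  have h2 := (tendsto_const_nhds (x := v)).inner (𝕜 := ℝ) (hq.tendsto_semigroup ht w)
  refine tendsto_nhds_unique h1 (h2.congr' ?_)
  filter_upwards [eventually_gt_atTop 0] with n hn
  exact (exp_symm (hq.yosida_symm (Nat.cast_pos.2 hn)) t v w).symm

/-- On the domain of `H²`, which is the range of `(I + H)⁻²`, the semigroup has a first order
Taylor expansion. -/
lemma norm_semigroup_sub_le (ht : 0 ≤ t) (w : K) :
    ‖semigroup q t (formResolvent q 1 (formResolvent q 1 w)) -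
      formResolvent q 1 (formResolvent q 1 w) +
      t • (formResolvent q 1 w - formResolvent q 1 (formResolvent q 1 w))‖
      ≤ 4 * ‖w‖ * t * t := by
  set u := formResolvent q 1 (formResolvent q 1 w) with hu
  have hA : Tendsto (fun n : ℕ => yosida q (n : ℝ) u) atTop (𝓝 (formResolvent q 1 w - u)) := by
    refine (hq.tendsto_smul_resolvent (formResolvent q 1 w - u)).congr' ?_
    filter_upwards [eventually_gt_atTop 0] with n hn
    exact (hq.yosida_resolvent (Nat.cast_pos.2 hn) _).symm
  refine le_of_tendsto (((hq.tendsto_semigroup ht u).sub_const u).add (hA.const_smul t)).norm ?_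
  filter_upwards [eventually_gt_atTop 0] with n hn
  have hn' : (0 : ℝ) < n := Nat.cast_pos.2 hn
  refine (norm_exp_sub_taylor_le (hq.yosida_nonneg hn') ht u).trans ?_
  gcongr
  exact hq.norm_yosida_yosida_le hn' w

end IsClosedForm

/-! ### Forms on a closed subspace -/

section Subspace

variable [CompleteSpace K] {K₁ : Submodule ℝ K} [CompleteSpace K₁] {q₁ : K₁ → ℝ≥0∞}
  {q₂ : K → ℝ≥0∞} (h₁ : IsClosedForm q₁) (h₂ : IsClosedForm q₂)
include h₁ h₂

/-- If the resolvents of two closed forms agree on a closed subspace, then so do the semigroups. -/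
theorem semigroup_eq_of_resolvent_eq
    (h : ∀ (n : ℕ) (f : K₁), 0 < n →
      (formResolvent q₁ (n : ℝ) f : K) = formResolvent q₂ (n : ℝ) (f : K))
    {t : ℝ} (ht : 0 ≤ t) (f : K₁) : ((semigroup q₁ t f : K₁) : K) = semigroup q₂ t (f : K) := by
  have h3 := (K₁.subtypeL.continuous.tendsto _).comp (h₁.tendsto_semigroup ht f)
  refine tendsto_nhds_unique h3 ((h₂.tendsto_semigroup ht (f : K)).congr' ?_)
  filter_upwards [eventually_gt_atTop 0] with n hn
  exact (exp_intertwine K₁.subtypeL (yosida q₁ (n : ℝ)) (fun v => by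
    simp [yosida_apply, h n v hn]) t f).symm

/-- If the semigroups of two closed forms agree on a closed subspace, then so do the resolvents.
The generators are compared through their weak derivatives at time zero. -/
theorem resolvent_eq_of_semigroup_eq
    (h : ∀ (f : K₁) (t : ℝ), 0 < t → ((semigroup q₁ t f : K₁) : K) = semigroup q₂ t (f : K))
    {l : ℝ} (hl : 0 < l) (f : K₁) : (formResolvent q₁ l f : K) = formResolvent q₂ l (f : K) := by
  -- it suffices to treat `l = 1` and vectors in the range of the resolvent of `q₁`
  have hsq : ∀ w : K₁, (formResolvent q₁ 1 (formResolvent q₁ 1 w) : K) =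
      formResolvent q₂ 1 (formResolvent q₁ 1 w : K) := fun w => by
    set z := formResolvent q₁ 1 w with hz
    set u := formResolvent q₁ 1 z with hu
    set g : K := (z : K) - (u : K) with hg
    -- `g = H₁ u`; the derivatives at `t = 0` of `(S₁ t u, v) = (u, S₂ t v)` agree
    have hweak : ∀ x : K, inner ℝ g (formResolvent q₂ 1 (formResolvent q₂ 1 x)) =
        inner ℝ (u : K) (formResolvent q₂ 1 x - formResolvent q₂ 1 (formResolvent q₂ 1 x)) := by
      intro x
      set v := formResolvent q₂ 1 (formResolvent q₂ 1 x) with hv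
      set k := formResolvent q₂ 1 x - v with hk
      have hb : ∀ t : ℝ, 0 < t → |inner ℝ g v - inner ℝ (u : K) k| ≤
          (4 * ‖w‖ * ‖v‖ + ‖(u : K)‖ * (4 * ‖x‖)) * t := fun t ht => by
        have e1 := h₁.norm_semigroup_sub_le ht.le w
        have e2 := h₂.norm_semigroup_sub_le ht.le x
        rw [← hz, ← hu] at e1
        rw [← hv, ← hk] at e2
        have e3 : ‖semigroup q₂ t (u : K) - u + t • g‖ ≤ 4 * ‖w‖ * t * t := by
          rw [← h u t ht]; exact e1
        have e4 : t * (inner ℝ g v - inner ℝ (u : K) k) =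
            inner ℝ (semigroup q₂ t (u : K) - u + t • g) v -
            inner ℝ (u : K) (semigroup q₂ t v - v + t • k) := by
          simp only [inner_add_left, inner_sub_left, inner_smul_left, inner_add_right,
            inner_sub_right, inner_smul_right, h₂.semigroup_symm ht.le, conj_trivial]
          ring
        have e5 := abs_real_inner_le_norm (semigroup q₂ t (u : K) - u + t • g) v
        have e6 := abs_real_inner_le_norm (u : K) (semigroup q₂ t v - v + t • k)
        have e7 : t * |inner ℝ g v - inner ℝ (u : K) k| ≤
            t * ((4 * ‖w‖ * ‖v‖ + ‖(u : K)‖ * (4 * ‖x‖)) * t) := by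
          rw [← abs_of_pos ht, ← abs_mul, abs_of_pos ht, e4]
          refine (abs_sub _ _).trans ?_
          have e8 := mul_le_mul_of_nonneg_right e3 (norm_nonneg v)
          have e9 := mul_le_mul_of_nonneg_left e2 (norm_nonneg (u : K))
          linarith
        exact le_of_mul_le_mul_left e7 ht
      have hlim : Tendsto (fun t : ℝ => (4 * ‖w‖ * ‖v‖ + ‖(u : K)‖ * (4 * ‖x‖)) * t) (𝓝[>] 0)
          (𝓝 0) := by
        have : Tendsto (fun t : ℝ => (4 * ‖w‖ * ‖v‖ + ‖(u : K)‖ * (4 * ‖x‖)) * t) (𝓝 0) (𝓝 _) :=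
          tendsto_id.const_mul _
        rw [mul_zero] at this
        exact this.mono_left nhdsWithin_le_nhds
      have := ge_of_tendsto hlim (eventually_mem_nhdsWithin.mono fun t ht => hb t ht)
      exact sub_eq_zero.1 (abs_nonpos_iff.1 this)
    have h3 : formResolvent q₂ 1 (formResolvent q₂ 1 g - u + formResolvent q₂ 1 (u : K)) = 0 := by
      refine ext_inner_right ℝ fun x => ?_
      have h4 := hweak x
      simp only [inner_sub_right, ← h₂.resolvent_symm one_pos] at h4
      simp only [map_add, map_sub, inner_add_left, inner_sub_left, inner_zero_left]
      linarith
    have h4 := h₂.resolvent_injective one_pos h3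
    have h5 : (z : K) = g + u := by rw [hg]; abel
    rw [h5, map_add, ← sub_eq_zero, ← neg_eq_zero, ← h4]
    abel
  have hone : ∀ f : K₁, (formResolvent q₁ 1 f : K) = formResolvent q₂ 1 (f : K) := fun f => by
    have hc : Continuous fun f : K₁ => (formResolvent q₁ 1 f : K) := by fun_prop
    have hc' : Continuous fun f : K₁ => formResolvent q₂ 1 (f : K) := by fun_prop
    refine congrFun (hc.ext_on (s := range (formResolvent q₁ 1)) h₁.denseRange_resolvent hc' ?_) f
    rintro _ ⟨w, rfl⟩
    exact hsq w
  symm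
  refine h₂.resolvent_unique hl ?_
  have h3 := h₁.resolvent_identity one_pos f l hl
  rw [← map_smul, ← map_add] at h3
  have h4 := h₂.isResolvent one_pos (f + (1 - l) • formResolvent q₁ l f : K₁)
  rw [← hone, ← h3] at h4
  convert! h4 using 1
  push_cast
  module

/-- If the resolvents of two closed forms agree on a closed subspace, then the orthogonal
projection `p` onto this subspace of an element `u` of the domain of the large form is in the
domain of the small one. -/
theorem ne_top_of_resolvent_eq
    (h : ∀ (n : ℕ) (f : K₁), 0 < n →
      (formResolvent q₁ (n : ℝ) f : K) = formResolvent q₂ (n : ℝ) (f : K))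
    {u : K} {p : K₁} (horth : ∀ w : K₁, inner ℝ (w : K) (u - p) = 0) (hu : q₂ u ≠ ∞) :
    q₁ p ≠ ∞ := by
  refine ne_top_of_le_ne_top ENNReal.ofReal_ne_top
    (h₁.le_of_approx_le (c := (q₂ u).toReal) fun n hn => ?_)
  have hn' : (0 : ℝ) < n := Nat.cast_pos.2 hn
  refine le_trans ?_ (h₂.approx_le hn' hu)
  have e1 : inner ℝ (p - (n : ℝ) • formResolvent q₁ n p) p =
      inner ℝ ((p : K) - (n : ℝ) • formResolvent q₂ n (p : K)) (p : K) := by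
    rw [Submodule.coe_inner]; push_cast; rw [h n p hn]
  set r : K := u - p with hr
  have e2 : u = p + r := by rw [hr]; abel
  have e3 : inner ℝ (p : K) r = 0 := horth p
  have e4 : inner ℝ (formResolvent q₂ n (p : K)) r = 0 := by rw [← h n p hn]; exact horth _
  have e5 : inner ℝ (formResolvent q₂ n r) (p : K) = 0 := by
    rw [h₂.resolvent_symm hn', real_inner_comm]; exact e4
  -- the approximating form of `u` splits into those of `p` and of `r`, without mixed terms
  have e6 : 0 ≤ (n : ℝ) * inner ℝ (r - (n : ℝ) • formResolvent q₂ n r) r :=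
    ENNReal.toReal_nonneg.trans (h₂.toReal_smul_resolvent_le_approx hn' r)
  have e7 : inner ℝ r (p : K) = 0 := by rw [real_inner_comm]; exact e3
  have e8 : (n : ℝ) * inner ℝ (u - (n : ℝ) • formResolvent q₂ n u) u =
      (n : ℝ) * inner ℝ ((p : K) - (n : ℝ) • formResolvent q₂ n (p : K)) (p : K) +
      (n : ℝ) * inner ℝ (r - (n : ℝ) • formResolvent q₂ n r) r := by
    rw [e2, map_add]
    simp only [inner_add_left, inner_sub_left, inner_smul_left, inner_add_right, smul_add,
      conj_trivial, e3, e4, e5, e7]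
    ring
  rw [e1, e8]
  linarith

end Subspace

/-! ### The relaxation of a quadratic form -/

section Relaxation

variable {K : Type*} [NormedAddCommGroup K]

lemma relaxation_le (q : K → ℝ≥0∞) (u : K) : relaxation q u ≤ q u := by
  rw [relaxation, liminf_eq]
  exact sSup_le fun a ha => (show ∀ᶠ v in 𝓝 u, a ≤ q v from ha).self_of_nhds

lemma lt_relaxation_iff {q : K → ℝ≥0∞} {u : K} {y : ℝ≥0∞} :
    y < relaxation q u ↔ ∃ z, y < z ∧ ∀ᶠ v in 𝓝 u, z ≤ q v := by
  rw [relaxation, liminf_eq, lt_sSup_iff]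
  exact ⟨fun ⟨a, h1, h2⟩ => ⟨a, h2, h1⟩, fun ⟨a, h1, h2⟩ => ⟨a, h2, h1⟩⟩

lemma lowerSemicontinuous_relaxation (q : K → ℝ≥0∞) : LowerSemicontinuous (relaxation q) := by
  intro u y hy
  obtain ⟨z, hyz, hz⟩ := lt_relaxation_iff.1 hy
  obtain ⟨w, hyw, hwz⟩ := exists_between hyz
  filter_upwards [hz.eventually_nhds] with v hv
  exact lt_relaxation_iff.2 ⟨z, hyz, hv⟩

lemma exists_seq_relaxation {q : K → ℝ≥0∞} {u : K} {y : ℝ≥0∞} (hy : relaxation q u < y) :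
    ∃ x : ℕ → K, Tendsto x atTop (𝓝 u) ∧ ∀ n, q (x n) < y := by
  have h : ∃ᶠ v in 𝓝 u, q v < y := by
    intro h
    simp only [not_lt] at h
    exact hy.not_ge (le_liminf_of_le (by isBoundedDefault) h)
  obtain ⟨x, hx, hxq⟩ := exists_seq_forall_of_frequently h
  exact ⟨x, hx, hxq⟩

lemma relaxation_le_of_tendsto {q : K → ℝ≥0∞} {u : K} {y : ℝ≥0∞} {x : ℕ → K}
    (hx : Tendsto x atTop (𝓝 u)) (h : ∀ n, q (x n) ≤ y) : relaxation q u ≤ y :=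
  le_of_tendsto_of_lsc (lowerSemicontinuous_relaxation q) hx
    (Eventually.of_forall fun n => (relaxation_le q _).trans (h n))

lemma le_relaxation {p q : K → ℝ≥0∞} (hp : LowerSemicontinuous p) (h : ∀ v, p v ≤ q v) (u : K) :
    p u ≤ relaxation q u :=
  (hp.le_liminf u).trans (liminf_le_liminf (Eventually.of_forall h))

end Relaxation

lemma relaxation_parallelogram_le {q : K → ℝ≥0∞} (hq : IsQuad q) (u v : K) :
    relaxation q (u + v) + relaxation q (u - v) ≤ 2 * relaxation q u + 2 * relaxation q v := by
  by_cases h : relaxation q u = ∞ ∨ relaxation q v = ∞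
  · rcases h with h | h <;> simp [h]
  push Not at h
  refine ENNReal.le_of_forall_pos_le_add fun ε hε _ => ?_
  have hε' : (ε / 4 : ℝ≥0∞) ≠ 0 := by simp [hε.ne']
  obtain ⟨x, hx, hxq⟩ := exists_seq_relaxation (ENNReal.lt_add_right h.1 hε')
  obtain ⟨z, hz, hzq⟩ := exists_seq_relaxation (ENNReal.lt_add_right h.2 hε')
  have hle := relaxation_le q
  have hlsc := lowerSemicontinuous_relaxation q
  generalize relaxation q = p at *
  have hlsc2 : LowerSemicontinuous fun y : K × K => p (y.1 + y.2) + p (y.1 - y.2) :=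
    (LowerSemicontinuous.comp hlsc continuous_add).add
      (LowerSemicontinuous.comp hlsc continuous_sub)
  have h1 : p (u + v) + p (u - v) ≤ 2 * (p u + ε / 4) + 2 * (p v + ε / 4) :=
    le_of_tendsto_of_lsc hlsc2 (hx.prodMk_nhds hz) (Eventually.of_forall fun n =>
      (add_le_add (hle _) (hle _)).trans ((hq.parallelogram_le _ _).trans
        (add_le_add (mul_le_mul_right (hxq n).le _) (mul_le_mul_right (hzq n).le _))))
  refine h1.trans_eq ?_
  calc 2 * (p u + ε / 4) + 2 * (p v + ε / 4) = 2 * p u + 2 * p v + 4 * (ε / 4) := by ring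
    _ = 2 * p u + 2 * p v + ε := by rw [ENNReal.mul_div_cancel (by simp) (by simp)]

lemma relaxation_smul {q : K → ℝ≥0∞} (hq : IsQuad q) (c : ℝ) (u : K) :
    relaxation q (c • u) = ENNReal.ofReal (c ^ 2) * relaxation q u := by
  rcases eq_or_ne c 0 with rfl | hc
  · have : relaxation q 0 = 0 := le_antisymm ((relaxation_le q 0).trans hq.map_zero.le) zero_le
    simp [this]
  have key : ∀ (c : ℝ) (u : K), c ≠ 0 →
      ENNReal.ofReal (c⁻¹ ^ 2) * relaxation q (c • u) ≤ relaxation q u := fun c u hc => by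
    refine le_relaxation (p := fun u => ENNReal.ofReal (c⁻¹ ^ 2) * relaxation q (c • u)) ?_ ?_ u
    · exact (ENNReal.continuous_const_mul ENNReal.ofReal_ne_top).comp_lowerSemicontinuous
        (LowerSemicontinuous.comp (f := relaxation q) (lowerSemicontinuous_relaxation q)
          (continuous_const_smul c))
        fun a b hab => mul_le_mul_right hab _
    · intro v
      calc ENNReal.ofReal (c⁻¹ ^ 2) * relaxation q (c • v)
          ≤ ENNReal.ofReal (c⁻¹ ^ 2) * q (c • v) := mul_le_mul_right (relaxation_le q _) _
        _ = q v := by rw [← hq.map_smul, smul_smul, inv_mul_cancel₀ hc, one_smul]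
  have h1 := key c u hc
  have h2 := key c⁻¹ (c • u) (inv_ne_zero hc)
  rw [inv_inv, smul_smul, inv_mul_cancel₀ hc, one_smul] at h2
  refine le_antisymm ?_ h2
  calc relaxation q (c • u)
      = ENNReal.ofReal (c ^ 2) * (ENNReal.ofReal (c⁻¹ ^ 2) * relaxation q (c • u)) := by
        rw [← mul_assoc, ← ENNReal.ofReal_mul (sq_nonneg c), ← mul_pow, mul_inv_cancel₀ hc]
        simp
    _ ≤ ENNReal.ofReal (c ^ 2) * relaxation q u := mul_le_mul_right h1 _

lemma isQuad_relaxation {q : K → ℝ≥0∞} (hq : IsQuad q) : IsQuad (relaxation q) where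
  parallelogram_le := relaxation_parallelogram_le hq
  map_smul := relaxation_smul hq

end QForm

namespace QForm

variable {K : Type*} [NormedAddCommGroup K] [InnerProductSpace ℝ K]

/-! ### Convergence with respect to a closed form -/

namespace IsClosedForm

variable {q : K → ℝ≥0∞} (hq : IsClosedForm q)
include hq

/-- A sequence that converges in norm and does not exceed the energy of its limit converges with
respect to the form, by the parallelogram law. -/
lemma tendsto_of_toReal_le {x : ℕ → K} {u : K} (hu : q u ≠ ∞) (hx : Tendsto x atTop (𝓝 u))
    (hxu : ∀ n, q (x n) ≤ q u) : Tendsto (fun n => (q (x n - u)).toReal) atTop (𝓝 0) := by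
  have hxt : ∀ n, q (x n) ≠ ∞ := fun n => ne_top_of_le_ne_top hu (hxu n)
  rw [tendsto_order]
  refine ⟨fun a ha => Eventually.of_forall fun n => ha.trans_le ENNReal.toReal_nonneg,
    fun ε hε => ?_⟩
  have h2 : q ((2 : ℝ) • u) ≠ ∞ := hq.smul_ne_top 2 hu
  have hxa : Tendsto (fun n => x n + u) atTop (𝓝 ((2 : ℝ) • u)) := by
    rw [two_smul]; exact hx.add_const u
  rcases le_or_gt (q ((2 : ℝ) • u)).toReal (ε / 2) with h0 | h0
  · rw [hq.toReal_smul] at h0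
    refine Eventually.of_forall fun n => ?_
    have h3 := hq.toReal_parallelogram (hxt n) hu
    have h4 := ENNReal.toReal_mono hu (hxu n)
    have h5 : 0 ≤ (q (x n + u)).toReal := ENNReal.toReal_nonneg
    linarith
  · have h1 : ENNReal.ofReal ((q ((2 : ℝ) • u)).toReal - ε / 2) < q ((2 : ℝ) • u) := by
      rw [ENNReal.ofReal_lt_iff_lt_toReal (by linarith) h2]; linarith
    filter_upwards [hxa.eventually (hq.lsc _ _ h1)] with n hn
    rw [gt_iff_lt, ENNReal.ofReal_lt_iff_lt_toReal (by linarith) (hq.add_ne_top (hxt n) hu),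
      hq.toReal_smul] at hn
    have h3 := hq.toReal_parallelogram (hxt n) hu
    have h4 := ENNReal.toReal_mono hu (hxu n)
    linarith

lemma tendsto_approx_polar [CompleteSpace K] {u v : K} (hu : q u ≠ ∞) (hv : q v ≠ ∞) :
    Tendsto (fun n : ℕ => (n : ℝ) * inner ℝ (u - (n : ℝ) • formResolvent q n u) v) atTop
      (𝓝 (polar q u v)) := by
  have h := ((hq.tendsto_approx (hq.add_ne_top hu hv)).sub
    (hq.tendsto_approx (hq.sub_ne_top hu hv))).div_const 4
  refine h.congr' ?_
  filter_upwards [eventually_gt_atTop 0] with n hn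
  have hs := hq.resolvent_symm (Nat.cast_pos.2 hn) u v
  rw [real_inner_comm] at hs
  simp only [map_add, map_sub, inner_add_left, inner_sub_left, inner_add_right, inner_sub_right,
    smul_add, smul_sub, inner_smul_left, conj_trivial]
  rw [real_inner_comm u v, real_inner_comm v (formResolvent q n u), hs]
  rw [real_inner_comm u (formResolvent q n v)]
  ring

end IsClosedForm

end QForm

namespace DirichletForm

variable {X : Type*} [MeasurableSpace X] {μ : Measure X} (E : DirichletForm μ)

/-! ### The quadratic form of a Dirichlet form -/

section Val

variable {E} {u v w : L2 μ}

lemma val_eq (hu : u ∈ E.domain) (hv : v ∈ E.domain) : E.val u v = E.form ⟨u, hu⟩ ⟨v, hv⟩ :=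
  dif_pos ⟨hu, hv⟩

lemma val_comm (u v : L2 μ) : E.val u v = E.val v u := by
  by_cases h : u ∈ E.domain ∧ v ∈ E.domain
  · rw [val_eq h.1 h.2, val_eq h.2 h.1, E.symm]
  · rw [val, val, dif_neg h, dif_neg (fun h' => h h'.symm)]

lemma val_self_nonneg (u : L2 μ) : 0 ≤ E.val u u := by
  by_cases h : u ∈ E.domain
  · rw [val_eq h h]; exact E.nonneg _
  · rw [val, dif_neg (fun h' => h h'.1)]

lemma val_add_left (hu : u ∈ E.domain) (hw : w ∈ E.domain) (hv : v ∈ E.domain) :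
    E.val (u + w) v = E.val u v + E.val w v := by
  rw [val_eq (E.domain.add_mem hu hw) hv, val_eq hu hv, val_eq hw hv, ← LinearMap.add_apply,
    ← map_add]
  rfl

lemma val_smul_left (c : ℝ) (hu : u ∈ E.domain) (hv : v ∈ E.domain) :
    E.val (c • u) v = c * E.val u v := by
  rw [val_eq (E.domain.smul_mem c hu) hv, val_eq hu hv, ← smul_eq_mul, ← LinearMap.smul_apply,
    ← map_smul]
  rfl

lemma val_add_right (hu : u ∈ E.domain) (hv : v ∈ E.domain) (hw : w ∈ E.domain) :
    E.val u (v + w) = E.val u v + E.val u w := by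
  rw [val_comm, val_add_left hv hw hu, val_comm v, val_comm w]

lemma val_smul_right (c : ℝ) (hu : u ∈ E.domain) (hv : v ∈ E.domain) :
    E.val u (c • v) = c * E.val u v := by
  rw [val_comm, val_smul_left c hv hu, val_comm v]

lemma val_sub_left (hu : u ∈ E.domain) (hw : w ∈ E.domain) (hv : v ∈ E.domain) :
    E.val (u - w) v = E.val u v - E.val w v := by
  have h : u - w = u + (-1 : ℝ) • w := by module
  rw [h, val_add_left hu (E.domain.smul_mem _ hw) hv, val_smul_left _ hw hv]; ring

lemma val_sub_right (hu : u ∈ E.domain) (hv : v ∈ E.domain) (hw : w ∈ E.domain) :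
    E.val u (v - w) = E.val u v - E.val u w := by
  rw [val_comm, val_sub_left hv hw hu, val_comm v, val_comm w]

lemma val_smul_smul (c : ℝ) (hu : u ∈ E.domain) : E.val (c • u) (c • u) = c ^ 2 * E.val u u := by
  rw [val_smul_left c hu (E.domain.smul_mem c hu), val_smul_right c hu hu]; ring

lemma val_parallelogram (hu : u ∈ E.domain) (hv : v ∈ E.domain) :
    E.val (u + v) (u + v) + E.val (u - v) (u - v) = 2 * E.val u u + 2 * E.val v v := by
  have ha := E.domain.add_mem hu hv
  have hs := E.domain.sub_mem hu hv
  rw [val_add_left hu hv ha, val_add_right hu hu hv, val_add_right hv hu hv,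
    val_sub_left hu hv hs, val_sub_right hu hu hv, val_sub_right hv hu hv]
  ring

lemma normSq_nonneg (u : L2 μ) : 0 ≤ E.normSq u :=
  add_nonneg (sq_nonneg _) (val_self_nonneg u)

lemma val_le_normSq (u : L2 μ) : E.val u u ≤ E.normSq u :=
  le_add_of_nonneg_left (sq_nonneg _)

lemma norm_sq_le_normSq (u : L2 μ) : ‖u‖ ^ 2 ≤ E.normSq u :=
  le_add_of_nonneg_right (val_self_nonneg u)

lemma val_zero : E.val 0 0 = 0 := by
  simpa using val_smul_smul (E := E) 0 E.domain.zero_mem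

lemma normSq_zero : E.normSq 0 = 0 := by
  rw [normSq, val_zero, norm_zero]; norm_num

lemma normSq_smul (c : ℝ) (hu : u ∈ E.domain) : E.normSq (c • u) = c ^ 2 * E.normSq u := by
  rw [normSq, normSq, val_smul_smul c hu, norm_smul, mul_pow, Real.norm_eq_abs, sq_abs]; ring

lemma normSq_sub_comm (hu : u ∈ E.domain) (hv : v ∈ E.domain) :
    E.normSq (u - v) = E.normSq (v - u) := by
  have h : u - v = (-1 : ℝ) • (v - u) := by module
  rw [h, normSq_smul _ (E.domain.sub_mem hv hu)]; ring

lemma normSq_add_le (hu : u ∈ E.domain) (hv : v ∈ E.domain) :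
    E.normSq (u + v) ≤ 2 * E.normSq u + 2 * E.normSq v := by
  have h1 := val_parallelogram hu hv
  have h2 := val_self_nonneg (E := E) (u - v)
  have h3 := parallelogram_law_with_norm ℝ u v
  simp only [normSq]
  nlinarith [sq_nonneg ‖u - v‖]

lemma normSq_sub_le (hu : u ∈ E.domain) (hv : v ∈ E.domain) (hw : w ∈ E.domain) :
    E.normSq (u - w) ≤ 2 * E.normSq (u - v) + 2 * E.normSq (v - w) := by
  have h := normSq_add_le (E.domain.sub_mem hu hv) (E.domain.sub_mem hv hw)
  rwa [sub_add_sub_cancel] at h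

lemma tendsto_of_normSq {x : ℕ → L2 μ} (h : Tendsto (fun n => E.normSq (x n - u)) atTop (𝓝 0)) :
    Tendsto x atTop (𝓝 u) := by
  rw [tendsto_iff_norm_sub_tendsto_zero]
  have h1 : Tendsto (fun n => √(E.normSq (x n - u))) atTop (𝓝 0) := by simpa using h.sqrt
  exact squeeze_zero (fun _ => norm_nonneg _)
    (fun n => Real.le_sqrt_of_sq_le (norm_sq_le_normSq _)) h1

end Val

/-- The restriction of the quadratic form of `E` to a subset of its domain, with the value `∞`
off this subset. -/
def quadOn (D : Submodule ℝ (L2 μ)) (φ : L2 μ) : ℝ≥0∞ :=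
  open Classical in if φ ∈ D then ENNReal.ofReal (E.val φ φ) else ∞

/-- The quadratic form `E(φ) = E(φ, φ)`, with the value `∞` off the domain. -/
def quad : L2 μ → ℝ≥0∞ := E.quadOn E.domain

variable {E} {D : Submodule ℝ (L2 μ)}

lemma quadOn_ne_top {u : L2 μ} : E.quadOn D u ≠ ∞ ↔ u ∈ D := by
  rw [quadOn]; split_ifs with h <;> simp [h]

lemma quadOn_of_mem {u : L2 μ} (hu : u ∈ D) : E.quadOn D u = ENNReal.ofReal (E.val u u) :=
  if_pos hu

lemma quadOn_toReal {u : L2 μ} (hu : u ∈ D) : (E.quadOn D u).toReal = E.val u u := by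
  rw [quadOn_of_mem hu, ENNReal.toReal_ofReal (val_self_nonneg u)]

lemma isQuad_quadOn (hD : D ≤ E.domain) : QForm.IsQuad (E.quadOn D) where
  parallelogram_le u v := by
    by_cases h : u ∈ D ∧ v ∈ D
    · rw [quadOn_of_mem h.1, quadOn_of_mem h.2, quadOn_of_mem (D.add_mem h.1 h.2),
        quadOn_of_mem (D.sub_mem h.1 h.2), ← ENNReal.ofReal_add (val_self_nonneg _)
        (val_self_nonneg _), val_parallelogram (hD h.1) (hD h.2),
        ENNReal.ofReal_add (by linarith [val_self_nonneg (E := E) u])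
          (by linarith [val_self_nonneg (E := E) v]),
        ENNReal.ofReal_mul zero_le_two, ENNReal.ofReal_mul zero_le_two, ENNReal.ofReal_ofNat]
    · rcases not_and_or.1 h with h | h <;> simp [quadOn, h]
  map_smul c u := by
    by_cases h : u ∈ D
    · rw [quadOn_of_mem h, quadOn_of_mem (D.smul_mem c h), val_smul_smul c (hD h),
        ENNReal.ofReal_mul (sq_nonneg c)]
    · rcases eq_or_ne c 0 with rfl | hc
      · rw [zero_smul, quadOn_of_mem D.zero_mem]
        rw [val_zero]
        simp
      · rw [quadOn, quadOn, if_neg h, if_neg ((D.smul_mem_iff hc).not.2 h),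
          ENNReal.mul_top (by simpa using hc)]

/-- If the subspace `D` of the domain is closed for the graph norm, then the restriction of the
form to `D` is lower semicontinuous. -/
lemma lowerSemicontinuous_quadOn (hD : D ≤ E.domain)
    (hcl : ∀ (x : ℕ → L2 μ) (u : L2 μ), (∀ n, x n ∈ D) → u ∈ E.domain →
      Tendsto (fun n => E.normSq (x n - u)) atTop (𝓝 0) → u ∈ D) :
    LowerSemicontinuous (E.quadOn D) := by
  refine (isQuad_quadOn hD).lowerSemicontinuous_of_complete fun x u hx hxu hc => ?_
  simp only [quadOn_ne_top] at hx ⊢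
  obtain ⟨v, hv⟩ := E.closed (fun n => ⟨x n, hD (hx n)⟩) fun ε hε => by
    obtain ⟨N, hN⟩ := hc (ε / 2) (by positivity)
    obtain ⟨M, hM⟩ := Metric.cauchySeq_iff.1 hxu.cauchySeq (√(ε / 2)) (by positivity)
    refine ⟨max N M, fun m hm n hn => ?_⟩
    have h1 := hN m (le_trans (le_max_left _ _) hm) n (le_trans (le_max_left _ _) hn)
    have h2 := hM m (le_trans (le_max_right _ _) hm) n (le_trans (le_max_right _ _) hn)
    rw [quadOn_toReal (D.sub_mem (hx m) (hx n)),
      val_eq (E.domain.sub_mem (hD (hx m)) (hD (hx n)))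
        (E.domain.sub_mem (hD (hx m)) (hD (hx n)))] at h1
    rw [dist_eq_norm, Real.lt_sqrt (norm_nonneg _)] at h2
    have h3 : ‖x m - x n‖ ^ 2 + E.form ⟨x m - x n, E.domain.sub_mem (hD (hx m)) (hD (hx n))⟩
      ⟨x m - x n, E.domain.sub_mem (hD (hx m)) (hD (hx n))⟩ < ε := by linarith
    exact h3
  have hv' : Tendsto (fun n => E.normSq (x n - v)) atTop (𝓝 0) := by
    refine hv.congr fun n => ?_
    rw [normSq, val_eq (E.domain.sub_mem (hD (hx n)) v.2) (E.domain.sub_mem (hD (hx n)) v.2)]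
    rfl
  have huv : u = v := tendsto_nhds_unique hxu (tendsto_of_normSq hv')
  rw [← huv] at hv'
  have hu : u ∈ D := hcl x u hx (huv ▸ v.2) hv'
  refine ⟨hu, squeeze_zero (fun _ => ENNReal.toReal_nonneg) (fun n => ?_) hv'⟩
  rw [quadOn_toReal (D.sub_mem (hx n) hu)]
  exact val_le_normSq _

lemma polar_quadOn (hD : D ≤ E.domain) {u v : L2 μ} (hu : u ∈ D) (hv : v ∈ D) :
    QForm.polar (E.quadOn D) u v = E.val u v := by
  rw [QForm.polar, quadOn_toReal (D.add_mem hu hv), quadOn_toReal (D.sub_mem hu hv)]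
  have hu := hD hu
  have hv := hD hv
  rw [val_add_left hu hv (E.domain.add_mem hu hv), val_add_right hu hu hv, val_add_right hv hu hv,
    val_sub_left hu hv (E.domain.sub_mem hu hv), val_sub_right hu hu hv, val_sub_right hv hu hv,
    val_comm v u]
  ring

lemma quad_eq_quadOn : E.quad = E.quadOn E.domain := rfl

lemma isClosedForm_quad (E : DirichletForm μ) : QForm.IsClosedForm E.quad where
  toIsQuad := isQuad_quadOn le_rfl
  lsc := lowerSemicontinuous_quadOn le_rfl fun _ _ _ hu _ => hu
  dense := by
    convert! E.dense_domain using 1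
    ext u
    exact quadOn_ne_top

lemma quad_ne_top {u : L2 μ} : E.quad u ≠ ∞ ↔ u ∈ E.domain := quadOn_ne_top

lemma quad_toReal {u : L2 μ} (hu : u ∈ E.domain) : (E.quad u).toReal = E.val u u :=
  quadOn_toReal hu

lemma quad_le_ofReal {u : L2 μ} {c : ℝ} (hc : 0 ≤ c) :
    E.quad u ≤ ENNReal.ofReal c ↔ u ∈ E.domain ∧ E.val u u ≤ c := by
  constructor
  · intro h
    have hu := quad_ne_top.1 (ne_top_of_le_ne_top ENNReal.ofReal_ne_top h)
    rw [quad_eq_quadOn, quadOn_of_mem hu, ENNReal.ofReal_le_ofReal_iff hc] at h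
    exact ⟨hu, h⟩
  · rintro ⟨hu, h⟩
    rw [quad_eq_quadOn, quadOn_of_mem hu]
    exact ENNReal.ofReal_le_ofReal h

/-- Lower semicontinuity of the energy in the norm of `L₂(X)`. -/
lemma mem_and_val_le_of_tendsto {x : ℕ → L2 μ} {u : L2 μ} {c : ℝ}
    (hx : Tendsto x atTop (𝓝 u)) (h : ∀ n, x n ∈ E.domain ∧ E.val (x n) (x n) ≤ c) :
    u ∈ E.domain ∧ E.val u u ≤ c := by
  have hc : 0 ≤ c := (val_self_nonneg _).trans (h 0).2
  rw [← quad_le_ofReal hc]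
  exact QForm.le_of_tendsto_of_lsc E.isClosedForm_quad.lsc hx
    (Eventually.of_forall fun n => (quad_le_ofReal hc).2 (h n))

lemma tendsto_normSq_of_val_le {x : ℕ → L2 μ} {u : L2 μ} (hu : u ∈ E.domain)
    (hx : Tendsto x atTop (𝓝 u)) (h : ∀ n, x n ∈ E.domain ∧ E.val (x n) (x n) ≤ E.val u u) :
    Tendsto (fun n => E.normSq (x n - u)) atTop (𝓝 0) := by
  have h1 := E.isClosedForm_quad.tendsto_of_toReal_le (quad_ne_top.2 hu) hx fun n => by
    rw [quad_eq_quadOn, quadOn_of_mem hu, quadOn_of_mem (h n).1]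
    exact ENNReal.ofReal_le_ofReal (h n).2
  have h2 := ((tendsto_iff_norm_sub_tendsto_zero.1 hx).pow 2).add h1
  simp only [ne_eq, OfNat.ofNat_ne_zero, not_false_eq_true, zero_pow, add_zero] at h2
  refine h2.congr fun n => ?_
  rw [quad_toReal (E.domain.sub_mem (h n).1 hu), normSq]

lemma tendsto_val_self {x : ℕ → L2 μ} {u : L2 μ} (hu : u ∈ E.domain) (hx : ∀ n, x n ∈ E.domain)
    (h : Tendsto (fun n => E.normSq (x n - u)) atTop (𝓝 0)) :
    Tendsto (fun n => E.val (x n) (x n)) atTop (𝓝 (E.val u u)) := by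
  have h1 := E.isClosedForm_quad.tendsto_toReal (fun n => quad_ne_top.2 (hx n))
    (quad_ne_top.2 hu) (squeeze_zero (fun _ => ENNReal.toReal_nonneg) (fun n => by
      rw [quad_toReal (E.domain.sub_mem (hx n) hu)]; exact val_le_normSq _) h)
  rw [quad_toReal hu] at h1
  exact h1.congr fun n => quad_toReal (hx n)

end DirichletForm

/-! ### Elements of `L₂(X)` -/

section L2Lemmas

variable {X : Type*} [MeasurableSpace X] {μ : Measure X}

lemma toL2_ae {g : X → ℝ} (hg : MemLp g 2 μ) : toL2 μ g =ᵐ[μ] g := by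
  rw [toL2, dif_pos hg]; exact hg.coeFn_toLp

lemma toL2_eq_of_ae {g : X → ℝ} {f : L2 μ} (h : f =ᵐ[μ] g) : toL2 μ g = f := by
  have hg : MemLp g 2 μ := (memLp_congr_ae h).1 (Lp.memLp f)
  exact Lp.ext ((toL2_ae hg).trans h.symm)

lemma memLp_two_of_le {g : X → ℝ} {f : L2 μ} {c : ℝ} (hg : AEStronglyMeasurable g μ)
    (h : ∀ᵐ x ∂μ, |g x| ≤ c * |f x|) : MemLp g 2 μ :=
  (Lp.memLp f).of_le_mul hg h

lemma toL2_ae_of_le {g : X → ℝ} {f : L2 μ} {c : ℝ} (hg : AEStronglyMeasurable g μ)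
    (h : ∀ᵐ x ∂μ, |g x| ≤ c * |f x|) : toL2 μ g =ᵐ[μ] g :=
  toL2_ae (memLp_two_of_le hg h)

lemma aestronglyMeasurable_coe (f : L2 μ) : AEStronglyMeasurable f μ :=
  Lp.aestronglyMeasurable f

lemma integrable_mul_coe (f g : L2 μ) : Integrable (fun x => f x * g x) μ :=
  (Lp.memLp f).integrable_mul (Lp.memLp g)

lemma inner_eq_integral (f g : L2 μ) : inner ℝ f g = ∫ x, f x * g x ∂μ := by
  rw [L2.inner_def]
  exact integral_congr_ae (Eventually.of_forall fun x => mul_comm _ _)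

lemma memLp_top_iff {f : X → ℝ} (hf : AEStronglyMeasurable f μ) :
    MemLp f ∞ μ ↔ ∃ M : ℝ, 0 ≤ M ∧ ∀ᵐ x ∂μ, |f x| ≤ M := by
  constructor
  · intro h
    have ht : eLpNormEssSup f μ ≠ ∞ := by simpa using h.2.ne
    refine ⟨(eLpNormEssSup f μ).toReal, ENNReal.toReal_nonneg, ?_⟩
    filter_upwards [ae_le_eLpNormEssSup (f := f) (μ := μ)] with x hx
    have := ENNReal.toReal_mono ht hx
    simpa using this
  · rintro ⟨M, -, h⟩
    exact memLp_top_of_bound hf M h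

/-- Dominated convergence in `L₂(X)`. -/
lemma tendsto_L2_of_dominated {F : ℕ → L2 μ} {f g : L2 μ} (hb : ∀ n, ∀ᵐ x ∂μ, |F n x| ≤ |g x|)
    (hlim : ∀ᵐ x ∂μ, Tendsto (fun n => F n x) atTop (𝓝 (f x))) : Tendsto F atTop (𝓝 f) := by
  have hfg : ∀ᵐ x ∂μ, |f x| ≤ |g x| := by
    filter_upwards [hlim, ae_all_iff.2 hb] with x h1 h2
    exact le_of_tendsto' h1.abs h2
  have hsq : Tendsto (fun n => ‖F n - f‖ ^ 2) atTop (𝓝 0) := by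
    have h1 : ∀ n, ‖F n - f‖ ^ 2 = ∫ x, (F n x - f x) ^ 2 ∂μ := fun n => by
      rw [← real_inner_self_eq_norm_sq, inner_eq_integral]
      refine integral_congr_ae ?_
      filter_upwards [Lp.coeFn_sub (F n) f] with x hx
      rw [hx, Pi.sub_apply, sq]
    simp only [h1]
    have h2 := tendsto_integral_of_dominated_convergence (F := fun n x => (F n x - f x) ^ 2)
      (f := fun _ => (0 : ℝ)) (μ := μ) (fun x => 4 * (g x * g x))
      (fun n => (((aestronglyMeasurable_coe (F n)).sub (aestronglyMeasurable_coe f)).pow 2))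
      ((integrable_mul_coe g g).const_mul 4)
      (fun n => by
        filter_upwards [hb n, hfg] with x h3 h4
        rw [Real.norm_eq_abs, abs_pow, sq_abs]
        have h5 : |F n x - f x| ≤ 2 * |g x| := (abs_sub _ _).trans (by linarith)
        have h6 := pow_le_pow_left₀ (abs_nonneg _) h5 2
        rw [sq_abs, mul_pow, sq_abs] at h6
        linarith)
      (by
        filter_upwards [hlim] with x hx
        simpa using (hx.sub_const (f x)).pow 2)
    simpa using h2
  rw [tendsto_iff_norm_sub_tendsto_zero]
  simpa [Real.sqrt_sq (norm_nonneg _)] using hsq.sqrt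

lemma ae_le_of_tendsto_L2 {F : ℕ → L2 μ} {f g : L2 μ} (h : Tendsto F atTop (𝓝 f))
    (hg : ∀ᶠ n in atTop, ∀ᵐ x ∂μ, g x ≤ F n x) : ∀ᵐ x ∂μ, g x ≤ f x :=
  (Lp.coeFn_le g f).2 (ge_of_tendsto h (hg.mono fun n hn => (Lp.coeFn_le g (F n)).1 hn))

end L2Lemmas

/-! ### Symmetric sub-Markovian operators -/

/-- A symmetric sub-Markovian operator on `L₂(X)`. -/
structure IsSubMarkov {X : Type*} [MeasurableSpace X] {μ : Measure X}
    (S : L2 μ →L[ℝ] L2 μ) : Prop where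
  symm : ∀ f g, inner ℝ (S f) g = inner ℝ f (S g)
  markov : ∀ f : L2 μ, (∀ᵐ x ∂μ, 0 ≤ f x ∧ f x ≤ 1) → ∀ᵐ x ∂μ, 0 ≤ S f x ∧ S f x ≤ 1

namespace IsSubMarkov

variable {X : Type*} [MeasurableSpace X] {μ : Measure X} {S : L2 μ →L[ℝ] L2 μ}

lemma integrable_sq {f f₂ : L2 μ} (hf₂ : ∀ᵐ x ∂μ, f₂ x = f x ^ 2) : Integrable f₂ μ :=
  (integrable_mul_coe f f).congr (by filter_upwards [hf₂] with x h; rw [h, sq])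

/-- The truncated form of `(f, f - S f)` is half the integral of the conditional variance. -/
lemma truncated_eq {f f₂ χ p : L2 μ} (hf₂ : ∀ᵐ x ∂μ, f₂ x = f x ^ 2)
    (hp : ∀ᵐ x ∂μ, p x = χ x * f x) :
    Integrable (fun x => χ x * (f₂ x - 2 * f x * S f x + S f₂ x)) μ ∧
    inner ℝ p (f - S f) - inner ℝ χ (f₂ - S f₂) / 2 =
      (∫ x, χ x * (f₂ x - 2 * f x * S f x + S f₂ x) ∂μ) / 2 := by
  have hae : (fun x => 2 * (p x * (f - S f) x) - χ x * (f₂ - S f₂) x) =ᵐ[μ]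
      fun x => χ x * (f₂ x - 2 * f x * S f x + S f₂ x) := by
    filter_upwards [hf₂, hp, Lp.coeFn_sub f (S f), Lp.coeFn_sub f₂ (S f₂)] with x e1 e2 e3 e4
    rw [e3, e4, Pi.sub_apply, Pi.sub_apply, e2, e1]
    ring
  have hi1 := (integrable_mul_coe p (f - S f)).const_mul 2
  have hi2 := integrable_mul_coe χ (f₂ - S f₂)
  refine ⟨(hi1.sub hi2).congr hae, ?_⟩
  rw [← integral_congr_ae hae, integral_sub hi1 hi2, integral_const_mul, inner_eq_integral,
    inner_eq_integral]
  ring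

lemma integrableOn_variance {f f₂ : L2 μ} (hf₂ : ∀ᵐ x ∂μ, f₂ x = f x ^ 2) {A : Set X}
    (hA : μ A ≠ ∞) : IntegrableOn (fun x => f₂ x - 2 * f x * S f x + S f₂ x) A μ := by
  refine (((integrable_sq hf₂).integrableOn).sub ?_).add
    (integrableOn_Lp_of_measure_ne_top _ (by norm_num) hA)
  refine (((integrable_mul_coe f (S f)).const_mul 2).congr ?_).integrableOn
  exact Eventually.of_forall fun x => (mul_assoc _ _ _).symm

/-- The integral of the conditional variance over a set `A` is at most the integral over `A` of
`f² - 2 f S f` plus the integral of `f²`, because `S 1_A ≤ 1`. These bounds converge to the form as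
`A` increases to the whole space. -/
lemma tendsto_setIntegral_variance [SigmaFinite μ] {f f₂ : L2 μ} (hf₂ : ∀ᵐ x ∂μ, f₂ x = f x ^ 2) :
    Tendsto (fun n => ∫ x in spanningSets μ n, (f₂ x - 2 * (f x * S f x)) ∂μ + ∫ x, f₂ x ∂μ) atTop
      (𝓝 (2 * inner ℝ f (f - S f))) := by
  have hi : Integrable (fun x => f₂ x - 2 * (f x * S f x)) μ :=
    (integrable_sq hf₂).sub ((integrable_mul_coe f (S f)).const_mul 2)
  have h := tendsto_setIntegral_of_monotone (μ := μ) (fun n => measurableSet_spanningSets μ n)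
    (monotone_spanningSets μ) hi.integrableOn
  rw [iUnion_spanningSets, setIntegral_univ] at h
  convert! h.add_const (∫ x, f₂ x ∂μ) using 2
  have h2 : ∫ x, f₂ x ∂μ = ∫ x, f x * f x ∂μ :=
    integral_congr_ae (by filter_upwards [hf₂] with x h; rw [h, sq])
  rw [integral_sub (integrable_sq hf₂) ((integrable_mul_coe f (S f)).const_mul 2),
    integral_const_mul, inner_sub_right, inner_eq_integral, inner_eq_integral, h2]
  ring

variable (hS : IsSubMarkov S)
include hS

/-- Positivity: the bounded truncations `min f n` are treated by scaling. -/
lemma nonneg {f : L2 μ} (hf : ∀ᵐ x ∂μ, 0 ≤ f x) : ∀ᵐ x ∂μ, 0 ≤ S f x := by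
  have hm : ∀ n : ℕ, AEStronglyMeasurable (fun x => min (f x) n) μ := fun n =>
    (aestronglyMeasurable_coe f).inf aestronglyMeasurable_const
  have hle : ∀ n : ℕ, ∀ᵐ x ∂μ, |min (f x) (n : ℝ)| ≤ 1 * |f x| := fun n => by
    filter_upwards [hf] with x hx
    rw [one_mul, abs_of_nonneg hx, abs_of_nonneg (le_min hx n.cast_nonneg)]
    exact min_le_left _ _
  have hF := fun n => toL2_ae_of_le (hm n) (hle n)
  have hlim : Tendsto (fun n : ℕ => toL2 μ fun x => min (f x) (n : ℝ)) atTop (𝓝 f) := by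
    refine tendsto_L2_of_dominated (g := f) (fun n => ?_) ?_
    · filter_upwards [hF n, hle n] with x h1 h2
      rw [h1]; simpa using h2
    · filter_upwards [ae_all_iff.2 hF] with x hx
      simp only [hx]
      refine tendsto_const_nhds.congr' ?_
      filter_upwards [eventually_ge_atTop ⌈f x⌉₊] with n hn
      exact (min_eq_left ((Nat.le_ceil _).trans (Nat.cast_le.2 hn))).symm
  have h0 := ae_le_of_tendsto_L2 (g := 0) ((S.continuous.tendsto f).comp hlim) (by
    filter_upwards [eventually_gt_atTop 0] with n hn
    have hn' : (0 : ℝ) < n := Nat.cast_pos.2 hn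
    set F := toL2 μ fun x => min (f x) (n : ℝ)
    have h1 := hS.markov ((n : ℝ)⁻¹ • F) (by
      filter_upwards [Lp.coeFn_smul (n : ℝ)⁻¹ F, hF n, hf] with x h1 h2 h3
      rw [h1, Pi.smul_apply, h2, smul_eq_mul]
      refine ⟨mul_nonneg (by positivity) (le_min h3 hn'.le), ?_⟩
      rw [inv_mul_le_iff₀ hn', mul_one]
      exact min_le_right _ _)
    rw [map_smul] at h1
    filter_upwards [h1, Lp.coeFn_smul (n : ℝ)⁻¹ (S F), Lp.coeFn_zero ℝ 2 μ] with x h2 h3 h4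
    rw [h4, Pi.zero_apply]
    rw [h3, Pi.smul_apply, smul_eq_mul] at h2
    exact nonneg_of_mul_nonneg_right h2.1 (by positivity))
  filter_upwards [h0, Lp.coeFn_zero ℝ 2 μ] with x h1 h2
  rwa [h2, Pi.zero_apply] at h1

lemma mono {f g : L2 μ} (h : ∀ᵐ x ∂μ, f x ≤ g x) : ∀ᵐ x ∂μ, S f x ≤ S g x := by
  have h1 := hS.nonneg (f := g - f) (by
    filter_upwards [h, Lp.coeFn_sub g f] with x h1 h2
    rw [h2, Pi.sub_apply]; linarith)
  rw [map_sub] at h1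
  filter_upwards [h1, Lp.coeFn_sub (S g) (S f)] with x h2 h3
  rw [h3, Pi.sub_apply] at h2; linarith

/-- A symmetric sub-Markovian operator preserves nonnegative constant upper bounds. -/
lemma le_const {f : L2 μ} {c : ℝ} (hc : 0 ≤ c) (hf : ∀ᵐ x ∂μ, f x ≤ c) :
    ∀ᵐ x ∂μ, S f x ≤ c := by
  have hm : AEStronglyMeasurable (fun x => max (f x) 0) μ :=
    (aestronglyMeasurable_coe f).sup aestronglyMeasurable_const
  have hp := toL2_ae_of_le (f := f) (c := 1) hm (Eventually.of_forall fun x => by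
    rw [one_mul, abs_of_nonneg (le_max_right _ _)]
    exact max_le (le_abs_self _) (abs_nonneg _))
  set p := toL2 μ fun x => max (f x) 0
  have hfp := hS.mono (f := f) (g := p) (by
    filter_upwards [hp] with x h1
    rw [h1]; exact le_max_left _ _)
  rcases hc.eq_or_lt with rfl | hc
  · have h0 : p = 0 := by
      refine Lp.ext ?_
      filter_upwards [hp, hf, Lp.coeFn_zero ℝ 2 μ] with x h1 h2 h3
      rw [h1, h3, max_eq_right h2]; rfl
    rw [h0, map_zero] at hfp
    filter_upwards [hfp, Lp.coeFn_zero ℝ 2 μ] with x h1 h2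
    rwa [h2] at h1
  · have h1 := hS.markov (c⁻¹ • p) (by
      filter_upwards [Lp.coeFn_smul c⁻¹ p, hp, hf] with x h1 h2 h3
      rw [h1, Pi.smul_apply, h2, smul_eq_mul]
      refine ⟨mul_nonneg (by positivity) (le_max_right _ _), ?_⟩
      rw [inv_mul_le_iff₀ hc, mul_one]
      exact max_le h3 hc.le)
    rw [map_smul] at h1
    filter_upwards [h1, Lp.coeFn_smul c⁻¹ (S p), hfp] with x h2 h3 h4
    rw [h3, Pi.smul_apply, smul_eq_mul, inv_mul_le_iff₀ hc, mul_one] at h2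
    exact h4.trans h2.2

/-- The pointwise comparison behind the contraction property: the conditional variance
`f² - 2 f S f + S (f²)` decreases under normal contractions `g = F ∘ f`. -/
lemma sq_sub_le {F : ℝ → ℝ} (h0 : F 0 = 0) (hF : ∀ a b, |F a - F b| ≤ |a - b|)
    {f f₂ g g₂ : L2 μ} (hf₂ : ∀ᵐ x ∂μ, f₂ x = f x ^ 2) (hg : ∀ᵐ x ∂μ, g x = F (f x))
    (hg₂ : ∀ᵐ x ∂μ, g₂ x = F (f x) ^ 2) :
    ∀ᵐ x ∂μ, g₂ x - 2 * g x * S g x + S g₂ x ≤ f₂ x - 2 * f x * S f x + S f₂ x := by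
  have hFc : Continuous F := by
    refine LipschitzWith.continuous (K := 1) (LipschitzWith.of_dist_le_mul fun a b => ?_)
    simpa [Real.dist_eq] using hF a b
  -- For a fixed constant `c` the operator is applied to `(g - F c)² - (f - c)² ≤ 0`.
  have hc : ∀ c : ℚ, ∀ᵐ x ∂μ, 0 ≤ S f₂ x - 2 * c * S f x - S g₂ x + 2 * F c * S g x +
      ((c : ℝ) ^ 2 - F c ^ 2) := fun c => by
    have h1 : 0 ≤ (c : ℝ) ^ 2 - F c ^ 2 := by
      have := hF c 0
      rw [h0, sub_zero, sub_zero] at this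
      have := pow_le_pow_left₀ (abs_nonneg _) this 2
      rw [sq_abs, sq_abs] at this
      linarith
    have h2 := hS.le_const (f := g₂ - f₂ + (2 * (c : ℝ)) • f - (2 * F c) • g) h1 (by
      filter_upwards [Lp.coeFn_sub (g₂ - f₂ + (2 * (c : ℝ)) • f) ((2 * F c) • g),
        Lp.coeFn_add (g₂ - f₂) ((2 * (c : ℝ)) • f), Lp.coeFn_sub g₂ f₂,
        Lp.coeFn_smul (2 * (c : ℝ)) f, Lp.coeFn_smul (2 * F c) g, hf₂, hg, hg₂]
        with x e1 e2 e3 e4 e5 e6 e7 e8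
      rw [e1, Pi.sub_apply, e2, Pi.add_apply, e3, Pi.sub_apply, e4, e5, Pi.smul_apply,
        Pi.smul_apply, e6, e8, e7, smul_eq_mul, smul_eq_mul]
      have := pow_le_pow_left₀ (abs_nonneg _) (hF (f x) c) 2
      rw [sq_abs, sq_abs] at this
      linarith)
    simp only [map_add, map_sub, map_smul] at h2
    filter_upwards [h2, Lp.coeFn_sub (S g₂ - S f₂ + (2 * (c : ℝ)) • S f) ((2 * F c) • S g),
        Lp.coeFn_add (S g₂ - S f₂) ((2 * (c : ℝ)) • S f), Lp.coeFn_sub (S g₂) (S f₂),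
        Lp.coeFn_smul (2 * (c : ℝ)) (S f), Lp.coeFn_smul (2 * F c) (S g)] with x e0 e1 e2 e3 e4 e5
    rw [e1, Pi.sub_apply, e2, Pi.add_apply, e3, Pi.sub_apply, e4, e5, Pi.smul_apply,
      Pi.smul_apply, smul_eq_mul, smul_eq_mul] at e0
    linarith
  filter_upwards [ae_all_iff.2 hc, hf₂, hg, hg₂] with x h1 h2 h3 h4
  have h5 : ∀ c : ℝ, 0 ≤ S f₂ x - 2 * c * S f x - S g₂ x + 2 * F c * S g x +
      (c ^ 2 - F c ^ 2) := by
    have hcl : IsClosed {c : ℝ | 0 ≤ S f₂ x - 2 * c * S f x - S g₂ x + 2 * F c * S g x +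
      (c ^ 2 - F c ^ 2)} := isClosed_le continuous_const (by fun_prop)
    have hsub : range ((↑) : ℚ → ℝ) ⊆ {c : ℝ | 0 ≤ S f₂ x - 2 * c * S f x - S g₂ x +
      2 * F c * S g x + (c ^ 2 - F c ^ 2)} := by
      rintro _ ⟨c, rfl⟩; exact h1 c
    intro c
    exact hcl.closure_subset_iff.2 hsub (Rat.denseRange_cast c)
  have h6 := h5 (f x)
  rw [h2, h3, h4]
  linarith

lemma sq_nonneg' {f f₂ : L2 μ} (hf₂ : ∀ᵐ x ∂μ, f₂ x = f x ^ 2) :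
    ∀ᵐ x ∂μ, 0 ≤ f₂ x - 2 * f x * S f x + S f₂ x := by
  have h := hS.sq_sub_le (F := fun _ => 0) rfl (fun a b => by simp) (g := 0) (g₂ := 0) hf₂
    (Lp.coeFn_zero ℝ 2 μ) (by simpa [Filter.EventuallyEq] using Lp.coeFn_zero ℝ 2 μ)
  rw [map_zero] at h
  filter_upwards [h, Lp.coeFn_zero ℝ 2 μ] with x h1 h2
  simp only [h2, Pi.zero_apply] at h1
  linarith

lemma setIntegral_variance {f f₂ : L2 μ} (hf₂ : ∀ᵐ x ∂μ, f₂ x = f x ^ 2) {A : Set X}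
    (hAm : MeasurableSet A) (hA : μ A ≠ ∞) :
    ∫ x in A, (f₂ x - 2 * f x * S f x + S f₂ x) ∂μ =
      ∫ x in A, (f₂ x - 2 * (f x * S f x)) ∂μ +
        inner ℝ (S (indicatorConstLp 2 hAm hA (1 : ℝ))) f₂ := by
  rw [hS.symm, L2.inner_indicatorConstLp_one, ← integral_add]
  · refine integral_congr_ae (Eventually.of_forall fun x => ?_)
    simp only []; ring
  · exact ((integrable_sq hf₂).sub ((integrable_mul_coe f (S f)).const_mul 2)).integrableOn
  · exact integrableOn_Lp_of_measure_ne_top _ (by norm_num) hA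

lemma indicator_le_one {A : Set X} (hAm : MeasurableSet A) (hA : μ A ≠ ∞) :
    ∀ᵐ x ∂μ, S (indicatorConstLp 2 hAm hA (1 : ℝ)) x ≤ 1 := by
  refine hS.le_const zero_le_one ?_
  filter_upwards [indicatorConstLp_coeFn (p := 2) (hs := hAm) (hμs := hA) (c := (1 : ℝ))] with x hx
  rw [hx]
  exact indicator_le_self' (fun _ _ => zero_le_one) x

lemma inner_indicator_le {A : Set X} (hAm : MeasurableSet A) (hA : μ A ≠ ∞) {h : L2 μ}
    (hi : Integrable h μ) (h0 : ∀ᵐ x ∂μ, 0 ≤ h x) :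
    inner ℝ (S (indicatorConstLp 2 hAm hA (1 : ℝ))) h ≤ ∫ x, h x ∂μ := by
  rw [inner_eq_integral]
  refine integral_mono_ae (integrable_mul_coe _ _) hi ?_
  filter_upwards [h0, hS.indicator_le_one hAm hA] with x h1 h2
  exact mul_le_of_le_one_left h1 h2

lemma truncated_nonneg {f f₂ χ p : L2 μ} (hf₂ : ∀ᵐ x ∂μ, f₂ x = f x ^ 2)
    (hp : ∀ᵐ x ∂μ, p x = χ x * f x) (hχ : ∀ᵐ x ∂μ, 0 ≤ χ x) :
    0 ≤ inner ℝ p (f - S f) - inner ℝ χ (f₂ - S f₂) / 2 := by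
  rw [(truncated_eq (S := S) hf₂ hp).2]
  refine div_nonneg (integral_nonneg_of_ae ?_) zero_le_two
  filter_upwards [hχ, hS.sq_nonneg' hf₂] with x h1 h2
  exact mul_nonneg h1 h2

variable [SigmaFinite μ]

/-- The Beurling-Deny contraction property of the bounded form `(f, f - S f)`. -/
theorem inner_sub_le_of_contraction {F : ℝ → ℝ} (h0 : F 0 = 0) (hF : ∀ a b, |F a - F b| ≤ |a - b|)
    {f f₂ g g₂ : L2 μ} (hf₂ : ∀ᵐ x ∂μ, f₂ x = f x ^ 2) (hg : ∀ᵐ x ∂μ, g x = F (f x))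
    (hg₂ : ∀ᵐ x ∂μ, g₂ x = F (f x) ^ 2) :
    inner ℝ g (g - S g) ≤ inner ℝ f (f - S f) := by
  have hg₂' : ∀ᵐ x ∂μ, g₂ x = g x ^ 2 := by
    filter_upwards [hg, hg₂] with x h1 h2; rw [h1, h2]
  have hle := le_of_tendsto_of_tendsto' (tendsto_setIntegral_variance (S := S) hg₂')
    (tendsto_setIntegral_variance (S := S) hf₂) fun n => by
      have hAm := measurableSet_spanningSets μ n
      have hA := (measure_spanningSets_lt_top μ n).ne
      have h1 := setIntegral_mono_ae (integrableOn_variance (S := S) hg₂' hA)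
        (integrableOn_variance (S := S) hf₂ hA) (hS.sq_sub_le h0 hF hf₂ hg hg₂)
      rw [hS.setIntegral_variance hg₂' hAm hA, hS.setIntegral_variance hf₂ hAm hA] at h1
      have hfi := integrable_sq hf₂
      have hgi := integrable_sq hg₂'
      have hsub := Lp.coeFn_sub f₂ g₂
      have h2 := hS.inner_indicator_le hAm hA (h := f₂ - g₂)
        ((hfi.sub hgi).congr (by filter_upwards [hsub] with x h; rw [h])) (by
          filter_upwards [hsub, hf₂, hg₂] with x e1 e2 e3
          rw [e1, Pi.sub_apply, e2, e3]
          have := hF (f x) 0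
          rw [h0, sub_zero, sub_zero] at this
          have := pow_le_pow_left₀ (abs_nonneg _) this 2
          rw [sq_abs, sq_abs] at this
          linarith)
      rw [integral_congr_ae hsub, inner_sub_right] at h2
      have h3 : ∫ x, (⇑f₂ - ⇑g₂) x ∂μ = ∫ x, f₂ x ∂μ - ∫ x, g₂ x ∂μ := integral_sub hfi hgi
      linarith
  linarith

/-- The truncated form is at most a multiple of the form: this uses only `S 1_A ≤ 1`, as `S 1` need
not exist in `L₂(X)`. -/
lemma truncated_le {f f₂ χ p : L2 μ} (hf₂ : ∀ᵐ x ∂μ, f₂ x = f x ^ 2)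
    (hp : ∀ᵐ x ∂μ, p x = χ x * f x) {M : ℝ} (hM : 0 ≤ M) (hχM : ∀ᵐ x ∂μ, χ x ≤ M) :
    inner ℝ p (f - S f) - inner ℝ χ (f₂ - S f₂) / 2 ≤ M * inner ℝ f (f - S f) := by
  obtain ⟨hi, heq⟩ := truncated_eq (S := S) hf₂ hp
  rw [heq]
  have hlim := tendsto_setIntegral_of_monotone (μ := μ) (fun n => measurableSet_spanningSets μ n)
    (monotone_spanningSets μ) hi.integrableOn
  rw [iUnion_spanningSets, setIntegral_univ] at hlim
  have := le_of_tendsto_of_tendsto' hlim ((tendsto_setIntegral_variance (S := S) hf₂).const_mul M)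
    fun n => by
      have hAm := measurableSet_spanningSets μ n
      have hA := (measure_spanningSets_lt_top μ n).ne
      have h1 : ∫ x in spanningSets μ n, χ x * (f₂ x - 2 * f x * S f x + S f₂ x) ∂μ ≤
          ∫ x in spanningSets μ n, M * (f₂ x - 2 * f x * S f x + S f₂ x) ∂μ := by
        refine setIntegral_mono_ae hi.integrableOn
          ((integrableOn_variance (S := S) hf₂ hA).const_mul M) ?_
        filter_upwards [hχM, hS.sq_nonneg' hf₂] with x h1 h2
        exact mul_le_mul_of_nonneg_right h1 h2
      rw [integral_const_mul, hS.setIntegral_variance hf₂ hAm hA] at h1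
      have h2 := hS.inner_indicator_le hAm hA (integrable_sq hf₂) (by
        filter_upwards [hf₂] with x h; rw [h]; positivity)
      exact h1.trans (mul_le_mul_of_nonneg_left (by linarith) hM)
  linarith

end IsSubMarkov

lemma QForm.IsQuad.sqrt_toReal_add_le {K : Type*} [NormedAddCommGroup K] [InnerProductSpace ℝ K]
    {q : K → ℝ≥0∞} (hq : QForm.IsQuad q) {u v : K} (hu : q u ≠ ∞) (hv : q v ≠ ∞) :
    √(q (u + v)).toReal ≤ √(q u).toReal + √(q v).toReal := by
  rw [Real.sqrt_le_left (by positivity), hq.toReal_add hu hv, add_sq,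
    Real.sq_sqrt ENNReal.toReal_nonneg, Real.sq_sqrt ENNReal.toReal_nonneg]
  have h := Real.le_sqrt_of_sq_le (hq.polar_sq_le hu hv)
  rw [Real.sqrt_mul ENNReal.toReal_nonneg] at h
  linarith

lemma QForm.IsQuad.abs_sqrt_sub_sqrt_le {K : Type*} [NormedAddCommGroup K]
    [InnerProductSpace ℝ K] {q : K → ℝ≥0∞} (hq : QForm.IsQuad q) {u v : K} (hu : q u ≠ ∞)
    (hv : q v ≠ ∞) : |√(q u).toReal - √(q v).toReal| ≤ √(q (u - v)).toReal := by
  have h1 := hq.sqrt_toReal_add_le (hq.sub_ne_top hu hv) hv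
  have h2 := hq.sqrt_toReal_add_le (hq.sub_ne_top hv hu) hu
  rw [sub_add_cancel] at h1 h2
  rw [hq.map_sub_comm v u] at h2
  rw [abs_le]
  constructor <;> linarith

namespace DirichletForm

variable {X : Type*} [MeasurableSpace X] {μ : Measure X} {E : DirichletForm μ}

/-! ### Contractions of elements of the domain -/

lemma clip_mem_and_val_le {φ ψ : L2 μ} (hφ : φ ∈ E.domain) {a : ℝ} (ha : 0 < a)
    (hψ : ∀ᵐ x ∂μ, ψ x = max 0 (min (φ x) a)) : ψ ∈ E.domain ∧ E.val ψ ψ ≤ E.val φ φ := by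
  have hφa := E.domain.smul_mem a⁻¹ hφ
  obtain ⟨h, hle⟩ := E.markov ⟨a⁻¹ • φ, hφa⟩ (a⁻¹ • ψ) (by
    filter_upwards [hψ, Lp.coeFn_smul a⁻¹ φ, Lp.coeFn_smul a⁻¹ ψ] with x e1 e2 e3
    simp only [e2, e3, Pi.smul_apply, smul_eq_mul, e1]
    have h0 : 0 ≤ a⁻¹ := by positivity
    rw [mul_max_of_nonneg _ _ h0, mul_min_of_nonneg _ _ h0, mul_zero, inv_mul_cancel₀ ha.ne'])
  rw [← val_eq h h, ← val_eq hφa hφa, val_smul_smul _ hφ] at hle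
  have hψD : ψ ∈ E.domain := (E.domain.smul_mem_iff (inv_ne_zero ha.ne')).1 h
  rw [val_smul_smul _ hψD] at hle
  exact ⟨hψD, le_of_mul_le_mul_left hle (by positivity)⟩

lemma exists_clip (φ : L2 μ) (a : ℝ) :
    ∃ ψ : L2 μ, ∀ᵐ x ∂μ, ψ x = max 0 (min (φ x) a) := by
  refine ⟨toL2 μ fun x => max 0 (min (φ x) a), toL2_ae_of_le (f := φ) (c := 1)
    (aestronglyMeasurable_const.sup ((aestronglyMeasurable_coe φ).inf
      aestronglyMeasurable_const)) (Eventually.of_forall fun x => ?_)⟩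
  rw [one_mul, abs_of_nonneg (le_max_left _ _)]
  exact max_le (abs_nonneg _) ((min_le_left _ _).trans (le_abs_self _))

/-- The operators `l (l I + H)⁻¹` of a Dirichlet form are sub-Markovian. -/
theorem isSubMarkov_resolvent (E : DirichletForm μ) {l : ℝ} (hl : 0 < l) :
    IsSubMarkov (l • QForm.formResolvent E.quad l) where
  symm f g := by
    simp only [FunLike.coe_smul, Pi.smul_apply, inner_smul_left, inner_smul_right]
    rw [E.isClosedForm_quad.resolvent_symm hl]
    rfl
  markov f hf := by
    have hq := E.isClosedForm_quad
    set u := (l • QForm.formResolvent E.quad l) f with hu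
    have huR : u = QForm.formResolvent E.quad l (l • f) := by
      rw [hu, map_smul]; rfl
    have hut : E.quad u ≠ ∞ := huR ▸ hq.resolvent_ne_top hl _
    have huD := quad_ne_top.1 hut
    obtain ⟨w, hw⟩ := exists_clip u 1
    obtain ⟨hwD, hwle⟩ := clip_mem_and_val_le huD one_pos hw
    have hdt : E.quad (w - u) ≠ ∞ := quad_ne_top.2 (E.domain.sub_mem hwD huD)
    -- The clipped function `w` is not further from `f` than the minimizer `u`.
    have hnorm : ‖w - f‖ ≤ ‖u - f‖ := by
      refine Lp.norm_le_norm_of_ae_le ?_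
      filter_upwards [hw, hf, Lp.coeFn_sub w f, Lp.coeFn_sub u f] with x e1 e2 e3 e4
      rw [e3, e4, Pi.sub_apply, Pi.sub_apply, e1, Real.norm_eq_abs, Real.norm_eq_abs]
      rcases le_total (u x) 0 with h0 | h0
      · rw [max_eq_left ((min_le_left _ _).trans h0), zero_sub, abs_neg, abs_of_nonneg e2.1,
          abs_of_nonpos (by linarith [e2.1])]
        linarith
      · rcases le_total (u x) 1 with h1 | h1
        · rw [min_eq_left h1, max_eq_right h0]
        · rw [min_eq_right h1, max_eq_right zero_le_one, abs_of_nonneg (by linarith [e2.2]),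
            abs_of_nonneg (by linarith [e2.2])]
          linarith
    have h1 := hq.polar_resolvent hl (l • f) hdt
    rw [← huR] at h1
    have h2 := hq.toReal_add hut hdt
    rw [add_sub_cancel, h1, quad_toReal hwD, quad_toReal huD] at h2
    have h3 := norm_add_sq_real (u - f) (w - u)
    rw [show u - f + (w - u) = w - f by abel] at h3
    have h4 := pow_le_pow_left₀ (norm_nonneg _) hnorm 2
    have h5 : 0 ≤ (E.quad (w - u)).toReal := ENNReal.toReal_nonneg
    have h6 : inner ℝ (l • f - l • u) (w - u) = -(l * inner ℝ (u - f) (w - u)) := by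
      rw [← smul_sub, ← neg_sub u f, smul_neg, inner_neg_left, inner_smul_left]; rfl
    rw [h6] at h2
    have h7 : ‖w - u‖ ^ 2 = 0 := by
      have : l * ‖w - u‖ ^ 2 ≤ 0 := by nlinarith
      nlinarith [sq_nonneg ‖w - u‖]
    have h8 : w = u := sub_eq_zero.1 (norm_eq_zero.1 (pow_eq_zero_iff two_ne_zero |>.1 h7))
    rw [h8] at hw
    filter_upwards [hw] with x hx
    rw [hx]
    exact ⟨le_max_left _ _, max_le zero_le_one (min_le_right _ _)⟩

lemma sq_ae_of_bound {f : L2 μ} {M : ℝ} (hM : ∀ᵐ x ∂μ, |f x| ≤ M) :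
    ∀ᵐ x ∂μ, toL2 μ (fun x => f x ^ 2) x = f x ^ 2 :=
  toL2_ae_of_le (f := f) (c := M) ((aestronglyMeasurable_coe f).pow 2) (by
    filter_upwards [hM] with x hx
    rw [abs_pow, sq]
    exact mul_le_mul_of_nonneg_right hx (abs_nonneg _))

lemma mul_ae_of_bound {χ f : L2 μ} {M : ℝ} (hM : ∀ᵐ x ∂μ, |χ x| ≤ M) :
    ∀ᵐ x ∂μ, toL2 μ (fun x => χ x * f x) x = χ x * f x :=
  toL2_ae_of_le (f := f) (c := M) ((aestronglyMeasurable_coe χ).mul (aestronglyMeasurable_coe f))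
    (by
      filter_upwards [hM] with x hx
      rw [abs_mul]
      exact mul_le_mul_of_nonneg_right hx (abs_nonneg _))

variable (E) in
/-- The subspace `D(E) ∩ L_∞(X)`. -/
def bddDomain : Submodule ℝ (L2 μ) where
  carrier := E.boundedDomain
  add_mem' := fun ha hb =>
    ⟨E.domain.add_mem ha.1 hb.1, (memLp_congr_ae (Lp.coeFn_add _ _)).2 (ha.2.add hb.2)⟩
  zero_mem' := ⟨E.domain.zero_mem, (memLp_congr_ae (Lp.coeFn_zero ℝ 2 μ)).2 MemLp.zero⟩
  smul_mem' := fun c _ ha =>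
    ⟨E.domain.smul_mem c ha.1, (memLp_congr_ae (Lp.coeFn_smul c _)).2 (ha.2.const_smul c)⟩

lemma mem_bddDomain {φ : L2 μ} :
    φ ∈ E.bddDomain ↔ φ ∈ E.domain ∧ ∃ M : ℝ, 0 < M ∧ ∀ᵐ x ∂μ, |φ x| ≤ M := by
  change φ ∈ E.domain ∧ MemLp φ ∞ μ ↔ _
  rw [memLp_top_iff (aestronglyMeasurable_coe φ)]
  refine and_congr_right fun _ => ⟨fun ⟨M, h1, h2⟩ => ⟨M + 1, by linarith, ?_⟩,
    fun ⟨M, h1, h2⟩ => ⟨M, h1.le, h2⟩⟩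
  filter_upwards [h2] with x hx
  linarith

lemma exists_common_bound {φ ψ : L2 μ} (hφ : φ ∈ E.bddDomain) (hψ : ψ ∈ E.bddDomain) :
    ∃ M : ℝ, 0 < M ∧ (∀ᵐ x ∂μ, |φ x| ≤ M) ∧ ∀ᵐ x ∂μ, |ψ x| ≤ M := by
  obtain ⟨-, M, hM, h1⟩ := mem_bddDomain.1 hφ
  obtain ⟨-, N, hN, h2⟩ := mem_bddDomain.1 hψ
  refine ⟨max M N, lt_max_of_lt_left hM, ?_, ?_⟩
  · filter_upwards [h1] with x hx using hx.trans (le_max_left _ _)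
  · filter_upwards [h2] with x hx using hx.trans (le_max_right _ _)

variable [SigmaFinite μ]

/-- Normal contractions operate on bounded elements of the domain. -/
theorem contraction_mem_and_val_le {F : ℝ → ℝ} (h0 : F 0 = 0)
    (hF : ∀ a b, |F a - F b| ≤ |a - b|) {f g : L2 μ} (hf : f ∈ E.domain) {M : ℝ}
    (hM : ∀ᵐ x ∂μ, |f x| ≤ M) (hg : ∀ᵐ x ∂μ, g x = F (f x)) :
    g ∈ E.domain ∧ E.val g g ≤ E.val f f := by
  have hgM : ∀ᵐ x ∂μ, |g x| ≤ M := by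
    filter_upwards [hM, hg] with x h1 h2
    have := hF (f x) 0
    rw [h0, sub_zero, sub_zero] at this
    rw [h2]; exact this.trans h1
  have hg₂ := sq_ae_of_bound hgM
  rw [← quad_le_ofReal (val_self_nonneg f)]
  refine E.isClosedForm_quad.le_of_approx_le fun n hn => ?_
  have hn' : (0 : ℝ) < n := Nat.cast_pos.2 hn
  have h1 := (E.isSubMarkov_resolvent hn').inner_sub_le_of_contraction h0 hF (sq_ae_of_bound hM)
    hg (by filter_upwards [hg₂, hg] with x e1 e2; rw [e1, e2])
  have h2 := E.isClosedForm_quad.approx_le hn' (quad_ne_top.2 hf)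
  rw [quad_toReal hf, real_inner_comm] at h2
  refine le_trans ?_ h2
  rw [real_inner_comm]
  exact mul_le_mul_of_nonneg_left h1 hn'.le

lemma sq_mem_and_val_le {f g : L2 μ} (hf : f ∈ E.domain) {M : ℝ} (hM0 : 0 < M)
    (hM : ∀ᵐ x ∂μ, |f x| ≤ M) (hg : ∀ᵐ x ∂μ, g x = f x ^ 2) :
    g ∈ E.domain ∧ E.val g g ≤ 4 * M ^ 2 * E.val f f := by
  set c : ℝ → ℝ := fun t => max (-M) (min t M) with hc
  have hcM : ∀ t, |c t| ≤ M := fun t =>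
    abs_le.2 ⟨le_max_left _ _, max_le (by linarith) (min_le_right _ _)⟩
  have hcl : ∀ a b, |c a - c b| ≤ |a - b| := fun a b => by
    refine (abs_max_sub_max_le_max _ _ _ _).trans ?_
    rw [sub_self, abs_zero, max_eq_right (abs_nonneg _)]
    refine (abs_min_sub_min_le_max _ _ _ _).trans ?_
    rw [sub_self, abs_zero, max_eq_left (abs_nonneg _)]
  have hc0 : c 0 = 0 := by simp [hc, hM0.le]
  obtain ⟨h1, h2⟩ := contraction_mem_and_val_le (E := E) (F := fun t => (2 * M)⁻¹ * c t ^ 2)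
    (g := (2 * M)⁻¹ • g) (by simp [hc0]) (fun a b => by
      have e1 : (2 * M)⁻¹ * c a ^ 2 - (2 * M)⁻¹ * c b ^ 2 =
        (2 * M)⁻¹ * ((c a + c b) * (c a - c b)) := by ring
      rw [e1, abs_mul, abs_mul, abs_of_pos (by positivity), inv_mul_le_iff₀ (by positivity)]
      refine mul_le_mul ?_ (hcl a b) (abs_nonneg _) (by positivity)
      refine (abs_add_le _ _).trans ?_
      linarith [hcM a, hcM b]) hf hM (by
      filter_upwards [Lp.coeFn_smul (2 * M)⁻¹ g, hg, hM] with x e1 e2 e3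
      have e4 : c (f x) = f x := by
        rw [abs_le] at e3
        simp [hc, e3.1, e3.2]
      rw [e1, Pi.smul_apply, smul_eq_mul, e2, e4])
  have hgD : g ∈ E.domain := (E.domain.smul_mem_iff (by positivity)).1 h1
  rw [val_smul_smul _ hgD] at h2
  refine ⟨hgD, ?_⟩
  have h3 : (2 * M)⁻¹ ^ 2 * E.val g g = E.val g g / (4 * M ^ 2) := by
    field_simp; ring
  rw [h3, div_le_iff₀ (by positivity)] at h2
  linarith

/-- The bounded elements of the domain form an algebra. -/
lemma mul_mem_and_val_le {f g p : L2 μ} (hf : f ∈ E.domain) (hg : g ∈ E.domain) {M : ℝ}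
    (hM0 : 0 < M) (hfM : ∀ᵐ x ∂μ, |f x| ≤ M) (hgM : ∀ᵐ x ∂μ, |g x| ≤ M)
    (hp : ∀ᵐ x ∂μ, p x = f x * g x) :
    p ∈ E.domain ∧ E.val p p ≤ 4 * M ^ 2 * (E.val f f + E.val g g) := by
  have ha := E.domain.add_mem hf hg
  have hs := E.domain.sub_mem hf hg
  have haM : ∀ᵐ x ∂μ, |(f + g) x| ≤ 2 * M := by
    filter_upwards [hfM, hgM, Lp.coeFn_add f g] with x e1 e2 e3
    rw [e3, Pi.add_apply]; refine (abs_add_le _ _).trans ?_; linarith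
  have hsM : ∀ᵐ x ∂μ, |(f - g) x| ≤ 2 * M := by
    filter_upwards [hfM, hgM, Lp.coeFn_sub f g] with x e1 e2 e3
    rw [e3, Pi.sub_apply]; refine (abs_sub _ _).trans ?_; linarith
  have hA := sq_ae_of_bound haM
  have hB := sq_ae_of_bound hsM
  set A := toL2 μ fun x => (f + g) x ^ 2
  set B := toL2 μ fun x => (f - g) x ^ 2
  obtain ⟨hAD, hAv⟩ := sq_mem_and_val_le ha (by positivity) haM hA
  obtain ⟨hBD, hBv⟩ := sq_mem_and_val_le hs (by positivity) hsM hB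
  have hpAB : p = (1 / 4 : ℝ) • (A - B) := by
    refine Lp.ext ?_
    filter_upwards [hp, hA, hB, Lp.coeFn_sub A B, Lp.coeFn_smul (1 / 4 : ℝ) (A - B),
      Lp.coeFn_add f g, Lp.coeFn_sub f g] with x e1 e2 e3 e4 e5 e6 e7
    rw [e5, Pi.smul_apply, e4, Pi.sub_apply, e2, e3, e1, e6, e7, Pi.add_apply, Pi.sub_apply,
      smul_eq_mul]
    ring
  rw [hpAB]
  have hABD := E.domain.sub_mem hAD hBD
  refine ⟨E.domain.smul_mem _ hABD, ?_⟩
  rw [val_smul_smul _ hABD]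
  have h1 := val_parallelogram hAD hBD
  have h2 := val_self_nonneg (E := E) (A + B)
  have h3 := val_parallelogram hf hg
  nlinarith [sq_nonneg M]

/-! ### Truncated forms on bounded elements -/

lemma toL2_mul_spec {φ ψ : L2 μ} (hφ : φ ∈ E.bddDomain) (hψ : ψ ∈ E.bddDomain) :
    toL2 μ (fun x => φ x * ψ x) ∈ E.bddDomain ∧
      ∀ᵐ x ∂μ, toL2 μ (fun x => φ x * ψ x) x = φ x * ψ x := by
  obtain ⟨M, hM, h1, h2⟩ := exists_common_bound hφ hψ
  have h3 := mul_ae_of_bound (f := ψ) h1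
  refine ⟨mem_bddDomain.2 ⟨(mul_mem_and_val_le (mem_bddDomain.1 hφ).1 (mem_bddDomain.1 hψ).1 hM
    h1 h2 h3).1, M * M, by positivity, ?_⟩, h3⟩
  filter_upwards [h1, h2, h3] with x e1 e2 e3
  rw [e3, abs_mul]
  exact mul_le_mul e1 e2 (abs_nonneg _) hM.le

lemma toL2_sq_spec {φ : L2 μ} (hφ : φ ∈ E.bddDomain) :
    toL2 μ (fun x => φ x ^ 2) ∈ E.bddDomain ∧
      ∀ᵐ x ∂μ, toL2 μ (fun x => φ x ^ 2) x = φ x ^ 2 := by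
  simpa only [sq] using toL2_mul_spec hφ hφ

/-- The truncated form is the limit of the truncations of the approximating forms. -/
lemma tendsto_truncBdd {χ φ : L2 μ} (hχ : χ ∈ E.bddDomain) (hφ : φ ∈ E.bddDomain) :
    Tendsto (fun n : ℕ => (n : ℝ) *
      (inner ℝ (toL2 μ fun x => χ x * φ x) (φ - ((n : ℝ) • QForm.formResolvent E.quad n) φ) -
      inner ℝ χ ((toL2 μ fun x => φ x ^ 2) - ((n : ℝ) • QForm.formResolvent E.quad n)
        (toL2 μ fun x => φ x ^ 2)) / 2)) atTop (𝓝 (E.truncBdd χ φ)) := by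
  have hq := E.isClosedForm_quad
  have h1 := (toL2_mul_spec hχ hφ).1.1
  have h2 := (toL2_sq_spec hφ).1.1
  have h3 := hq.tendsto_approx_polar (quad_ne_top.2 hφ.1) (quad_ne_top.2 h1)
  have h4 := hq.tendsto_approx_polar (quad_ne_top.2 h2) (quad_ne_top.2 hχ.1)
  have h5 := h3.sub (h4.div_const 2)
  rw [quad, polar_quadOn le_rfl hφ.1 h1, polar_quadOn le_rfl h2 hχ.1, val_comm φ,
    val_comm _ χ] at h5
  refine h5.congr fun n => ?_
  rw [real_inner_comm, real_inner_comm χ]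
  simp only [FunLike.coe_smul, Pi.smul_apply, quad]
  ring

lemma truncBdd_nonneg {χ φ : L2 μ} (hχ : χ ∈ E.bddDomain) (hφ : φ ∈ E.bddDomain)
    (hχ0 : ∀ᵐ x ∂μ, 0 ≤ χ x) : 0 ≤ E.truncBdd χ φ := by
  refine ge_of_tendsto (tendsto_truncBdd hχ hφ) ?_
  filter_upwards [eventually_gt_atTop 0] with n hn
  have hn' : (0 : ℝ) < n := Nat.cast_pos.2 hn
  exact mul_nonneg hn'.le ((E.isSubMarkov_resolvent hn').truncated_nonneg (toL2_sq_spec hφ).2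
    (toL2_mul_spec hχ hφ).2 hχ0)

lemma truncBdd_le {χ φ : L2 μ} (hχ : χ ∈ E.bddDomain) (hφ : φ ∈ E.bddDomain) {M : ℝ}
    (hM : 0 ≤ M) (hχM : ∀ᵐ x ∂μ, χ x ≤ M) : E.truncBdd χ φ ≤ M * E.val φ φ := by
  have hlim := (E.isClosedForm_quad.tendsto_approx (quad_ne_top.2 hφ.1)).const_mul M
  rw [quad_toReal hφ.1] at hlim
  refine le_of_tendsto_of_tendsto (tendsto_truncBdd hχ hφ) hlim ?_
  filter_upwards [eventually_gt_atTop 0] with n hn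
  have hn' : (0 : ℝ) < n := Nat.cast_pos.2 hn
  have h := (E.isSubMarkov_resolvent hn').truncated_le (toL2_sq_spec hφ).2
    (toL2_mul_spec hχ hφ).2 hM hχM
  rw [mul_left_comm, real_inner_comm φ]
  exact mul_le_mul_of_nonneg_left h hn'.le

lemma truncBdd_sub_left {χ χ' φ : L2 μ} (hχ : χ ∈ E.bddDomain) (hχ' : χ' ∈ E.bddDomain)
    (hφ : φ ∈ E.bddDomain) :
    E.truncBdd (χ - χ') φ = E.truncBdd χ φ - E.truncBdd χ' φ := by
  have h1 := toL2_mul_spec hχ hφ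
  have h2 := toL2_mul_spec hχ' hφ
  have h3 := (toL2_mul_spec (E.bddDomain.sub_mem hχ hχ') hφ).2
  have h4 : toL2 μ (fun x => (χ - χ') x * φ x) =
      toL2 μ (fun x => χ x * φ x) - toL2 μ (fun x => χ' x * φ x) := by
    refine Lp.ext ?_
    filter_upwards [h1.2, h2.2, h3, Lp.coeFn_sub χ χ',
      Lp.coeFn_sub (toL2 μ fun x => χ x * φ x) (toL2 μ fun x => χ' x * φ x)] with x e1 e2 e3 e4 e5
    rw [e5, e3, Pi.sub_apply, e1, e2, e4, Pi.sub_apply]; ring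
  rw [truncBdd, truncBdd, truncBdd, h4, val_sub_left h1.1.1 h2.1.1 hφ.1,
    val_sub_left hχ.1 hχ'.1 (toL2_sq_spec hφ).1.1]
  ring

lemma truncBdd_mono {χ χ' φ : L2 μ} (hχ : χ ∈ E.bddDomain) (hχ' : χ' ∈ E.bddDomain)
    (hφ : φ ∈ E.bddDomain) (h : ∀ᵐ x ∂μ, χ x ≤ χ' x) : E.truncBdd χ φ ≤ E.truncBdd χ' φ := by
  have h1 := truncBdd_nonneg (E.bddDomain.sub_mem hχ' hχ) hφ (by
    filter_upwards [h, Lp.coeFn_sub χ' χ] with x e1 e2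
    rw [e2, Pi.sub_apply]; linarith)
  rw [truncBdd_sub_left hχ' hχ hφ] at h1
  linarith

lemma truncBdd_smul {χ φ : L2 μ} (hχ : χ ∈ E.bddDomain) (hφ : φ ∈ E.bddDomain) (c : ℝ) :
    E.truncBdd χ (c • φ) = c ^ 2 * E.truncBdd χ φ := by
  have hc := E.bddDomain.smul_mem c hφ
  have h1 := toL2_mul_spec hχ hφ
  have h2 := toL2_sq_spec hφ
  have h3 : toL2 μ (fun x => χ x * (c • φ) x) = c • toL2 μ fun x => χ x * φ x := by
    refine Lp.ext ?_
    filter_upwards [h1.2, (toL2_mul_spec hχ hc).2, Lp.coeFn_smul c φ,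
      Lp.coeFn_smul c (toL2 μ fun x => χ x * φ x)] with x e1 e2 e3 e4
    rw [e4, e2, e3, Pi.smul_apply, Pi.smul_apply, e1, smul_eq_mul, smul_eq_mul]; ring
  have h4 : toL2 μ (fun x => (c • φ) x ^ 2) = c ^ 2 • toL2 μ fun x => φ x ^ 2 := by
    refine Lp.ext ?_
    filter_upwards [h2.2, (toL2_sq_spec hc).2, Lp.coeFn_smul c φ,
      Lp.coeFn_smul (c ^ 2) (toL2 μ fun x => φ x ^ 2)] with x e1 e2 e3 e4
    rw [e4, e2, e3, Pi.smul_apply, Pi.smul_apply, e1, smul_eq_mul, smul_eq_mul]; ring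
  rw [truncBdd, truncBdd, h3, h4, val_smul_left c h1.1.1 hc.1, val_smul_right c h1.1.1 hφ.1,
    val_smul_right _ hχ.1 h2.1.1]
  ring

lemma truncBdd_parallelogram {χ φ ψ : L2 μ} (hχ : χ ∈ E.bddDomain) (hφ : φ ∈ E.bddDomain)
    (hψ : ψ ∈ E.bddDomain) :
    E.truncBdd χ (φ + ψ) + E.truncBdd χ (φ - ψ) = 2 * E.truncBdd χ φ + 2 * E.truncBdd χ ψ := by
  have ha := E.bddDomain.add_mem hφ hψ
  have hs := E.bddDomain.sub_mem hφ hψ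
  have p1 := toL2_mul_spec hχ hφ
  have p2 := toL2_mul_spec hχ hψ
  have s1 := toL2_sq_spec hφ
  have s2 := toL2_sq_spec hψ
  have pa := toL2_mul_spec hχ ha
  have ps := toL2_mul_spec hχ hs
  have sa := toL2_sq_spec ha
  have ss := toL2_sq_spec hs
  have ea := Lp.coeFn_add φ ψ
  have es := Lp.coeFn_sub φ ψ
  rw [truncBdd, truncBdd, truncBdd, truncBdd]
  generalize toL2 μ (fun x => χ x * φ x) = P1 at *
  generalize toL2 μ (fun x => χ x * ψ x) = P2 at *
  generalize toL2 μ (fun x => φ x ^ 2) = S1 at *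
  generalize toL2 μ (fun x => ψ x ^ 2) = S2 at *
  generalize toL2 μ (fun x => χ x * (φ + ψ) x) = PA at *
  generalize toL2 μ (fun x => χ x * (φ - ψ) x) = PS at *
  generalize toL2 μ (fun x => (φ + ψ) x ^ 2) = SA at *
  generalize toL2 μ (fun x => (φ - ψ) x ^ 2) = SS at *
  have h1 : PA = P1 + P2 := by
    refine Lp.ext ?_
    filter_upwards [p1.2, p2.2, pa.2, ea, Lp.coeFn_add P1 P2] with x e1 e2 e3 e4 e5
    rw [e5, e3, Pi.add_apply, e1, e2, e4, Pi.add_apply]; ring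
  have h2 : PS = P1 - P2 := by
    refine Lp.ext ?_
    filter_upwards [p1.2, p2.2, ps.2, es, Lp.coeFn_sub P1 P2] with x e1 e2 e3 e4 e5
    rw [e5, e3, Pi.sub_apply, e1, e2, e4, Pi.sub_apply]; ring
  have h3 : SS = (2 : ℝ) • (S1 + S2) - SA := by
    refine Lp.ext ?_
    filter_upwards [s1.2, s2.2, sa.2, ss.2, ea, es, Lp.coeFn_add S1 S2,
      Lp.coeFn_smul (2 : ℝ) (S1 + S2), Lp.coeFn_sub ((2 : ℝ) • (S1 + S2)) SA]
      with x e1 e2 e3 e4 e5 e6 e7 e8 e9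
    rw [e9, Pi.sub_apply, e8, Pi.smul_apply, e7, Pi.add_apply, e1, e2, e3, e4, e5, e6,
      Pi.add_apply, Pi.sub_apply, smul_eq_mul]
    ring
  have hS := E.domain.add_mem s1.1.1 s2.1.1
  rw [h1, h2, h3, val_sub_right hχ.1 (E.domain.smul_mem 2 hS) sa.1.1, val_smul_right 2 hχ.1 hS,
    val_add_right hχ.1 s1.1.1 s2.1.1, val_add_left p1.1.1 p2.1.1 ha.1,
    val_sub_left p1.1.1 p2.1.1 hs.1, val_add_right p1.1.1 hφ.1 hψ.1, val_add_right p2.1.1 hφ.1 hψ.1,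
    val_sub_right p1.1.1 hφ.1 hψ.1, val_sub_right p2.1.1 hφ.1 hψ.1]
  ring

end DirichletForm

namespace DirichletForm

variable {X : Type*} [MeasurableSpace X] {μ : Measure X} {E : DirichletForm μ}

/-! ### Approximation by bounded elements -/

lemma eventually_clip_eq {F : ℕ → X → ℝ} {f : X → ℝ}
    (h : ∀ n : ℕ, ∀ᵐ x ∂μ, F n x = max 0 (min (f x) ((n : ℝ) + 1))) :
    ∀ᵐ x ∂μ, Tendsto (fun n => F n x) atTop (𝓝 (max (f x) 0)) := by
  filter_upwards [ae_all_iff.2 h] with x hx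
  simp only [hx]
  refine tendsto_const_nhds.congr' ?_
  filter_upwards [eventually_ge_atTop ⌈f x⌉₊] with n hn
  have h1 : f x ≤ n := (Nat.le_ceil _).trans (Nat.cast_le.2 hn)
  rw [min_eq_left (by linarith), max_comm]

/-- Positive parts of elements of the domain are limits, in the graph norm, of truncations. -/
lemma exists_bdd_seq_posPart {φ : L2 μ} (hφ : φ ∈ E.domain) :
    ∃ (p : L2 μ) (x : ℕ → L2 μ), p ∈ E.domain ∧ (∀ᵐ y ∂μ, p y = max (φ y) 0) ∧
      (∀ n, x n ∈ E.bddDomain) ∧ Tendsto (fun n => E.normSq (x n - p)) atTop (𝓝 0) ∧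
      ∀ n, ∀ᵐ y ∂μ, φ y = 0 → x n y = 0 := by
  choose x hx using fun n : ℕ => exists_clip φ ((n : ℝ) + 1)
  have hp : ∀ᵐ y ∂μ, toL2 μ (fun y => max (φ y) 0) y = max (φ y) 0 :=
    toL2_ae_of_le (f := φ) (c := 1) ((aestronglyMeasurable_coe φ).sup aestronglyMeasurable_const)
      (Eventually.of_forall fun y => by
        rw [one_mul, abs_of_nonneg (le_max_right _ _)]
        exact max_le (le_abs_self _) (abs_nonneg _))
  set p := toL2 μ fun y => max (φ y) 0
  have hlim : Tendsto x atTop (𝓝 p) := by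
    refine tendsto_L2_of_dominated (g := φ) (fun n => ?_) ?_
    · filter_upwards [hx n] with y hy
      rw [hy, abs_of_nonneg (le_max_left _ _)]
      exact max_le (abs_nonneg _) ((min_le_left _ _).trans (le_abs_self _))
    · filter_upwards [eventually_clip_eq hx, hp] with y h1 h2
      rwa [h2]
  have hpos : ∀ n : ℕ, (0 : ℝ) < n + 1 := fun n => by positivity
  have hpD := (mem_and_val_le_of_tendsto hlim fun n => clip_mem_and_val_le hφ (hpos n) (hx n)).1
  refine ⟨p, x, hpD, hp, fun n => ?_, ?_, fun n => ?_⟩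
  · refine mem_bddDomain.2 ⟨(clip_mem_and_val_le hφ (hpos n) (hx n)).1, n + 1, hpos n, ?_⟩
    filter_upwards [hx n] with y hy
    rw [hy, abs_of_nonneg (le_max_left _ _)]
    exact max_le (hpos n).le (min_le_right _ _)
  · refine tendsto_normSq_of_val_le hpD hlim fun n => clip_mem_and_val_le hpD (hpos n) ?_
    filter_upwards [hx n, hp] with y h1 h2
    rw [h1, h2]
    rcases le_total (φ y) 0 with h | h
    · rw [max_eq_right h, min_eq_left (hpos n).le, max_self,
        max_eq_left ((min_le_left _ _).trans h)]
    · rw [max_eq_left h]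
  · filter_upwards [hx n] with y hy h0
    rw [hy, h0, min_eq_left (hpos n).le, max_self]

/-- Every element of the domain is the limit, in the graph norm, of bounded elements that vanish
where it vanishes. -/
lemma exists_bdd_seq {φ : L2 μ} (hφ : φ ∈ E.domain) :
    ∃ x : ℕ → L2 μ, (∀ n, x n ∈ E.bddDomain) ∧
      Tendsto (fun n => E.normSq (x n - φ)) atTop (𝓝 0) ∧
      ∀ n, ∀ᵐ y ∂μ, φ y = 0 → x n y = 0 := by
  obtain ⟨p, x, hp, hpφ, hx, hxp, hx0⟩ := exists_bdd_seq_posPart hφ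
  obtain ⟨m, z, hm, hmφ, hz, hzm, hz0⟩ := exists_bdd_seq_posPart (E.domain.neg_mem hφ)
  have hneg := Lp.coeFn_neg φ
  have hpm : φ = p - m := by
    refine Lp.ext ?_
    filter_upwards [hpφ, hmφ, hneg, Lp.coeFn_sub p m] with y e1 e2 e3 e4
    rw [e4, Pi.sub_apply, e1, e2, e3, Pi.neg_apply]
    rcases le_total (φ y) 0 with h | h
    · rw [max_eq_right h, max_eq_left (by linarith)]; ring
    · rw [max_eq_left h, max_eq_right (by linarith)]; ring
  refine ⟨fun n => x n - z n, fun n => E.bddDomain.sub_mem (hx n) (hz n), ?_, fun n => ?_⟩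
  · have h1 := (hxp.const_mul 2).add (hzm.const_mul 2)
    rw [mul_zero, add_zero] at h1
    refine squeeze_zero (fun _ => normSq_nonneg _) (fun n => ?_) h1
    have h2 := E.domain.sub_mem (hx n).1 hp
    have h3 := E.domain.sub_mem hm (hz n).1
    have h4 : x n - z n - φ = (x n - p) + (m - z n) := by rw [hpm]; abel
    rw [h4, normSq_sub_comm (hz n).1 hm]
    exact normSq_add_le h2 h3
  · filter_upwards [hx0 n, hz0 n, hneg, Lp.coeFn_sub (x n) (z n)] with y e1 e2 e3 e4 h
    rw [e4, Pi.sub_apply, e1 h, e2 (by rw [e3, Pi.neg_apply, h, neg_zero]), sub_zero]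

lemma dense_bddDomain : Dense (E.bddDomain : Set (L2 μ)) := by
  refine dense_iff_closure_eq.2 (eq_univ_of_univ_subset ?_)
  rw [← E.dense_domain.closure_eq]
  refine closure_minimal (fun φ hφ => ?_) isClosed_closure
  obtain ⟨x, hx, hxφ, -⟩ := exists_bdd_seq hφ
  exact mem_closure_of_tendsto (tendsto_of_normSq hxφ) (Eventually.of_forall hx)

/-! ### The extension of the truncated forms by continuity -/

section Trunc

variable {χ χ' φ ψ : L2 μ}

variable (E) in
/-- The truncated form `E_χ` on bounded elements of the domain, as a quadratic form. -/
def truncQuad (χ φ : L2 μ) : ℝ≥0∞ :=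
  open Classical in if φ ∈ E.bddDomain then ENNReal.ofReal (E.truncBdd χ φ) else ∞

lemma truncQuad_ne_top (hφ : φ ∈ E.bddDomain) : E.truncQuad χ φ ≠ ∞ := by
  rw [truncQuad, if_pos hφ]; exact ENNReal.ofReal_ne_top

/-- The filter of bounded elements of the domain that tend to `φ` in the graph norm. -/
abbrev bddNhds (E : DirichletForm μ) (φ : L2 μ) : Filter (L2 μ) :=
  comap (fun ψ : L2 μ => E.normSq (ψ - φ)) (𝓝 0) ⊓ 𝓟 E.boundedDomain

lemma tendsto_bddNhds {x : ℕ → L2 μ} (hx : ∀ n, x n ∈ E.bddDomain)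
    (h : Tendsto (fun n => E.normSq (x n - φ)) atTop (𝓝 0)) :
    Tendsto x atTop (E.bddNhds φ) :=
  tendsto_inf.2 ⟨tendsto_comap_iff.2 h, tendsto_principal.2 (Eventually.of_forall hx)⟩

variable [SigmaFinite μ]

lemma truncQuad_toReal (hχ : χ ∈ E.bddDomain) (hχ0 : ∀ᵐ x ∂μ, 0 ≤ χ x)
    (hφ : φ ∈ E.bddDomain) : (E.truncQuad χ φ).toReal = E.truncBdd χ φ := by
  rw [truncQuad, if_pos hφ, ENNReal.toReal_ofReal (truncBdd_nonneg hχ hφ hχ0)]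

lemma isQuad_truncQuad (hχ : χ ∈ E.bddDomain) (hχ0 : ∀ᵐ x ∂μ, 0 ≤ χ x) :
    QForm.IsQuad (E.truncQuad χ) where
  parallelogram_le u v := by
    by_cases h : u ∈ E.bddDomain ∧ v ∈ E.bddDomain
    · have h0 := fun {w} (hw : w ∈ E.bddDomain) => truncBdd_nonneg hχ hw hχ0
      rw [truncQuad, truncQuad, truncQuad, truncQuad, if_pos h.1, if_pos h.2,
        if_pos (E.bddDomain.add_mem h.1 h.2), if_pos (E.bddDomain.sub_mem h.1 h.2),
        ← ENNReal.ofReal_add (h0 (E.bddDomain.add_mem h.1 h.2)) (h0 (E.bddDomain.sub_mem h.1 h.2)),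
        truncBdd_parallelogram hχ h.1 h.2, ENNReal.ofReal_add (by linarith [h0 h.1])
        (by linarith [h0 h.2]), ENNReal.ofReal_mul zero_le_two, ENNReal.ofReal_mul zero_le_two,
        ENNReal.ofReal_ofNat]
    · rcases not_and_or.1 h with h | h <;> simp [truncQuad, h]
  map_smul c u := by
    by_cases h : u ∈ E.bddDomain
    · rw [truncQuad, truncQuad, if_pos h, if_pos (E.bddDomain.smul_mem c h), truncBdd_smul hχ h,
        ENNReal.ofReal_mul (sq_nonneg c)]
    · rcases eq_or_ne c 0 with rfl | hc
      · have h0 := truncBdd_smul hχ E.bddDomain.zero_mem 0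
        rw [zero_smul] at h0
        rw [zero_smul, truncQuad, if_pos E.bddDomain.zero_mem, h0]
        simp
      · rw [truncQuad, truncQuad, if_neg h, if_neg ((E.bddDomain.smul_mem_iff hc).not.2 h),
          ENNReal.mul_top (by simpa using hc)]

lemma exists_tendsto_truncBdd (hχ : χ ∈ E.bddDomain) (hχ0 : ∀ᵐ x ∂μ, 0 ≤ χ x)
    (hφ : φ ∈ E.domain) : ∃ L, Tendsto (fun ψ => E.truncBdd χ ψ) (E.bddNhds φ) (𝓝 L) := by
  obtain ⟨x, hx, hxφ, -⟩ := exists_bdd_seq hφ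
  have hne : (E.bddNhds φ).NeBot := (tendsto_bddNhds hx hxφ).neBot
  obtain ⟨-, M, hM, hχM⟩ := mem_bddDomain.1 hχ
  have hχM' : ∀ᵐ y ∂μ, χ y ≤ M := by
    filter_upwards [hχM] with y hy using (le_abs_self _).trans hy
  have hbdd : E.boundedDomain ∈ E.bddNhds φ := mem_inf_of_right (mem_principal_self _)
  suffices h : ∃ L, Tendsto (fun ψ => √(E.truncBdd χ ψ)) (E.bddNhds φ) (𝓝 L) by
    obtain ⟨L, hL⟩ := h
    refine ⟨L ^ 2, (hL.pow 2).congr' ?_⟩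
    filter_upwards [hbdd] with ψ hψ
    exact Real.sq_sqrt (truncBdd_nonneg hχ hψ hχ0)
  rw [← cauchy_map_iff_exists_tendsto, Metric.cauchy_iff]
  refine ⟨hne.map _, fun ε hε => ?_⟩
  set δ := ε ^ 2 / (8 * M)
  have hδ : 0 < δ := by positivity
  refine ⟨_, image_mem_map (inter_mem_inf (preimage_mem_comap (gt_mem_nhds hδ))
    (mem_principal_self E.boundedDomain)), ?_⟩
  rintro _ ⟨u, ⟨hu, huD⟩, rfl⟩ _ ⟨v, ⟨hv, hvD⟩, rfl⟩
  have huv := E.bddDomain.sub_mem huD hvD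
  have h1 := (isQuad_truncQuad hχ hχ0).abs_sqrt_sub_sqrt_le (truncQuad_ne_top huD)
    (truncQuad_ne_top hvD)
  rw [truncQuad_toReal hχ hχ0 huD, truncQuad_toReal hχ hχ0 hvD,
    truncQuad_toReal hχ hχ0 huv] at h1
  rw [Real.dist_eq]
  refine h1.trans_lt ?_
  rw [Real.sqrt_lt' hε]
  refine (truncBdd_le hχ huv hM.le hχM').trans_lt ?_
  have hu' : E.normSq (u - φ) < δ := hu
  have hv' : E.normSq (v - φ) < δ := hv
  have h2 := normSq_sub_le huD.1 hφ hvD.1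
  rw [normSq_sub_comm hφ hvD.1] at h2
  have h3 := val_le_normSq (E := E) (u - v)
  have h4 : E.val (u - v) (u - v) < 4 * δ := by linarith
  have h5 : M * (4 * δ) < ε ^ 2 := by
    have : M * (4 * δ) = ε ^ 2 / 2 := by simp only [δ]; field_simp; ring
    rw [this]
    have : 0 < ε ^ 2 := by positivity
    linarith
  exact (mul_lt_mul_of_pos_left h4 hM).trans h5

/-- The truncated form at `φ` is the limit of its values at bounded approximations of `φ`. -/
lemma tendsto_trunc (hχ : χ ∈ E.bddDomain) (hχ0 : ∀ᵐ x ∂μ, 0 ≤ χ x) (hφ : φ ∈ E.domain)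
    {x : ℕ → L2 μ} (hx : ∀ n, x n ∈ E.bddDomain)
    (h : Tendsto (fun n => E.normSq (x n - φ)) atTop (𝓝 0)) :
    Tendsto (fun n => E.truncBdd χ (x n)) atTop (𝓝 (E.trunc χ φ)) :=
  (tendsto_nhds_limUnder (exists_tendsto_truncBdd hχ hχ0 hφ)).comp (tendsto_bddNhds hx h)

lemma trunc_nonneg (hχ : χ ∈ E.bddDomain) (hχ0 : ∀ᵐ x ∂μ, 0 ≤ χ x) (hφ : φ ∈ E.domain) :
    0 ≤ E.trunc χ φ := by
  obtain ⟨x, hx, hxφ, -⟩ := exists_bdd_seq hφ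
  exact ge_of_tendsto' (tendsto_trunc hχ hχ0 hφ hx hxφ) fun n => truncBdd_nonneg hχ (hx n) hχ0

lemma trunc_le (hχ : χ ∈ E.bddDomain) (hχ0 : ∀ᵐ x ∂μ, 0 ≤ χ x) (hχ1 : ∀ᵐ x ∂μ, χ x ≤ 1)
    (hφ : φ ∈ E.domain) : E.trunc χ φ ≤ E.val φ φ := by
  obtain ⟨x, hx, hxφ, -⟩ := exists_bdd_seq hφ
  refine le_of_tendsto_of_tendsto' (tendsto_trunc hχ hχ0 hφ hx hxφ) (tendsto_val_self hφ
    (fun n => (hx n).1) hxφ) fun n => ?_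
  simpa using truncBdd_le hχ (hx n) zero_le_one hχ1

lemma trunc_mono (hχ : χ ∈ E.bddDomain) (hχ0 : ∀ᵐ x ∂μ, 0 ≤ χ x) (hχ' : χ' ∈ E.bddDomain)
    (hχχ' : ∀ᵐ x ∂μ, χ x ≤ χ' x) (hφ : φ ∈ E.domain) : E.trunc χ φ ≤ E.trunc χ' φ := by
  have hχ0' : ∀ᵐ x ∂μ, 0 ≤ χ' x := by
    filter_upwards [hχ0, hχχ'] with x h1 h2 using h1.trans h2
  obtain ⟨x, hx, hxφ, -⟩ := exists_bdd_seq hφ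
  exact le_of_tendsto_of_tendsto' (tendsto_trunc hχ hχ0 hφ hx hxφ)
    (tendsto_trunc hχ' hχ0' hφ hx hxφ) fun n => truncBdd_mono hχ hχ' (hx n) hχχ'

lemma trunc_smul (hχ : χ ∈ E.bddDomain) (hχ0 : ∀ᵐ x ∂μ, 0 ≤ χ x) (hφ : φ ∈ E.domain) (c : ℝ) :
    E.trunc χ (c • φ) = c ^ 2 * E.trunc χ φ := by
  obtain ⟨x, hx, hxφ, -⟩ := exists_bdd_seq hφ
  have h1 := tendsto_trunc hχ hχ0 (E.domain.smul_mem c hφ)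
    (x := fun n => c • x n) (fun n => E.bddDomain.smul_mem c (hx n)) (by
      have := hxφ.const_mul (c ^ 2)
      rw [mul_zero] at this
      refine this.congr fun n => ?_
      rw [← smul_sub, normSq_smul c (E.domain.sub_mem (hx n).1 hφ)])
  have h2 := (tendsto_trunc hχ hχ0 hφ hx hxφ).const_mul (c ^ 2)
  exact tendsto_nhds_unique h1 (h2.congr fun n => (truncBdd_smul hχ (hx n) c).symm)

lemma trunc_parallelogram (hχ : χ ∈ E.bddDomain) (hχ0 : ∀ᵐ x ∂μ, 0 ≤ χ x) (hφ : φ ∈ E.domain)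
    (hψ : ψ ∈ E.domain) :
    E.trunc χ (φ + ψ) + E.trunc χ (φ - ψ) = 2 * E.trunc χ φ + 2 * E.trunc χ ψ := by
  obtain ⟨x, hx, hxφ, -⟩ := exists_bdd_seq hφ
  obtain ⟨z, hz, hzψ, -⟩ := exists_bdd_seq hψ
  have hlim := (hxφ.const_mul 2).add (hzψ.const_mul 2)
  rw [mul_zero, add_zero] at hlim
  have h1 := tendsto_trunc hχ hχ0 (E.domain.add_mem hφ hψ)
    (x := fun n => x n + z n) (fun n => E.bddDomain.add_mem (hx n) (hz n)) (by
      refine squeeze_zero (fun _ => normSq_nonneg _) (fun n => ?_) hlim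
      rw [show x n + z n - (φ + ψ) = (x n - φ) + (z n - ψ) by abel]
      exact normSq_add_le (E.domain.sub_mem (hx n).1 hφ) (E.domain.sub_mem (hz n).1 hψ))
  have h2 := tendsto_trunc hχ hχ0 (E.domain.sub_mem hφ hψ)
    (x := fun n => x n - z n) (fun n => E.bddDomain.sub_mem (hx n) (hz n)) (by
      refine squeeze_zero (fun _ => normSq_nonneg _) (fun n => ?_) hlim
      rw [show x n - z n - (φ - ψ) = (x n - φ) + (ψ - z n) by abel,
        normSq_sub_comm (hz n).1 hψ]
      exact normSq_add_le (E.domain.sub_mem (hx n).1 hφ) (E.domain.sub_mem hψ (hz n).1))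
  have h3 := ((tendsto_trunc hχ hχ0 hφ hx hxφ).const_mul 2).add
    ((tendsto_trunc hχ hχ0 hψ hz hzψ).const_mul 2)
  exact tendsto_nhds_unique (h1.add h2)
    (h3.congr fun n => (truncBdd_parallelogram hχ (hx n) (hz n)).symm)

end Trunc

/-! ### The form with Neumann boundary conditions -/

section Neumann

variable {Ω : Set X} {χ χ' φ ψ : L2 μ}

lemma cutoffs_nonneg (hχ : χ ∈ E.cutoffs Ω) : ∀ᵐ x ∂μ, 0 ≤ χ x := by
  filter_upwards [hχ.2] with x hx using hx.1

lemma cutoffs_le_one (hχ : χ ∈ E.cutoffs Ω) : ∀ᵐ x ∂μ, χ x ≤ 1 := by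
  filter_upwards [hχ.2] with x hx
  exact hx.2.trans (indicator_le_self' (fun _ _ => zero_le_one) x)

lemma cutoffs_directed (hχ : χ ∈ E.cutoffs Ω) (hχ' : χ' ∈ E.cutoffs Ω) :
    ∃ η ∈ E.cutoffs Ω, (∀ᵐ x ∂μ, χ x ≤ η x) ∧ ∀ᵐ x ∂μ, χ' x ≤ η x := by
  obtain ⟨w, hw⟩ := exists_clip (χ - χ') 1
  have hwD := (clip_mem_and_val_le (E.domain.sub_mem hχ.1.1 hχ'.1.1) one_pos hw).1
  have hη : ∀ᵐ x ∂μ, (χ' + w) x = max (χ x) (χ' x) := by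
    filter_upwards [hw, Lp.coeFn_sub χ χ', Lp.coeFn_add χ' w, cutoffs_le_one hχ,
      cutoffs_nonneg hχ'] with x e1 e2 e3 e4 e5
    rw [e3, Pi.add_apply, e1, e2, Pi.sub_apply, min_eq_left (by linarith)]
    rcases le_total (χ x) (χ' x) with h | h
    · rw [max_eq_left (by linarith), max_eq_right h, add_zero]
    · rw [max_eq_right (by linarith), max_eq_left h]; ring
  refine ⟨χ' + w, ⟨mem_bddDomain.2 ⟨E.domain.add_mem hχ'.1.1 hwD, 1, one_pos, ?_⟩, ?_⟩, ?_, ?_⟩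
  · filter_upwards [hη, cutoffs_nonneg hχ, cutoffs_le_one hχ, cutoffs_le_one hχ']
      with x e1 e2 e3 e4
    rw [e1, abs_of_nonneg (e2.trans (le_max_left _ _))]
    exact max_le e3 e4
  · filter_upwards [hη, hχ.2, hχ'.2] with x e1 e2 e3
    rw [e1]
    exact ⟨e2.1.trans (le_max_left _ _), max_le e2.2 e3.2⟩
  · filter_upwards [hη] with x e1
    rw [e1]; exact le_max_left _ _
  · filter_upwards [hη] with x e1
    rw [e1]; exact le_max_right _ _

lemma neumannPart_of_mem (hφ : φ ∈ E.domain) :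
    E.neumannPart Ω φ = ⨆ χ ∈ E.cutoffs Ω, ENNReal.ofReal (E.trunc χ φ) :=
  if_pos hφ

lemma neumannPart_of_notMem (hφ : φ ∉ E.domain) : E.neumannPart Ω φ = ∞ :=
  if_neg hφ

lemma zero_mem_cutoffs : (0 : L2 μ) ∈ E.cutoffs Ω := by
  refine ⟨E.bddDomain.zero_mem, ?_⟩
  filter_upwards [Lp.coeFn_zero ℝ 2 μ] with x hx
  rw [hx]
  exact ⟨le_rfl, indicator_nonneg (fun _ _ => zero_le_one) x⟩

lemma trunc_le_neumannPart (hχ : χ ∈ E.cutoffs Ω) (hφ : φ ∈ E.domain) :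
    ENNReal.ofReal (E.trunc χ φ) ≤ E.neumannPart Ω φ := by
  rw [neumannPart_of_mem hφ]
  exact le_iSup₂ (f := fun χ (_ : χ ∈ E.cutoffs Ω) => ENNReal.ofReal (E.trunc χ φ)) χ hχ

variable [SigmaFinite μ]

lemma neumannPart_le (hφ : φ ∈ E.domain) : E.neumannPart Ω φ ≤ ENNReal.ofReal (E.val φ φ) := by
  rw [neumannPart_of_mem hφ]
  exact iSup₂_le fun χ hχ =>
    ENNReal.ofReal_le_ofReal (trunc_le hχ.1 (cutoffs_nonneg hχ) (cutoffs_le_one hχ) hφ)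

/-- The parallelogram law passes to the supremum because the truncated forms are directed. -/
lemma isQuad_neumannPart : QForm.IsQuad (E.neumannPart Ω) where
  parallelogram_le u v := by
    by_cases h : u ∈ E.domain ∧ v ∈ E.domain
    · rw [neumannPart_of_mem (E.domain.add_mem h.1 h.2), neumannPart_of_mem
        (E.domain.sub_mem h.1 h.2)]
      refine ENNReal.biSup_add_biSup_le ⟨0, zero_mem_cutoffs⟩ ⟨0, zero_mem_cutoffs⟩
        fun χ hχ χ' hχ' => ?_
      obtain ⟨η, hη, h1, h2⟩ := cutoffs_directed hχ hχ'
      have hη0 := cutoffs_nonneg hη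
      have ha := E.domain.add_mem h.1 h.2
      have hs := E.domain.sub_mem h.1 h.2
      calc ENNReal.ofReal (E.trunc χ (u + v)) + ENNReal.ofReal (E.trunc χ' (u - v))
          ≤ ENNReal.ofReal (E.trunc η (u + v)) + ENNReal.ofReal (E.trunc η (u - v)) :=
            add_le_add
              (ENNReal.ofReal_le_ofReal (trunc_mono hχ.1 (cutoffs_nonneg hχ) hη.1 h1 ha))
              (ENNReal.ofReal_le_ofReal (trunc_mono hχ'.1 (cutoffs_nonneg hχ') hη.1 h2 hs))
        _ = 2 * ENNReal.ofReal (E.trunc η u) + 2 * ENNReal.ofReal (E.trunc η v) := by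
            rw [← ENNReal.ofReal_add (trunc_nonneg hη.1 hη0 ha) (trunc_nonneg hη.1 hη0 hs),
              trunc_parallelogram hη.1 hη0 h.1 h.2,
              ENNReal.ofReal_add (by linarith [trunc_nonneg hη.1 hη0 h.1])
              (by linarith [trunc_nonneg hη.1 hη0 h.2]), ENNReal.ofReal_mul zero_le_two,
              ENNReal.ofReal_mul zero_le_two, ENNReal.ofReal_ofNat]
        _ ≤ 2 * E.neumannPart Ω u + 2 * E.neumannPart Ω v :=
            add_le_add (mul_le_mul_right (trunc_le_neumannPart hη h.1) _)
              (mul_le_mul_right (trunc_le_neumannPart hη h.2) _)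
    · rcases not_and_or.1 h with h | h <;> simp [neumannPart_of_notMem h]
  map_smul c u := by
    by_cases h : u ∈ E.domain
    · rw [neumannPart_of_mem h, neumannPart_of_mem (E.domain.smul_mem c h), ENNReal.mul_iSup]
      refine iSup_congr fun χ => ?_
      rw [ENNReal.mul_iSup]
      refine iSup_congr fun hχ => ?_
      rw [trunc_smul hχ.1 (cutoffs_nonneg hχ) h, ENNReal.ofReal_mul (sq_nonneg c)]
    · rcases eq_or_ne c 0 with rfl | hc
      · have h0 : E.neumannPart Ω 0 ≤ 0 := by
          refine (neumannPart_le E.domain.zero_mem).trans ?_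
          rw [val_zero]; simp
        rw [zero_smul, le_antisymm h0 zero_le]; simp
      · rw [neumannPart_of_notMem h,
          neumannPart_of_notMem ((E.domain.smul_mem_iff hc).not.2 h),
          ENNReal.mul_top (by simpa using hc)]

/-- The relaxed Neumann form is closed. -/
lemma isClosedForm_relaxation_neumannPart :
    QForm.IsClosedForm (QForm.relaxation (E.neumannPart Ω)) where
  toIsQuad := QForm.isQuad_relaxation isQuad_neumannPart
  lsc := QForm.lowerSemicontinuous_relaxation _
  dense := E.dense_domain.mono fun _ hφ =>
    ne_top_of_le_ne_top ENNReal.ofReal_ne_top ((QForm.relaxation_le _ _).trans (neumannPart_le hφ))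

end Neumann

end DirichletForm

/-! ### Restriction to a measurable set -/

section Restriction

variable {X : Type*} [MeasurableSpace X] {μ : Measure X} {Ω : Set X}

lemma indicator_memLp (hΩ : MeasurableSet Ω) (f : L2 μ) : MemLp (Ω.indicator f) 2 μ :=
  (Lp.memLp f).indicator hΩ

/-- The operator on `L₂(X)` of multiplication by the indicator function of `Ω`, that is, the
orthogonal projection onto `L₂(Ω)`. -/
def restrictL2 (μ : Measure X) {Ω : Set X} (hΩ : MeasurableSet Ω) : L2 μ →L[ℝ] L2 μ :=
  LinearMap.mkContinuous
    { toFun := fun f => toL2 μ (Ω.indicator f)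
      map_add' := fun f g => by
        refine Lp.ext ?_
        filter_upwards [toL2_ae (indicator_memLp hΩ (f + g)), toL2_ae (indicator_memLp hΩ f),
          toL2_ae (indicator_memLp hΩ g), Lp.coeFn_add f g,
          Lp.coeFn_add (toL2 μ (Ω.indicator f)) (toL2 μ (Ω.indicator g))] with x h1 h2 h3 h4 h5
        rw [h5, h1, Pi.add_apply, h2, h3]
        by_cases hx : x ∈ Ω
        · rw [indicator_of_mem hx, indicator_of_mem hx, indicator_of_mem hx, h4, Pi.add_apply]
        · simp only [indicator_of_notMem hx, add_zero]
      map_smul' := fun c f => by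
        refine Lp.ext ?_
        filter_upwards [toL2_ae (indicator_memLp hΩ (c • f)), toL2_ae (indicator_memLp hΩ f),
          Lp.coeFn_smul c f, Lp.coeFn_smul c (toL2 μ (Ω.indicator f))] with x h1 h2 h3 h4
        rw [RingHom.id_apply, h4, h1, Pi.smul_apply, h2]
        by_cases hx : x ∈ Ω <;> simp [hx, h3] } 1 fun f => by
    rw [one_mul]
    refine Lp.norm_le_norm_of_ae_le ?_
    filter_upwards [toL2_ae (indicator_memLp hΩ f)] with x h1
    change ‖toL2 μ (Ω.indicator f) x‖ ≤ _
    rw [h1]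
    exact norm_indicator_le_norm_self _ _

lemma restrictL2_ae (hΩ : MeasurableSet Ω) (f : L2 μ) :
    ∀ᵐ x ∂μ, restrictL2 μ hΩ f x = Ω.indicator f x :=
  toL2_ae (indicator_memLp hΩ f)

lemma restrictL2_mem (hΩ : MeasurableSet Ω) (f : L2 μ) : restrictL2 μ hΩ f ∈ L2On μ Ω := by
  filter_upwards [restrictL2_ae hΩ f] with x h1 hx
  rw [h1, indicator_of_notMem hx]

lemma restrictL2_eq (hΩ : MeasurableSet Ω) {f g : L2 μ} (hg : g ∈ L2On μ Ω)
    (h : ∀ᵐ x ∂μ, x ∈ Ω → g x = f x) : restrictL2 μ hΩ f = g := by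
  refine Lp.ext ?_
  filter_upwards [restrictL2_ae hΩ f, hg, h] with x h1 h2 h3
  rw [h1]
  by_cases hx : x ∈ Ω
  · rw [indicator_of_mem hx, h3 hx]
  · rw [indicator_of_notMem hx, h2 hx]

lemma restrictL2_of_mem (hΩ : MeasurableSet Ω) {f : L2 μ} (hf : f ∈ L2On μ Ω) :
    restrictL2 μ hΩ f = f :=
  restrictL2_eq hΩ hf (Eventually.of_forall fun _ _ => rfl)

lemma restrictL2_restrictL2 (hΩ : MeasurableSet Ω) (f : L2 μ) :
    restrictL2 μ hΩ (restrictL2 μ hΩ f) = restrictL2 μ hΩ f :=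
  restrictL2_of_mem hΩ (restrictL2_mem hΩ f)

lemma sub_restrictL2_ae (hΩ : MeasurableSet Ω) (f : L2 μ) :
    ∀ᵐ x ∂μ, x ∈ Ω → (f - restrictL2 μ hΩ f) x = 0 := by
  filter_upwards [restrictL2_ae hΩ f, Lp.coeFn_sub f (restrictL2 μ hΩ f)] with x h1 h2 hx
  rw [h2, Pi.sub_apply, h1, indicator_of_mem hx, sub_self]

lemma inner_sub_restrictL2 (hΩ : MeasurableSet Ω) {g : L2 μ} (hg : g ∈ L2On μ Ω) (f : L2 μ) :
    inner ℝ g (f - restrictL2 μ hΩ f) = 0 := by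
  rw [inner_eq_integral]
  refine integral_eq_zero_of_ae ?_
  filter_upwards [hg, sub_restrictL2_ae hΩ f] with x h1 h2
  by_cases hx : x ∈ Ω
  · change g x * (f - restrictL2 μ hΩ f) x = 0
    rw [h2 hx, mul_zero]
  · change g x * (f - restrictL2 μ hΩ f) x = 0
    rw [h1 hx, zero_mul]

lemma inner_restrictL2 (hΩ : MeasurableSet Ω) {g : L2 μ} (hg : g ∈ L2On μ Ω) (f : L2 μ) :
    inner ℝ g (restrictL2 μ hΩ f) = inner ℝ g f := by
  have h := inner_sub_restrictL2 hΩ hg f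
  rw [inner_sub_right] at h
  linarith

lemma isClosed_L2On (hΩ : MeasurableSet Ω) : IsClosed (L2On μ Ω : Set (L2 μ)) := by
  have h : (L2On μ Ω : Set (L2 μ)) = {f | restrictL2 μ hΩ f = f} := by
    ext f
    refine ⟨restrictL2_of_mem hΩ, fun h => ?_⟩
    rw [SetLike.mem_coe, ← show restrictL2 μ hΩ f = f from h]
    exact restrictL2_mem hΩ f
  rw [h]
  exact isClosed_eq (restrictL2 μ hΩ).continuous continuous_id

end Restriction

namespace DirichletForm

/-! ### Supports and cutoff functions -/

section Support

variable {X : Type*} [MeasurableSpace X] [TopologicalSpace X] {μ : Measure X}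

lemma isClosed_aeSupport (f : L2 μ) : IsClosed (aeSupport f) := by
  rw [← isOpen_compl_iff, isOpen_iff_mem_nhds]
  intro x hx
  simp only [aeSupport, mem_compl_iff, mem_ofPred_eq, not_forall, not_not] at hx
  obtain ⟨U, hU, hfU⟩ := hx
  filter_upwards [eventually_mem_nhds_iff.2 hU] with y hy
  exact fun hys => hys U hy hfU

lemma aeSupport_subset {f : L2 μ} {C : Set X} (hC : IsClosed C)
    (h : ∀ᵐ x ∂μ, x ∉ C → f x = 0) : aeSupport f ⊆ C := by
  intro x hx
  by_contra hxC
  exact hx Cᶜ (hC.isOpen_compl.mem_nhds hxC) h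

/-- An element of `L₂(X)` vanishes almost everywhere off its support. -/
lemma ae_eq_zero_of_notMem_aeSupport [SecondCountableTopology X] (f : L2 μ) :
    ∀ᵐ x ∂μ, x ∉ aeSupport f → f x = 0 := by
  rw [ae_iff]
  refine measure_null_of_locally_null _ fun x hx => ?_
  simp only [Classical.not_imp, mem_ofPred_eq] at hx
  obtain ⟨hx, -⟩ := hx
  simp only [aeSupport, mem_ofPred_eq, not_forall, not_not] at hx
  obtain ⟨U, hU, hfU⟩ := hx
  refine ⟨_ ∩ U, inter_mem_nhdsWithin _ hU, measure_mono_null ?_ (ae_iff.1 hfU)⟩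
  rintro y ⟨hy, hyU⟩
  simp only [Classical.not_imp, mem_ofPred_eq] at hy ⊢
  exact ⟨hyU, hy.2⟩

end Support

variable {X : Type*} [MeasurableSpace X] {μ : Measure X} {E : DirichletForm μ}

/-- In a regular Dirichlet form there are cutoff functions for every compact subset `K` of an open
set `U`. -/
lemma exists_cutoff [TopologicalSpace X] [T2Space X] [LocallyCompactSpace X] (hreg : E.IsRegular)
    {K U : Set X} (hK : IsCompact K) (hU : IsOpen U) (hKU : K ⊆ U) :
    ∃ χ ∈ E.bddDomain, (∀ᵐ x ∂μ, 0 ≤ χ x ∧ χ x ≤ 1) ∧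
      (∃ W, IsOpen W ∧ K ⊆ W ∧ ∀ᵐ x ∂μ, x ∈ W → χ x = 1) ∧
      ∃ C, IsCompact C ∧ C ⊆ U ∧ ∀ᵐ x ∂μ, x ∉ C → χ x = 0 := by
  obtain ⟨L, hL, hKL, hLU⟩ := exists_compact_between hK hU hKU
  obtain ⟨f, hf1, hfc, hfU, hf01⟩ := exists_continuousMap_one_of_isCompact_subset_isOpen hL hU hLU
  let f₀ : C₀(X, ℝ) := ⟨f, by
    refine tendsto_const_nhds.congr' ?_
    filter_upwards [hfc.compl_mem_cocompact] with x hx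
    exact (image_eq_zero_of_notMem_tsupport hx).symm⟩
  obtain ⟨g, hg, -, ψ, hψ, hψg⟩ := Metric.dense_iff.1 hreg.2 f₀ (1 / 4) (by norm_num)
  have hgf : ∀ x, |g x - f x| ≤ 1 / 4 := fun x => by
    rw [← Real.dist_eq]
    refine le_trans ?_ (Metric.mem_ball.1 hg).le
    rw [← ZeroAtInftyContinuousMap.dist_toBCF_eq_dist]
    exact BoundedContinuousFunction.dist_coe_le_dist (f := g.toBCF) (g := f₀.toBCF) x
  obtain ⟨a, ha⟩ := exists_clip ψ (3 / 4)
  obtain ⟨b, hb⟩ := exists_clip ψ (1 / 4)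
  have haD := (clip_mem_and_val_le hψ (by norm_num) ha).1
  have hbD := (clip_mem_and_val_le hψ (by norm_num) hb).1
  have hχ : ∀ᵐ x ∂μ, ((2 : ℝ) • (a - b)) x =
      2 * (max 0 (min (g x) (3 / 4)) - max 0 (min (g x) (1 / 4))) := by
    filter_upwards [ha, hb, hψg, Lp.coeFn_smul (2 : ℝ) (a - b), Lp.coeFn_sub a b]
      with x h1 h2 h3 h4 h5
    rw [h4, Pi.smul_apply, h5, Pi.sub_apply, h1, h2, h3, smul_eq_mul]
  have h01 : ∀ t : ℝ, 0 ≤ 2 * (max 0 (min t (3 / 4)) - max 0 (min t (1 / 4))) ∧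
      2 * (max 0 (min t (3 / 4)) - max 0 (min t (1 / 4))) ≤ 1 := fun t => by
    rcases le_total t 0 with h | h
    · rw [min_eq_left (by linarith), min_eq_left (by linarith)]; simp
    · rcases le_total t (1 / 4) with h1 | h1
      · rw [min_eq_left (by linarith), min_eq_left (by linarith)]; simp
      · rw [min_eq_right h1, max_eq_right (by norm_num : (0 : ℝ) ≤ 1 / 4),
          max_eq_right (le_min h (by norm_num))]
        refine ⟨?_, ?_⟩
        · have : 1 / 4 ≤ min t (3 / 4) := le_min h1 (by norm_num)
          linarith
        · have : min t (3 / 4) ≤ 3 / 4 := min_le_right _ _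
          linarith
  have hχ01 : ∀ᵐ x ∂μ, 0 ≤ ((2 : ℝ) • (a - b)) x ∧ ((2 : ℝ) • (a - b)) x ≤ 1 := by
    filter_upwards [hχ] with x hx
    rw [hx]; exact h01 _
  refine ⟨(2 : ℝ) • (a - b), mem_bddDomain.2 ⟨E.domain.smul_mem _ (E.domain.sub_mem haD hbD), 1,
    one_pos, ?_⟩, hχ01, ⟨interior L, isOpen_interior, hKL, ?_⟩, tsupport f, hfc, hfU, ?_⟩
  · filter_upwards [hχ01] with x hx
    rw [abs_of_nonneg hx.1]; exact hx.2
  · filter_upwards [hχ] with x hx hxL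
    have h1 : f x = 1 := hf1 (interior_subset hxL)
    have h2 := abs_le.1 (hgf x)
    rw [h1] at h2
    rw [hx, min_eq_right (by linarith), min_eq_right (by linarith)]
    norm_num
  · filter_upwards [hχ] with x hx hxL
    have h1 : f x = 0 := image_eq_zero_of_notMem_tsupport hxL
    have h2 := abs_le.1 (hgf x)
    rw [h1] at h2
    rw [hx, min_eq_left (by linarith), min_eq_left (by linarith)]
    simp

/-! ### Consequences of strong locality -/

section Local

variable {Ω : Set X} {χ φ ψ : L2 μ}

lemma toL2_mul_eq_zero (h : ∀ᵐ x ∂μ, χ x * φ x = 0) : toL2 μ (fun x => χ x * φ x) = 0 := by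
  refine toL2_eq_of_ae ?_
  filter_upwards [h, Lp.coeFn_zero ℝ 2 μ] with x h1 h2
  rw [h1, h2]; rfl

variable [SigmaFinite μ]

lemma truncBdd_eq_zero (hloc : E.IsStronglyLocal) (hχ : χ ∈ E.bddDomain) (hφ : φ ∈ E.bddDomain)
    (h : ∀ᵐ x ∂μ, χ x * φ x = 0) : E.truncBdd χ φ = 0 := by
  have h1 : E.val 0 φ = 0 := by
    simpa using val_smul_left (E := E) 0 E.domain.zero_mem hφ.1
  have h2 := hloc χ hχ.1 _ (toL2_sq_spec hφ).1.1 0 (by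
    filter_upwards [h, (toL2_sq_spec hφ).2] with x e1 e2
    rw [e2, add_zero, sq, ← mul_assoc, e1, zero_mul])
  rw [truncBdd, toL2_mul_eq_zero h, h1, h2]
  norm_num

lemma truncBdd_eq_val (hloc : E.IsStronglyLocal) (hχ : χ ∈ E.bddDomain) (hφ : φ ∈ E.bddDomain)
    (h : ∀ᵐ x ∂μ, φ x = 0 ∨ χ x = 1) : E.truncBdd χ φ = E.val φ φ := by
  have h1 : toL2 μ (fun x => χ x * φ x) = φ := by
    refine toL2_eq_of_ae ?_
    filter_upwards [h] with x hx
    rcases hx with hx | hx <;> simp [hx]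
  have h2 := hloc χ hχ.1 _ (toL2_sq_spec hφ).1.1 (-1) (by
    filter_upwards [h, (toL2_sq_spec hφ).2] with x e1 e2
    rw [e2]
    rcases e1 with e1 | e1 <;> simp [e1])
  rw [truncBdd, h1, h2]
  ring

lemma trunc_eq_zero (hloc : E.IsStronglyLocal) (hχ : χ ∈ E.bddDomain) (hχ0 : ∀ᵐ x ∂μ, 0 ≤ χ x)
    (hφ : φ ∈ E.domain) (h : ∀ᵐ x ∂μ, χ x = 0 ∨ φ x = 0) : E.trunc χ φ = 0 := by
  obtain ⟨x, hx, hxφ, hx0⟩ := exists_bdd_seq hφ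
  refine tendsto_nhds_unique (tendsto_trunc hχ hχ0 hφ hx hxφ)
    (tendsto_const_nhds.congr fun n => (truncBdd_eq_zero hloc hχ (hx n) ?_).symm)
  filter_upwards [h, hx0 n] with y h1 h2
  rcases h1 with h1 | h1
  · rw [h1, zero_mul]
  · rw [h2 h1, mul_zero]

lemma trunc_eq_val (hloc : E.IsStronglyLocal) (hχ : χ ∈ E.bddDomain) (hχ0 : ∀ᵐ x ∂μ, 0 ≤ χ x)
    (hφ : φ ∈ E.domain) (h : ∀ᵐ x ∂μ, φ x = 0 ∨ χ x = 1) : E.trunc χ φ = E.val φ φ := by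
  obtain ⟨x, hx, hxφ, hx0⟩ := exists_bdd_seq hφ
  refine tendsto_nhds_unique (tendsto_trunc hχ hχ0 hφ hx hxφ)
    ((tendsto_val_self hφ (fun n => (hx n).1) hxφ).congr fun n =>
      (truncBdd_eq_val hloc hχ (hx n) ?_).symm)
  filter_upwards [h, hx0 n] with y h1 h2
  exact h1.imp_left h2

lemma neumannPart_eq_zero (hloc : E.IsStronglyLocal) (hφ : φ ∈ E.domain)
    (h : ∀ᵐ x ∂μ, x ∈ Ω → φ x = 0) : E.neumannPart Ω φ = 0 := by
  rw [neumannPart_of_mem hφ]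
  refine le_antisymm (iSup₂_le fun χ hχ => ?_) zero_le
  rw [trunc_eq_zero hloc hχ.1 (cutoffs_nonneg hχ) hφ, ENNReal.ofReal_zero]
  filter_upwards [h, hχ.2] with x h1 h2
  by_cases hx : x ∈ Ω
  · exact Or.inr (h1 hx)
  · rw [indicator_of_notMem hx] at h2
    exact Or.inl (le_antisymm h2.2 h2.1)

/-- The Neumann form of `φ` depends only on the restriction of `φ` to `Ω`. -/
lemma neumannPart_congr (hloc : E.IsStronglyLocal) (hφ : φ ∈ E.domain) (hψ : ψ ∈ E.domain)
    (h : ∀ᵐ x ∂μ, x ∈ Ω → φ x = ψ x) : E.neumannPart Ω φ = E.neumannPart Ω ψ := by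
  have hq := isQuad_neumannPart (E := E) (Ω := Ω)
  have ht : ∀ {η}, η ∈ E.domain → E.neumannPart Ω η ≠ ∞ := fun hη =>
    ne_top_of_le_ne_top ENNReal.ofReal_ne_top (neumannPart_le hη)
  have hs := E.domain.sub_mem hφ hψ
  have h0 := neumannPart_eq_zero (Ω := Ω) hloc hs (by
    filter_upwards [h, Lp.coeFn_sub φ ψ] with x h1 h2 hx
    rw [h2, Pi.sub_apply, h1 hx, sub_self])
  have h1 := hq.abs_sqrt_sub_sqrt_le (ht hφ) (ht hψ)
  rw [h0, ENNReal.toReal_zero, Real.sqrt_zero, abs_nonpos_iff, sub_eq_zero,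
    Real.sqrt_inj ENNReal.toReal_nonneg ENNReal.toReal_nonneg] at h1
  exact (ENNReal.toReal_eq_toReal_iff' (ht hφ) (ht hψ)).1 h1

end Local

/-! ### The form with Dirichlet boundary conditions -/

section Dirichlet

variable [TopologicalSpace X] {Ω : Set X} {φ ψ : L2 μ}

lemma mem_compactDomain {C : Set X} [T2Space X] (hφ : φ ∈ E.domain) (hC : IsCompact C)
    (hCΩ : C ⊆ Ω) (h : ∀ᵐ x ∂μ, x ∉ C → φ x = 0) : φ ∈ E.compactDomain Ω :=
  have hs := aeSupport_subset hC.isClosed h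
  ⟨hφ, hC.of_isClosed_subset (isClosed_aeSupport φ) hs, hs.trans hCΩ⟩

lemma toL2_mul_mem_compactDomain [T2Space X] [SigmaFinite μ] {χ : L2 μ}
    (hχ : χ ∈ E.bddDomain) (hψ : ψ ∈ E.bddDomain) {C : Set X}
    (hC : IsCompact C) (hCΩ : C ⊆ Ω) (h : ∀ᵐ x ∂μ, x ∉ C → χ x = 0) :
    toL2 μ (fun x => χ x * ψ x) ∈ E.compactDomain Ω := by
  obtain ⟨hp, hpe⟩ := toL2_mul_spec hχ hψ
  refine mem_compactDomain hp.1 hC hCΩ ?_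
  filter_upwards [hpe, h] with x h1 h2 hx
  rw [h1, h2 hx, zero_mul]

lemma compactDomain_subset_dirichletDomain : E.compactDomain Ω ⊆ E.dirichletDomain Ω :=
  fun φ hφ => ⟨hφ.1, fun ε hε => ⟨φ, hφ, by rwa [sub_self, normSq_zero]⟩⟩

lemma exists_seq_compactDomain (hφ : φ ∈ E.dirichletDomain Ω) :
    ∃ x : ℕ → L2 μ, (∀ n, x n ∈ E.compactDomain Ω) ∧
      Tendsto (fun n => E.normSq (x n - φ)) atTop (𝓝 0) := by
  choose x hx hxφ using fun n : ℕ => hφ.2 (1 / ((n : ℝ) + 1)) (by positivity)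
  refine ⟨x, hx, squeeze_zero (fun _ => normSq_nonneg _) (fun n => ?_)
    tendsto_one_div_add_atTop_nhds_zero_nat⟩
  rw [normSq_sub_comm (hx n).1 hφ.1]
  exact (hxφ n).le

lemma mem_dirichletDomain_of_tendsto {x : ℕ → L2 μ} (hx : ∀ n, x n ∈ E.dirichletDomain Ω)
    (hφ : φ ∈ E.domain) (h : Tendsto (fun n => E.normSq (x n - φ)) atTop (𝓝 0)) :
    φ ∈ E.dirichletDomain Ω := by
  refine ⟨hφ, fun ε hε => ?_⟩
  obtain ⟨n, hn⟩ := (h.eventually (gt_mem_nhds (by positivity : 0 < ε / 4))).exists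
  obtain ⟨ψ, hψ, hψx⟩ := (hx n).2 (ε / 4) (by positivity)
  refine ⟨ψ, hψ, ?_⟩
  have h1 := normSq_sub_le hφ (hx n).1 hψ.1
  rw [normSq_sub_comm hφ (hx n).1] at h1
  linarith

lemma dirichletDomain_subset_L2On [SecondCountableTopology X]
    [OpensMeasurableSpace X] (hΩ : IsOpen Ω) :
    E.dirichletDomain Ω ⊆ (L2On μ Ω : Set (L2 μ)) := fun φ hφ => by
  obtain ⟨x, hx, hxφ⟩ := exists_seq_compactDomain hφ
  refine (isClosed_L2On hΩ.measurableSet).mem_of_tendsto (tendsto_of_normSq hxφ)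
    (Eventually.of_forall fun n => ?_)
  filter_upwards [ae_eq_zero_of_notMem_aeSupport (x n)] with y h1 hy
  exact h1 fun h => hy ((hx n).2.2 h)

variable [T2Space X] [SecondCountableTopology X]

lemma compactDomain_add (hφ : φ ∈ E.compactDomain Ω) (hψ : ψ ∈ E.compactDomain Ω) :
    φ + ψ ∈ E.compactDomain Ω := by
  refine mem_compactDomain (E.domain.add_mem hφ.1 hψ.1) (hφ.2.1.union hψ.2.1)
    (union_subset hφ.2.2 hψ.2.2) ?_
  filter_upwards [ae_eq_zero_of_notMem_aeSupport φ, ae_eq_zero_of_notMem_aeSupport ψ,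
    Lp.coeFn_add φ ψ] with x h1 h2 h3 hx
  rw [mem_union, not_or] at hx
  rw [h3, Pi.add_apply, h1 hx.1, h2 hx.2, add_zero]

lemma compactDomain_smul (c : ℝ) (hφ : φ ∈ E.compactDomain Ω) : c • φ ∈ E.compactDomain Ω := by
  refine mem_compactDomain (E.domain.smul_mem c hφ.1) hφ.2.1 hφ.2.2 ?_
  filter_upwards [ae_eq_zero_of_notMem_aeSupport φ, Lp.coeFn_smul c φ] with x h1 h2 hx
  rw [h2, Pi.smul_apply, h1 hx, smul_zero]

variable (E) in
/-- The domain of the form with Dirichlet boundary conditions, as a subspace of `L₂(X)`. -/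
def dirichletSubmodule (Ω : Set X) : Submodule ℝ (L2 μ) where
  carrier := E.dirichletDomain Ω
  zero_mem' := compactDomain_subset_dirichletDomain
    (mem_compactDomain E.domain.zero_mem isCompact_empty (empty_subset Ω) (by
      filter_upwards [Lp.coeFn_zero ℝ 2 μ] with x hx _
      rw [hx]; rfl))
  add_mem' := by
    intro φ ψ hφ hψ
    obtain ⟨x, hx, hxφ⟩ := exists_seq_compactDomain hφ
    obtain ⟨z, hz, hzψ⟩ := exists_seq_compactDomain hψ
    refine mem_dirichletDomain_of_tendsto (x := fun n => x n + z n)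
      (fun n => compactDomain_subset_dirichletDomain (compactDomain_add (hx n) (hz n)))
      (E.domain.add_mem hφ.1 hψ.1) ?_
    have h1 := (hxφ.const_mul 2).add (hzψ.const_mul 2)
    rw [mul_zero, add_zero] at h1
    refine squeeze_zero (fun _ => normSq_nonneg _) (fun n => ?_) h1
    rw [show x n + z n - (φ + ψ) = (x n - φ) + (z n - ψ) by abel]
    exact normSq_add_le (E.domain.sub_mem (hx n).1 hφ.1) (E.domain.sub_mem (hz n).1 hψ.1)
  smul_mem' := by
    intro c φ hφ
    obtain ⟨x, hx, hxφ⟩ := exists_seq_compactDomain hφ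
    refine mem_dirichletDomain_of_tendsto (x := fun n => c • x n)
      (fun n => compactDomain_subset_dirichletDomain (compactDomain_smul c (hx n)))
      (E.domain.smul_mem c hφ.1) ?_
    have h1 := hxφ.const_mul (c ^ 2)
    rw [mul_zero] at h1
    refine h1.congr fun n => ?_
    rw [← smul_sub, normSq_smul c (E.domain.sub_mem (hx n).1 hφ.1)]

lemma dirichletSubmodule_le : E.dirichletSubmodule Ω ≤ E.domain := fun _ hφ => hφ.1

lemma lowerSemicontinuous_dirichlet : LowerSemicontinuous (E.quadOn (E.dirichletSubmodule Ω)) :=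
  lowerSemicontinuous_quadOn dirichletSubmodule_le fun _ _ hx hu h =>
    mem_dirichletDomain_of_tendsto hx hu h

/-- Lower semicontinuity of the Dirichlet form in the norm of `L₂(X)`. -/
lemma mem_dirichletDomain_of_val_le {x : ℕ → L2 μ} {u : L2 μ} {c : ℝ}
    (hx : Tendsto x atTop (𝓝 u)) (h : ∀ n, x n ∈ E.dirichletDomain Ω ∧ E.val (x n) (x n) ≤ c) :
    u ∈ E.dirichletDomain Ω :=
  (quadOn_ne_top (E := E) (D := E.dirichletSubmodule Ω)).1 <|
    ne_top_of_le_ne_top ENNReal.ofReal_ne_top <|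
      QForm.le_of_tendsto_of_lsc lowerSemicontinuous_dirichlet hx <|
        Eventually.of_forall fun n => by
          rw [quadOn_of_mem (h n).1]; exact ENNReal.ofReal_le_ofReal (h n).2

end Dirichlet

end DirichletForm

namespace DirichletForm

/-! ### The two forms on the Dirichlet domain -/

section Compare

variable {X : Type*} [MetricSpace X] [LocallyCompactSpace X] [SigmaCompactSpace X]
  [MeasurableSpace X] {μ : Measure X} [SigmaFinite μ] {E : DirichletForm μ}
  {Ω : Set X} {χ φ ψ : L2 μ}

/-- A cutoff function that equals one on the support of `ψ` turns the truncated form into `E`. -/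
lemma neumannPart_of_mem_compactDomain (hreg : E.IsRegular) (hloc : E.IsStronglyLocal)
    (hΩ : IsOpen Ω) (hψ : ψ ∈ E.compactDomain Ω) :
    E.neumannPart Ω ψ = ENNReal.ofReal (E.val ψ ψ) := by
  obtain ⟨χ, hχ, h01, ⟨W, -, hKW, hχ1⟩, C, hC, hCΩ, hχ0⟩ := exists_cutoff hreg hψ.2.1 hΩ hψ.2.2
  have hcut : χ ∈ E.cutoffs Ω := ⟨hχ, by
    filter_upwards [h01, hχ0] with x h1 h2
    by_cases hx : x ∈ Ω
    · rw [indicator_of_mem hx]; exact h1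
    · rw [h2 fun h => hx (hCΩ h), indicator_of_notMem hx]; exact ⟨le_rfl, le_rfl⟩⟩
  refine le_antisymm (neumannPart_le hψ.1) ?_
  rw [← trunc_eq_val hloc hχ (cutoffs_nonneg hcut) hψ.1 ?_]
  · exact trunc_le_neumannPart hcut hψ.1
  · filter_upwards [ae_eq_zero_of_notMem_aeSupport ψ, hχ1] with x h1 h2
    by_cases hx : x ∈ aeSupport ψ
    · exact Or.inr (h2 (hKW hx))
    · exact Or.inl (h1 hx)

/-- On the domain of the form with Dirichlet boundary conditions, the form with Neumann boundary
conditions (before relaxation) is the original form. -/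
lemma neumannPart_of_mem_dirichletDomain (hreg : E.IsRegular) (hloc : E.IsStronglyLocal)
    (hΩ : IsOpen Ω) (hψ : ψ ∈ E.dirichletDomain Ω) :
    E.neumannPart Ω ψ = ENNReal.ofReal (E.val ψ ψ) := by
  have hq := isQuad_neumannPart (E := E) (Ω := Ω)
  have ht : ∀ {η}, η ∈ E.domain → E.neumannPart Ω η ≠ ∞ := fun hη =>
    ne_top_of_le_ne_top ENNReal.ofReal_ne_top (neumannPart_le hη)
  obtain ⟨x, hx, hxψ⟩ := exists_seq_compactDomain hψ
  have h1 : Tendsto (fun n => (E.neumannPart Ω (x n)).toReal) atTop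
      (𝓝 (E.neumannPart Ω ψ).toReal) := by
    refine hq.tendsto_toReal (fun n => ht (hx n).1) (ht hψ.1)
      (squeeze_zero (fun _ => ENNReal.toReal_nonneg) (fun n => ?_) hxψ)
    refine (ENNReal.toReal_le_of_le_ofReal (val_self_nonneg _)
      (neumannPart_le (E.domain.sub_mem (hx n).1 hψ.1))).trans (val_le_normSq _)
  have h2 : (E.neumannPart Ω ψ).toReal = E.val ψ ψ :=
    tendsto_nhds_unique h1 ((tendsto_val_self hψ.1 (fun n => (hx n).1) hxψ).congr fun n => by
      rw [neumannPart_of_mem_compactDomain hreg hloc hΩ (hx n),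
        ENNReal.toReal_ofReal (val_self_nonneg _)])
  rw [← h2, ENNReal.ofReal_toReal (ht hψ.1)]

variable [BorelSpace X]

/-- If the restriction of `ψ` to `Ω` satisfies the Dirichlet boundary conditions, then the Neumann
form of `ψ` is the form of this restriction. -/
lemma neumannPart_eq_val_restrictL2 (hreg : E.IsRegular) (hloc : E.IsStronglyLocal)
    (hΩ : IsOpen Ω) (hψ : ψ ∈ E.domain)
    (hr : restrictL2 μ hΩ.measurableSet ψ ∈ E.dirichletDomain Ω) :
    E.neumannPart Ω ψ = ENNReal.ofReal
      (E.val (restrictL2 μ hΩ.measurableSet ψ) (restrictL2 μ hΩ.measurableSet ψ)) := by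
  rw [← neumannPart_of_mem_dirichletDomain hreg hloc hΩ hr]
  refine neumannPart_congr hloc hψ hr.1 ?_
  filter_upwards [restrictL2_ae hΩ.measurableSet ψ] with x hx hxΩ
  rw [hx, indicator_of_mem hxΩ]

lemma val_restrictL2_le (hreg : E.IsRegular) (hloc : E.IsStronglyLocal)
    (hΩ : IsOpen Ω) (hψ : ψ ∈ E.domain)
    (hr : restrictL2 μ hΩ.measurableSet ψ ∈ E.dirichletDomain Ω) :
    E.val (restrictL2 μ hΩ.measurableSet ψ) (restrictL2 μ hΩ.measurableSet ψ) ≤ E.val ψ ψ := by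
  have h := neumannPart_le (Ω := Ω) hψ
  rwa [neumannPart_eq_val_restrictL2 hreg hloc hΩ hψ hr,
    ENNReal.ofReal_le_ofReal_iff (val_self_nonneg _)] at h

/-! ### The form with Dirichlet boundary conditions is closed and densely defined -/

/-- Elements of `D(E)` with compact support in `Ω` are dense in `L₂(Ω)`: for `f ∈ D(E) ∩ L_∞(X)` the
restriction to `Ω` is the limit of products of `f` with cutoff functions along an exhaustion of `Ω`
by compact sets. -/
lemma restrictL2_mem_closure_compactDomain (hreg : E.IsRegular) (hΩ : IsOpen Ω) (f : L2 μ) :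
    restrictL2 μ hΩ.measurableSet f ∈ closure (E.compactDomain Ω) := by
  have hcl : IsClosed {f : L2 μ |
      restrictL2 μ hΩ.measurableSet f ∈ closure (E.compactDomain Ω)} :=
    isClosed_closure.preimage (restrictL2 μ hΩ.measurableSet).continuous
  refine hcl.closure_subset_iff.2 (fun ψ hψ => ?_) (dense_bddDomain (E := E) f)
  obtain ⟨F, hF, hFΩ, hFU, hFm⟩ := hΩ.exists_iUnion_isClosed
  choose χ hχ h01 hW hC using fun k : ℕ =>
    exists_cutoff hreg ((isCompact_compactCovering X k).inter_left (hF k)) hΩ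
      (inter_subset_left.trans (hFΩ k))
  choose W _ hKW hχ1 using hW
  choose C hC hCΩ hχ0 using hC
  have hp := fun k => toL2_mul_spec (hχ k) hψ
  refine mem_closure_of_tendsto (f := fun k => toL2 μ (fun x => χ k x * ψ x))
    (tendsto_L2_of_dominated (g := ψ) (fun k => ?_) ?_) (b := atTop)
    (Eventually.of_forall fun k => toL2_mul_mem_compactDomain (hχ k) hψ (hC k) (hCΩ k) (hχ0 k))
  · filter_upwards [(hp k).2, h01 k] with x h1 h2
    rw [h1, abs_mul, abs_of_nonneg h2.1]
    exact mul_le_of_le_one_left (abs_nonneg _) h2.2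
  · filter_upwards [ae_all_iff.2 fun k => (hp k).2, ae_all_iff.2 hχ0,
      ae_all_iff.2 hχ1, restrictL2_ae hΩ.measurableSet ψ] with x h1 h2 h3 h4
    rw [h4]
    refine tendsto_const_nhds.congr' ?_
    by_cases hx : x ∈ Ω
    · obtain ⟨k₁, hk₁⟩ := mem_iUnion.1 (hFU.symm ▸ hx : x ∈ ⋃ n, F n)
      obtain ⟨k₂, hk₂⟩ := exists_mem_compactCovering x
      filter_upwards [eventually_ge_atTop k₁, eventually_ge_atTop k₂] with k hk hk'
      rw [indicator_of_mem hx, h1,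
        h3 k (hKW k ⟨hFm hk hk₁, compactCovering_subset X hk' hk₂⟩), one_mul]
    · refine Eventually.of_forall fun k => ?_
      rw [indicator_of_notMem hx]
      change (0 : ℝ) = toL2 μ (fun x => χ k x * ψ x) x
      rw [h1, h2 k fun h => hx (hCΩ k h), zero_mul]

lemma isClosedForm_dirichletPart (hreg : E.IsRegular) (hΩ : IsOpen Ω) :
    QForm.IsClosedForm (E.dirichletPart Ω) where
  parallelogram_le u v :=
    (isQuad_quadOn (E := E) (D := E.dirichletSubmodule Ω) dirichletSubmodule_le).parallelogram_le
      (u : L2 μ) v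
  map_smul c u :=
    (isQuad_quadOn (E := E) (D := E.dirichletSubmodule Ω) dirichletSubmodule_le).map_smul
      c (u : L2 μ)
  lsc := (lowerSemicontinuous_dirichlet (E := E) (Ω := Ω)).comp continuous_subtype_val
  dense := fun f => by
    rw [closure_subtype]
    have h := restrictL2_mem_closure_compactDomain hreg hΩ (f : L2 μ)
    rw [restrictL2_of_mem hΩ.measurableSet f.2] at h
    refine closure_mono (fun ψ hψ => ?_) h
    have hψ' := compactDomain_subset_dirichletDomain hψ
    exact ⟨⟨ψ, dirichletDomain_subset_L2On hΩ hψ'⟩,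
      (quadOn_ne_top (D := E.dirichletSubmodule Ω)).2 hψ', rfl⟩

end Compare

end DirichletForm

namespace DirichletForm

/-! ### Sets of capacity zero -/

section Capacity

variable {X : Type*} [MeasurableSpace X] {μ : Measure X} {E : DirichletForm μ}
  {Ω : Set X} {φ ψ : L2 μ}

lemma clip_mem_and_normSq_le (hφ : φ ∈ E.domain) {a : ℝ} (ha : 0 < a)
    (hψ : ∀ᵐ x ∂μ, ψ x = max 0 (min (φ x) a)) : ψ ∈ E.domain ∧ E.normSq ψ ≤ E.normSq φ := by
  have h := clip_mem_and_val_le hφ ha hψ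
  refine ⟨h.1, add_le_add (pow_le_pow_left₀ (norm_nonneg _) (Lp.norm_le_norm_of_ae_le ?_) 2) h.2⟩
  filter_upwards [hψ] with x hx
  rw [hx, Real.norm_eq_abs, Real.norm_eq_abs, abs_of_nonneg (le_max_left _ _)]
  exact max_le (abs_nonneg _) ((min_le_left _ _).trans (le_abs_self _))

variable [TopologicalSpace X]

lemma relCap_le {A V : Set X} (hφ : φ ∈ E.domain) (hV : IsOpen V) (hAV : A ⊆ V)
    (h : ∀ᵐ x ∂μ, x ∈ V ∩ Ω → 1 ≤ φ x) : E.relCap Ω A ≤ ENNReal.ofReal (E.normSq φ) :=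
  iInf₂_le φ ⟨hφ, V, hV, hAV, h⟩

/-- A set of capacity zero admits test functions of small norm with values in `[0, 1]`. -/
lemma exists_of_relCap_eq_zero {A : Set X} (hA : E.relCap Ω A = 0) {ε : ℝ} (hε : 0 < ε) :
    ∃ φ ∈ E.domain, E.normSq φ < ε ∧ (∀ᵐ x ∂μ, 0 ≤ φ x ∧ φ x ≤ 1) ∧
      ∃ V, IsOpen V ∧ A ⊆ V ∧ ∀ᵐ x ∂μ, x ∈ V ∩ Ω → φ x = 1 := by
  have h : E.relCap Ω A < ENNReal.ofReal ε := by rw [hA]; exact ENNReal.ofReal_pos.2 hε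
  obtain ⟨φ, h⟩ := iInf_lt_iff.1 h
  obtain ⟨⟨hφ, V, hV, hAV, h1⟩, hlt⟩ := iInf_lt_iff.1 h
  obtain ⟨ψ, hψ⟩ := exists_clip φ 1
  have hc := clip_mem_and_normSq_le hφ one_pos hψ
  refine ⟨ψ, hc.1, hc.2.trans_lt ((ENNReal.ofReal_lt_ofReal_iff hε).1 hlt), ?_, V, hV, hAV, ?_⟩
  · filter_upwards [hψ] with x hx
    rw [hx]
    exact ⟨le_max_left _ _, max_le zero_le_one (min_le_right _ _)⟩
  · filter_upwards [hψ, h1] with x hx h1 hxV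
    rw [hx, min_eq_right (h1 hxV), max_eq_right zero_le_one]

end Capacity

/-! ### Capacity zero and restrictions -/

section Restriction

variable {X : Type*} [MetricSpace X] [LocallyCompactSpace X] [SigmaCompactSpace X]
  [MeasurableSpace X] [BorelSpace X] {μ : Measure X} [SigmaFinite μ] {E : DirichletForm μ}
  {Ω : Set X} {φ ψ : L2 μ}

/-- If `u` vanishes off a compact set and near the boundary of `Ω`, then the restriction of `u` to
`Ω` has compact support in `Ω`. -/
lemma restrictL2_mem_compactDomain (hreg : E.IsRegular) (hΩ : IsOpen Ω) {u : L2 μ}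
    (hu : u ∈ E.bddDomain) {C V : Set X} (hC : IsCompact C) (huC : ∀ᵐ x ∂μ, x ∉ C → u x = 0)
    (hV : IsOpen V) (hΩV : frontier Ω ⊆ V) (huV : ∀ᵐ x ∂μ, x ∈ V ∩ Ω → u x = 0) :
    restrictL2 μ hΩ.measurableSet u ∈ E.compactDomain Ω := by
  have hK : IsCompact (C ∩ (closure Ω ∩ Vᶜ)) :=
    hC.inter_right (isClosed_closure.inter hV.isClosed_compl)
  have hKΩ : C ∩ (closure Ω ∩ Vᶜ) ⊆ Ω := fun x hx => by
    by_contra hxΩ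
    exact hx.2.2 (hΩV (by rw [hΩ.frontier_eq]; exact ⟨hx.2.1, hxΩ⟩))
  obtain ⟨χ, hχ, -, ⟨W, -, hKW, hχ1⟩, C', hC', hCΩ', hχ0⟩ := exists_cutoff hreg hK hΩ hKΩ
  have hw := toL2_mul_mem_compactDomain hχ hu hC' hCΩ' hχ0
  suffices h : restrictL2 μ hΩ.measurableSet u = toL2 μ (fun x => χ x * u x) by rwa [h]
  refine restrictL2_eq hΩ.measurableSet
    (dirichletDomain_subset_L2On hΩ (compactDomain_subset_dirichletDomain hw)) ?_
  filter_upwards [(toL2_mul_spec hχ hu).2, huC, huV, hχ1] with x h1 h2 h3 h4 hx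
  rw [h1]
  by_cases hxC : x ∈ C
  · by_cases hxV : x ∈ V
    · rw [h3 ⟨hxV, hx⟩, mul_zero]
    · rw [h4 (hKW ⟨hxC, subset_closure hx, hxV⟩), one_mul]
  · rw [h2 hxC, mul_zero]

lemma restrictL2_mem_dirichletDomain_of_bdd (hreg : E.IsRegular) (hloc : E.IsStronglyLocal)
    (hΩ : IsOpen Ω) (hcap : E.relCap Ω (frontier Ω) = 0) (hψ : ψ ∈ E.bddDomain) {C : Set X}
    (hC : IsCompact C) (hψC : ∀ᵐ x ∂μ, x ∉ C → ψ x = 0) :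
    restrictL2 μ hΩ.measurableSet ψ ∈ E.dirichletDomain Ω := by
  obtain ⟨M₀, -, hM₀⟩ := (mem_bddDomain.1 hψ).2
  obtain ⟨M, hM1, hM⟩ : ∃ M : ℝ, 1 ≤ M ∧ ∀ᵐ x ∂μ, |ψ x| ≤ M :=
    ⟨max M₀ 1, le_max_right _ _, by filter_upwards [hM₀] with x hx using hx.trans (le_max_left _ _)⟩
  have hM0 : 0 < M := by linarith
  choose φ hφ hφn h01 hV using fun n : ℕ =>
    exists_of_relCap_eq_zero hcap (ε := 1 / ((n : ℝ) + 1)) (by positivity)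
  choose V hVo hΩV hφ1 using hV
  have hφabs : ∀ n, ∀ᵐ x ∂μ, |φ n x| ≤ 1 := fun n => by
    filter_upwards [h01 n] with x hx
    rw [abs_of_nonneg hx.1]; exact hx.2
  have hφb : ∀ n, φ n ∈ E.bddDomain := fun n => mem_bddDomain.2 ⟨hφ n, 1, one_pos, hφabs n⟩
  have hφ0 : Tendsto (fun n => ‖φ n‖) atTop (𝓝 0) := by
    have h : Tendsto (fun n => E.normSq (φ n - 0)) atTop (𝓝 0) :=
      squeeze_zero (fun _ => normSq_nonneg _) (fun n => by rw [sub_zero]; exact (hφn n).le)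
        tendsto_one_div_add_atTop_nhds_zero_nat
    simpa using (tendsto_of_normSq h).norm
  -- the products `ψ φ n` are bounded in `D(E)` and tend to zero in `L₂(X)`
  let p : ℕ → L2 μ := fun n => toL2 μ (fun x => ψ x * φ n x)
  have hp : ∀ n, p n ∈ E.bddDomain ∧ ∀ᵐ x ∂μ, p n x = ψ x * φ n x := fun n =>
    toL2_mul_spec hψ (hφb n)
  have hpv : ∀ n, E.val (p n) (p n) ≤ 4 * M ^ 2 * (E.val ψ ψ + 1) := fun n => by
    refine (mul_mem_and_val_le hψ.1 (hφ n) hM0 hM ?_ (hp n).2).2.trans ?_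
    · filter_upwards [hφabs n] with x hx using hx.trans hM1
    · have h1 : E.val (φ n) (φ n) ≤ 1 := (val_le_normSq _).trans <| (hφn n).le.trans <| by
        rw [div_le_one (by positivity)]
        linarith [(Nat.cast_nonneg n : (0 : ℝ) ≤ n)]
      exact mul_le_mul_of_nonneg_left (by linarith) (by positivity)
  have hp0 : Tendsto p atTop (𝓝 0) := by
    rw [tendsto_zero_iff_norm_tendsto_zero]
    refine squeeze_zero (fun _ => norm_nonneg _) (fun n => ?_)
      (by simpa using hφ0.const_mul M : Tendsto (fun n => M * ‖φ n‖) atTop (𝓝 0))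
    refine Lp.norm_le_mul_norm_of_ae_le_mul ?_
    filter_upwards [(hp n).2, hM] with x h1 h2
    rw [h1, norm_mul]
    exact mul_le_mul_of_nonneg_right h2 (norm_nonneg _)
  have hu : ∀ n, ψ - p n ∈ E.bddDomain := fun n => E.bddDomain.sub_mem hψ (hp n).1
  have huv : ∀ n, E.val (ψ - p n) (ψ - p n) ≤
      2 * E.val ψ ψ + 2 * (4 * M ^ 2 * (E.val ψ ψ + 1)) := fun n => by
    have h1 := val_parallelogram hψ.1 (hp n).1.1
    have h2 := val_self_nonneg (E := E) (ψ + p n)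
    linarith [hpv n]
  have hr : ∀ n, restrictL2 μ hΩ.measurableSet (ψ - p n) ∈ E.dirichletDomain Ω := fun n => by
    refine compactDomain_subset_dirichletDomain
      (restrictL2_mem_compactDomain hreg hΩ (hu n) hC ?_ (hVo n) (hΩV n) ?_)
    · filter_upwards [hψC, (hp n).2, Lp.coeFn_sub ψ (p n)] with x h1 h2 h3 hx
      rw [h3, Pi.sub_apply, h2, h1 hx, zero_mul, sub_zero]
    · filter_upwards [hφ1 n, (hp n).2, Lp.coeFn_sub ψ (p n)] with x h1 h2 h3 hx
      rw [h3, Pi.sub_apply, h2, h1 hx, mul_one, sub_self]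
  refine mem_dirichletDomain_of_val_le (x := fun n => restrictL2 μ hΩ.measurableSet (ψ - p n)) ?_
    fun n => ⟨hr n, (val_restrictL2_le hreg hloc hΩ (hu n).1 (hr n)).trans (huv n)⟩
  have h := (restrictL2 μ hΩ.measurableSet).continuous.tendsto (ψ - 0)
  rw [sub_zero] at h
  refine h.comp ?_
  simpa using tendsto_const_nhds.sub hp0

/-- If the boundary of `Ω` has capacity zero, then restricting an element of `D(E)` to `Ω` yields
an element satisfying the Dirichlet boundary conditions. -/
theorem restrictL2_mem_dirichletDomain (hreg : E.IsRegular) (hloc : E.IsStronglyLocal)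
    (hΩ : IsOpen Ω) (hcap : E.relCap Ω (frontier Ω) = 0) (hψ : ψ ∈ E.domain) :
    restrictL2 μ hΩ.measurableSet ψ ∈ E.dirichletDomain Ω := by
  choose x hx hxc hxψ using fun n : ℕ => hreg.1 ψ hψ (1 / ((n : ℝ) + 1)) (by positivity)
  have hlim : Tendsto (fun n => E.normSq (x n - ψ)) atTop (𝓝 0) :=
    squeeze_zero (fun _ => normSq_nonneg _)
      (fun n => by rw [normSq_sub_comm (hx n) hψ]; exact (hxψ n).le)
      tendsto_one_div_add_atTop_nhds_zero_nat
  have hr : ∀ n, restrictL2 μ hΩ.measurableSet (x n) ∈ E.dirichletDomain Ω := fun n => by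
    obtain ⟨g, hg, hgc, hgx⟩ := hxc n
    obtain ⟨B, hB⟩ := hgc.exists_bound_of_continuous hg
    refine restrictL2_mem_dirichletDomain_of_bdd hreg hloc hΩ hcap
      (mem_bddDomain.2 ⟨hx n, max B 1, lt_max_of_lt_right one_pos, ?_⟩) hgc ?_
    · filter_upwards [hgx] with y hy
      rw [hy]
      exact (hB y).trans (le_max_left _ _)
    · filter_upwards [hgx] with y hy hyc
      rw [hy, image_eq_zero_of_notMem_tsupport hyc]
  obtain ⟨c, hc⟩ := (tendsto_val_self hψ hx hlim).bddAbove_range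
  exact mem_dirichletDomain_of_val_le
    (((restrictL2 μ hΩ.measurableSet).continuous.tendsto ψ).comp (tendsto_of_normSq hlim))
    fun n => ⟨hr n, (val_restrictL2_le hreg hloc hΩ (hx n) (hr n)).trans (hc (mem_range_self n))⟩

end Restriction

/-! ### Restrictions and semigroups -/

section Semigroup

variable {X : Type*} [MetricSpace X] [LocallyCompactSpace X] [SigmaCompactSpace X]
  [MeasurableSpace X] [BorelSpace X] {μ : Measure X} [SigmaFinite μ] {E : DirichletForm μ}
  {Ω : Set X}

/-- If restrictions to `Ω` satisfy the Dirichlet boundary conditions, then the relaxed Neumann form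
is the Dirichlet form composed with restriction to `Ω`. -/
lemma relaxation_neumannPart_eq (hreg : E.IsRegular) (hloc : E.IsStronglyLocal) (hΩ : IsOpen Ω)
    (hr : ∀ ψ ∈ E.domain, restrictL2 μ hΩ.measurableSet ψ ∈ E.dirichletDomain Ω) (u : L2 μ) :
    QForm.relaxation (E.neumannPart Ω) u =
      E.quadOn (E.dirichletSubmodule Ω) (restrictL2 μ hΩ.measurableSet u) := by
  have hN : ∀ ψ ∈ E.domain, E.neumannPart Ω ψ =
      E.quadOn (E.dirichletSubmodule Ω) (restrictL2 μ hΩ.measurableSet ψ) := fun ψ hψ => by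
    rw [neumannPart_eq_val_restrictL2 hreg hloc hΩ hψ (hr ψ hψ), quadOn_of_mem (hr ψ hψ)]
  apply le_antisymm
  · by_cases hu : restrictL2 μ hΩ.measurableSet u ∈ E.dirichletSubmodule Ω
    · -- the part of `u` off `Ω` is approximated by differences `x n - restrictL2 (x n)`, which are
      -- in `D(E)` and on which the Neumann form vanishes
      obtain ⟨x, hx, hxu⟩ := mem_closure_iff_seq_limit.1
        (E.dense_domain (u - restrictL2 μ hΩ.measurableSet u))
      refine QForm.relaxation_le_of_tendsto (x := fun n => x n -
        restrictL2 μ hΩ.measurableSet (x n) + restrictL2 μ hΩ.measurableSet u) ?_ fun n => ?_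
      · have h := (hxu.sub (((restrictL2 μ hΩ.measurableSet).continuous.tendsto _).comp
          hxu)).add_const (restrictL2 μ hΩ.measurableSet u)
        rwa [map_sub, restrictL2_restrictL2, sub_self, sub_zero, sub_add_cancel] at h
      · rw [hN _ (E.domain.add_mem (E.domain.sub_mem (hx n) (hr _ (hx n)).1) hu.1), map_add,
          map_sub, restrictL2_restrictL2, restrictL2_restrictL2, sub_self, zero_add]
    · rw [not_ne_iff.1 (quadOn_ne_top.not.2 hu)]
      exact le_top
  · refine QForm.le_relaxation (p := fun v => E.quadOn (E.dirichletSubmodule Ω)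
      (restrictL2 μ hΩ.measurableSet v)) ?_ (fun v => ?_) u
    · exact lowerSemicontinuous_dirichlet.comp (restrictL2 μ hΩ.measurableSet).continuous
    · by_cases hv : v ∈ E.domain
      · exact (hN v hv).ge
      · rw [neumannPart_of_notMem hv]
        exact le_top

theorem semigroup_eq_of_restrictL2_mem (hreg : E.IsRegular) (hloc : E.IsStronglyLocal)
    (hΩ : IsOpen Ω)
    (hr : ∀ ψ ∈ E.domain, restrictL2 μ hΩ.measurableSet ψ ∈ E.dirichletDomain Ω)
    (φ : L2On μ Ω) {t : ℝ} (ht : 0 < t) :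
    (E.dirichletSemigroup Ω t φ : L2 μ) = E.neumannSemigroup Ω t (φ : L2 μ) := by
  have : CompleteSpace (L2On μ Ω) := (isClosed_L2On hΩ.measurableSet).completeSpace_coe
  have hD := isClosedForm_dirichletPart (E := E) hreg hΩ
  have hN := isClosedForm_relaxation_neumannPart (E := E) (Ω := Ω)
  have hrel := relaxation_neumannPart_eq hreg hloc hΩ hr
  refine QForm.semigroup_eq_of_resolvent_eq hD hN (fun n f hn => ?_) ht.le φ
  have hn' : (0 : ℝ) < n := Nat.cast_pos.2 hn
  set v := QForm.formResolvent (E.dirichletPart Ω) (n : ℝ) f with hv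
  have hvr : restrictL2 μ hΩ.measurableSet (v : L2 μ) = v := restrictL2_of_mem _ v.2
  refine (hN.resolvent_unique hn' ⟨?_, fun w hw => ?_⟩).symm
  · rw [hrel, hvr]
    exact hD.resolvent_ne_top hn' f
  · rw [hrel] at hw
    let w' : L2On μ Ω := ⟨restrictL2 μ hΩ.measurableSet w, restrictL2_mem _ w⟩
    have h := hD.polar_resolvent hn' f (v := w') hw
    have h1 : QForm.polar (QForm.relaxation (E.neumannPart Ω)) (v : L2 μ) w =
        QForm.polar (E.dirichletPart Ω) v w' := by
      rw [QForm.polar, hrel, hrel, map_add, map_sub, hvr]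
      rfl
    rw [h1, h]
    exact inner_restrictL2 hΩ.measurableSet (f - (n : ℝ) • v).2 w

/-- The semigroups determine the resolvents and hence the forms, so that equality of the semigroups
on `L₂(Ω)` forces restrictions to satisfy the Dirichlet boundary conditions. -/
theorem restrictL2_mem_of_semigroup_eq (hreg : E.IsRegular) (hΩ : IsOpen Ω)
    (h : ∀ φ : L2On μ Ω, ∀ t : ℝ, 0 < t →
      (E.dirichletSemigroup Ω t φ : L2 μ) = E.neumannSemigroup Ω t (φ : L2 μ))
    {ψ : L2 μ} (hψ : ψ ∈ E.domain) :
    restrictL2 μ hΩ.measurableSet ψ ∈ E.dirichletDomain Ω := by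
  have : CompleteSpace (L2On μ Ω) := (isClosed_L2On hΩ.measurableSet).completeSpace_coe
  have hD := isClosedForm_dirichletPart (E := E) hreg hΩ
  have hN := isClosedForm_relaxation_neumannPart (E := E) (Ω := Ω)
  have h1 := QForm.ne_top_of_resolvent_eq hD hN
    (fun n f hn => QForm.resolvent_eq_of_semigroup_eq hD hN h (Nat.cast_pos.2 hn) f)
    (u := ψ) (p := ⟨restrictL2 μ hΩ.measurableSet ψ, restrictL2_mem _ ψ⟩)
    (fun w => inner_sub_restrictL2 hΩ.measurableSet w.2 ψ)
    (ne_top_of_le_ne_top ENNReal.ofReal_ne_top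
      ((QForm.relaxation_le _ _).trans (neumannPart_le hψ)))
  exact (quadOn_ne_top (D := E.dirichletSubmodule Ω)).1 h1

end Semigroup

end DirichletForm

namespace DirichletForm

/-! ### Countable unions of sets of capacity zero -/

section Union

variable {X : Type*} [MeasurableSpace X] {μ : Measure X} {E : DirichletForm μ} {Ω : Set X}

/-- A substitute for the triangle inequality, from `(a + b)² ≤ 2 a² + 2 b²`. -/
lemma normSq_sum_le (n : ℕ) {a : ℕ → L2 μ} (ha : ∀ j, a j ∈ E.domain) :
    E.normSq (∑ j ∈ Finset.range n, a j) ≤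
      ∑ j ∈ Finset.range n, 2 ^ (j + 1) * E.normSq (a j) := by
  induction n generalizing a with
  | zero => simp [normSq_zero]
  | succ n ih =>
    rw [Finset.sum_range_succ', Finset.sum_range_succ']
    refine (normSq_add_le (E.domain.sum_mem fun j _ => ha (j + 1)) (ha 0)).trans ?_
    have h := ih (a := fun j => a (j + 1)) fun j => ha (j + 1)
    have h1 : ∑ j ∈ Finset.range n, 2 ^ (j + 1 + 1) * E.normSq (a (j + 1)) =
        2 * ∑ j ∈ Finset.range n, 2 ^ (j + 1) * E.normSq (a (j + 1)) := by
      rw [Finset.mul_sum]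
      exact Finset.sum_congr rfl fun j _ => by ring
    rw [h1, zero_add, pow_one]
    linarith

lemma sum_half_pow (n : ℕ) : ∑ j ∈ Finset.range n, (1 / 2 : ℝ) ^ (j + 1) = 1 - (1 / 2) ^ n := by
  induction n with
  | zero => simp
  | succ n ih => rw [Finset.sum_range_succ, ih]; ring

/-- The sum of nonnegative test functions for the sets `A j` is a test function for their union. -/
lemma relCap_iUnion_eq_zero [TopologicalSpace X] {A : ℕ → Set X}
    (hA : ∀ j, E.relCap Ω (A j) = 0) : E.relCap Ω (⋃ j, A j) = 0 := by
  refine le_antisymm (le_of_forall_gt fun d hd => ?_) zero_le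
  obtain ⟨c, hc0, hcd⟩ : ∃ c : ℝ, 0 < c ∧ ENNReal.ofReal (2 * c ^ 2) < d := by
    have h : Tendsto (fun c : ℝ => ENNReal.ofReal (2 * c ^ 2)) (𝓝[>] 0) (𝓝 0) := by
      have h1 : Continuous fun c : ℝ => ENNReal.ofReal (2 * c ^ 2) :=
        ENNReal.continuous_ofReal.comp (by fun_prop)
      simpa using (h1.tendsto 0).mono_left nhdsWithin_le_nhds
    exact ((eventually_mem_nhdsWithin).and (h.eventually (gt_mem_nhds hd))).exists
  -- the weights `2 ^ (j + 1)` from `normSq_sum_le` are outweighed by squared norms of order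
  -- `4 ^ (-j)`
  choose φ hφ hφn h01 V hV using fun j =>
    exists_of_relCap_eq_zero (hA j) (ε := (c * (1 / 2) ^ (j + 1)) ^ 2) (by positivity)
  have hnorm : ∀ j, ‖φ j‖ ≤ c * (1 / 2) ^ (j + 1) := fun j =>
    (sq_le_sq₀ (norm_nonneg _) (by positivity)).1 ((norm_sq_le_normSq _).trans (hφn j).le)
  have hgeom : ∀ n, ∑ j ∈ Finset.range n, c * (1 / 2 : ℝ) ^ (j + 1) ≤ c := fun n => by
    rw [← Finset.mul_sum, sum_half_pow]
    exact mul_le_of_le_one_right hc0.le (by linarith [pow_nonneg (by norm_num : (0 : ℝ) ≤ 1 / 2) n])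
  have hsum : Summable φ := by
    refine Summable.of_norm_bounded (g := fun j => c * (1 / 2 : ℝ) ^ (j + 1)) ?_ hnorm
    exact summable_of_sum_range_le (fun j => by positivity) hgeom
  obtain ⟨s, hs⟩ := hsum
  have hlim := hs.tendsto_sum_nat
  have hpart : ∀ n, E.normSq (∑ j ∈ Finset.range n, φ j) ≤ c ^ 2 := fun n => by
    refine (normSq_sum_le n hφ).trans ?_
    calc ∑ j ∈ Finset.range n, 2 ^ (j + 1) * E.normSq (φ j)
        ≤ ∑ j ∈ Finset.range n, c * (c * (1 / 2 : ℝ) ^ (j + 1)) := by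
          refine Finset.sum_le_sum fun j _ => ?_
          refine (mul_le_mul_of_nonneg_left (hφn j).le (by positivity)).trans_eq ?_
          have : (2 : ℝ) ^ (j + 1) * (1 / 2) ^ (j + 1) = 1 := by
            rw [← mul_pow]; norm_num
          linear_combination c ^ 2 * (1 / 2) ^ (j + 1) * this
      _ ≤ c * c := by
          rw [← Finset.mul_sum]
          exact mul_le_mul_of_nonneg_left (hgeom n) hc0.le
      _ = c ^ 2 := by ring
  have hval := mem_and_val_le_of_tendsto hlim fun n =>
    ⟨E.domain.sum_mem fun j _ => hφ j, (val_le_normSq _).trans (hpart n)⟩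
  have hsn : ‖s‖ ^ 2 ≤ c ^ 2 := le_of_tendsto' (hlim.norm.pow 2) fun n =>
    (norm_sq_le_normSq _).trans (hpart n)
  have hle : ∀ j, ∀ᵐ x ∂μ, φ j x ≤ s x := fun j => by
    refine ae_le_of_tendsto_L2 hlim ?_
    filter_upwards [eventually_gt_atTop j] with n hn
    refine (Lp.coeFn_le _ _).2 (Finset.single_le_sum (f := φ) (fun i _ => ?_)
      (Finset.mem_range.2 hn))
    exact (Lp.coeFn_nonneg _).1 (by filter_upwards [h01 i] with x hx using hx.1)
  refine (relCap_le hval.1 (isOpen_iUnion fun j => (hV j).1)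
    (iUnion_mono fun j => (hV j).2.1) ?_).trans_lt
    ((ENNReal.ofReal_le_ofReal ?_).trans_lt hcd)
  · filter_upwards [ae_all_iff.2 hle, ae_all_iff.2 fun j => (hV j).2.2] with x h1 h2 hx
    obtain ⟨j, hj⟩ := mem_iUnion.1 hx.1
    exact (h2 j ⟨hj, hx.2⟩).ge.trans (h1 j)
  · rw [normSq]
    linarith [hval.2]

end Union

/-! ### The capacity of the boundary -/

section Boundary

variable {X : Type*} [MetricSpace X] [LocallyCompactSpace X] [SigmaCompactSpace X]
  [MeasurableSpace X] [BorelSpace X] {μ : Measure X} {E : DirichletForm μ} {Ω : Set X}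

/-- Near a compact set `K` off `Ω`, the restriction of a cutoff function for `K` equals one on `Ω`,
whereas the elements of `D(E)` with compact support in `Ω` vanish; differences of the two are
test functions for the capacity of `K`. -/
lemma relCap_eq_zero_of_isCompact (hreg : E.IsRegular) (hΩ : IsOpen Ω)
    (hr : ∀ ψ ∈ E.domain, restrictL2 μ hΩ.measurableSet ψ ∈ E.dirichletDomain Ω)
    {K : Set X} (hK : IsCompact K) (hKΩ : Disjoint K Ω) : E.relCap Ω K = 0 := by
  obtain ⟨ψ, hψ, -, ⟨W, hW, hKW, hψ1⟩, -⟩ := exists_cutoff hreg hK isOpen_univ (subset_univ K)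
  have hrψ := hr ψ hψ.1
  refine le_antisymm (le_of_forall_gt fun d hd => ?_) zero_le
  obtain ⟨ε, hε, hεd⟩ := ENNReal.lt_iff_exists_nnreal_btwn.1 hd
  have hε0 : 0 < (ε : ℝ) := NNReal.coe_pos.2 (ENNReal.coe_pos.1 hε)
  obtain ⟨θ, hθ, hlt⟩ := hrψ.2 ε hε0
  refine (relCap_le (V := W ∩ (aeSupport θ)ᶜ) (E.domain.sub_mem hrψ.1 hθ.1)
    (hW.inter (isClosed_aeSupport θ).isOpen_compl)
    (subset_inter hKW fun x hx hxθ => hKΩ.notMem_of_mem_left hx (hθ.2.2 hxθ)) ?_).trans_lt ?_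
  · filter_upwards [restrictL2_ae hΩ.measurableSet ψ, hψ1, ae_eq_zero_of_notMem_aeSupport θ,
      Lp.coeFn_sub (restrictL2 μ hΩ.measurableSet ψ) θ] with x h1 h2 h3 h4 hx
    rw [h4, Pi.sub_apply, h1, indicator_of_mem hx.2, h2 hx.1.1, h3 hx.1.2, sub_zero]
  · refine lt_of_le_of_lt (ENNReal.ofReal_le_ofReal hlt.le) ?_
    rwa [ENNReal.ofReal_coe_nnreal]

theorem relCap_frontier_eq_zero (hreg : E.IsRegular) (hΩ : IsOpen Ω)
    (hr : ∀ ψ ∈ E.domain, restrictL2 μ hΩ.measurableSet ψ ∈ E.dirichletDomain Ω) :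
    E.relCap Ω (frontier Ω) = 0 := by
  rw [← inter_univ (frontier Ω), ← iUnion_compactCovering X, inter_iUnion]
  refine relCap_iUnion_eq_zero fun j => relCap_eq_zero_of_isCompact hreg hΩ hr
    ((isCompact_compactCovering X j).inter_left isClosed_frontier) ?_
  rw [hΩ.frontier_eq]
  exact disjoint_sdiff_left.mono_left inter_subset_left

end Boundary

end DirichletForm

end

theorem theorem3p7 {X : Type*} [MetricSpace X] [LocallyCompactSpace X] [SigmaCompactSpace X]
    [MeasurableSpace X] [BorelSpace X] (μ : Measure X) [μ.Regular] [μ.IsOpenPosMeasure]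
    (E : DirichletForm μ) (hreg : E.IsRegular) (hloc : E.IsStronglyLocal)
    (Ω : Set X) (hΩ : IsOpen Ω) :
    E.relCap Ω (frontier Ω) = 0 ↔
      ∀ φ : L2On μ Ω, ∀ t : ℝ, 0 < t →
        (E.dirichletSemigroup Ω t φ : L2 μ) = E.neumannSemigroup Ω t (φ : L2 μ) :=
  ⟨fun hcap φ _ ht => DirichletForm.semigroup_eq_of_restrictL2_mem hreg hloc hΩ
      (fun _ hψ => DirichletForm.restrictL2_mem_dirichletDomain hreg hloc hΩ hcap hψ) φ ht,
    fun h => DirichletForm.relCap_frontier_eq_zero hreg hΩ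
      fun _ hψ => DirichletForm.restrictL2_mem_of_semigroup_eq hreg hΩ h hψ⟩
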